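/- **Definitions.** Let $(M,J)$ be a complex manifold. For a $J$-Hermitian metric $g$ let $\omega(\cdot,\cdot)=g(J\cdot,\cdot)$ be its fundamental form; $g$ is called SKT (or pluriclosed) if $dd^c\omega=0$, where $d^c=J^{-1}dJ$. Let $\nabla$ be the Chern connection of $(J,g)$, that is, the unique linear connection with $\nabla g=0$, $\nabla J=0$ and torsion $T$ satisfying $T^{1,1}=0$, let $R$ be its curvature, and put $$S_{i\bar j}=g^{k\bar l}R_{k\bar l i\bar j},\qquad Q_{i\bar j}=g^{k\bar l}g^{m\bar n}T_{ik\bar n}T_{\bar j\bar l m}.$$ The pluriclosed flow is the evolution equation $\frac{\partial}{\partial t}g=-S+Q$ for Hermitian metrics on $(M,J)$. A solvmanifold is a quotient $M$ of a solvable Lie group $\mathsf G$ by a discrete subgroup $\Gamma$ (acting by left translations; $M$ need not be compact, and $\Gamma=1$ is allowed). A tensor on $M$, or a solution of the flow on $M$, is called invariant if its lift to $\mathsf G$ is left-invariant. **Statement.** Let $M$ be a solvmanifold with an invariant complex structure $J$ and an invariant SKT metric $g_0$. Then every invariant solution of the pluriclosed flow on $(M,J)$ starting from $g_0$ exists for all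 positive times: there is an invariant solution $(g(t))_{t\in[0,\infty)}$ with $g(0)=g_0$, and every invariant solution on an interval $[0,T)$ starting from $g_0$ coincides with $g(t)$ for all $t\in[0,T)$. In particular this holds on every solvable Lie group $\mathsf G$ with a left-invariant SKT structure $(J,g_0)$. -/

import Mathlib

open scoped Manifold ContDiff Bundle
open Bundle VectorField

namespace Pluriclosed

noncomputable section

section Manifold

/-! ### Hermitian geometry on a smooth real manifold `M` modelled on a real vector space `E` -/

variable (E : Type*) [NormedAddCommGroup E] [NormedSpace ℝ E]
variable (M : Type*) [TopologicalSpace M] [ChartedSpace E M] [IsManifold 𝓘(ℝ, E) ∞ M]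

/-- Vector fields on `M` (no regularity required). -/
abbrev VField : Type _ := (x : M) → TangentSpace 𝓘(ℝ, E) x

/-- Smooth Riemannian metrics on `M`. -/
abbrev Metric : Type _ :=
  ContMDiffRiemannianMetric 𝓘(ℝ, E) ∞ E (fun x : M => TangentSpace 𝓘(ℝ, E) x)

/-- A complex structure on `M`: a smooth field of endomorphisms `J` of the tangent spaces with
`J² = -1` whose Nijenhuis tensor
`N_J(X, Y) = [X, Y] + J[JX, Y] + J[X, JY] - [JX, JY]` vanishes. The last condition is imposed at
every point `x`, on all vector fields which are smooth at `x`. -/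
structure ComplexStructure where
  /-- The endomorphism `J` of the tangent space at `x`. -/
  toFun (x : M) : TangentSpace 𝓘(ℝ, E) x →L[ℝ] TangentSpace 𝓘(ℝ, E) x
  sq (x : M) (v : TangentSpace 𝓘(ℝ, E) x) : toFun x (toFun x v) = -v
  contMDiff : ContMDiff 𝓘(ℝ, E) (𝓘(ℝ, E).prod 𝓘(ℝ, E →L[ℝ] E)) ∞
    (fun x => TotalSpace.mk' (E →L[ℝ] E)
      (E := fun x : M => TangentSpace 𝓘(ℝ, E) x →L[ℝ] TangentSpace 𝓘(ℝ, E) x) x (toFun x))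
  nijenhuis (x : M) (X Y : VField E M)
    (hX : CMDiffAt ∞ (T% X) x) (hY : CMDiffAt ∞ (T% Y) x) :
    mlieBracket 𝓘(ℝ, E) X Y x
      + toFun x (mlieBracket 𝓘(ℝ, E) (fun y => toFun y (X y)) Y x)
      + toFun x (mlieBracket 𝓘(ℝ, E) X (fun y => toFun y (Y y)) x)
      - mlieBracket 𝓘(ℝ, E) (fun y => toFun y (X y)) (fun y => toFun y (Y y)) x = 0

variable {E M}

instance : CoeFun (ComplexStructure E M)
    fun _ => (x : M) → TangentSpace 𝓘(ℝ, E) x →L[ℝ] TangentSpace 𝓘(ℝ, E) x :=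
  ⟨ComplexStructure.toFun⟩

/-- The vector field `JX`. -/
def ComplexStructure.apply (J : ComplexStructure E M) (X : VField E M) : VField E M :=
  fun x => J x (X x)

/-- The metric `g` is Hermitian: `J` is `g`-orthogonal. -/
def IsHermitian (J : ComplexStructure E M) (g : Metric E M) : Prop :=
  ∀ (x : M) (u v : TangentSpace 𝓘(ℝ, E) x), g.inner x (J x u) (J x v) = g.inner x u v

/-! Differential forms are evaluated on vector fields, and the exterior derivative is given by the
invariant formula. -/

/-- The exterior derivative `dα` of a two-form `α`:
`X α(Y, Z) - Y α(X, Z) + Z α(X, Y) - α([X, Y], Z) + α([X, Z], Y) - α([Y, Z], X)`. -/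
def extDerivTwo (α : VField E M → VField E M → M → ℝ) (X Y Z : VField E M) (x : M) : ℝ :=
  mvfderiv 𝓘(ℝ, E) (α Y Z) x (X x)
    - mvfderiv 𝓘(ℝ, E) (α X Z) x (Y x)
    + mvfderiv 𝓘(ℝ, E) (α X Y) x (Z x)
    - α (mlieBracket 𝓘(ℝ, E) X Y) Z x
    + α (mlieBracket 𝓘(ℝ, E) X Z) Y x
    - α (mlieBracket 𝓘(ℝ, E) Y Z) X x

/-- The exterior derivative `dβ` of a three-form `β`, evaluated on `W, X, Y, Z`. -/
def extDerivThree (β : VField E M → VField E M → VField E M → M → ℝ)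
    (W X Y Z : VField E M) (x : M) : ℝ :=
  mvfderiv 𝓘(ℝ, E) (β X Y Z) x (W x)
    - mvfderiv 𝓘(ℝ, E) (β W Y Z) x (X x)
    + mvfderiv 𝓘(ℝ, E) (β W X Z) x (Y x)
    - mvfderiv 𝓘(ℝ, E) (β W X Y) x (Z x)
    - β (mlieBracket 𝓘(ℝ, E) W X) Y Z x
    + β (mlieBracket 𝓘(ℝ, E) W Y) X Z x
    - β (mlieBracket 𝓘(ℝ, E) W Z) X Y x
    - β (mlieBracket 𝓘(ℝ, E) X Y) W Z x
    + β (mlieBracket 𝓘(ℝ, E) X Z) W Y x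
    - β (mlieBracket 𝓘(ℝ, E) Y Z) W X x

/-- The fundamental form `ω(X, Y) = g(JX, Y)`. -/
def fundamentalForm (J : ComplexStructure E M) (g : Metric E M) (X Y : VField E M) (x : M) : ℝ :=
  g.inner x (J x (X x)) (Y x)

/-- The three-form `dᶜω`, that is, `dᶜω(X, Y, Z) = -dω(JX, JY, JZ)`: as `ω` is `J`-invariant, this
is `J⁻¹ d J ω`, where `J` acts on forms by precomposition. -/
def dcFundamentalForm (J : ComplexStructure E M) (g : Metric E M)
    (X Y Z : VField E M) (x : M) : ℝ :=
  -extDerivTwo (fundamentalForm J g) (J.apply X) (J.apply Y) (J.apply Z) x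

/-- The SKT (or pluriclosed) condition `d dᶜ ω = 0`, tested at every point `x` on all vector fields
which are smooth at `x`. -/
def IsPluriclosed (J : ComplexStructure E M) (g : Metric E M) : Prop :=
  ∀ (x : M) (W X Y Z : VField E M),
    CMDiffAt ∞ (T% W) x → CMDiffAt ∞ (T% X) x → CMDiffAt ∞ (T% Y) x → CMDiffAt ∞ (T% Z) x →
      extDerivThree (dcFundamentalForm J g) W X Y Z x = 0

/-- The curvature tensor `R(u, v)w = ∇_u ∇_v w - ∇_v ∇_u w - ∇_[u, v] w` at `x` of a linear
connection `∇`, computed by extending `u, v, w` to vector fields which are smooth near `x`.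
In Mathlib `∇ Y x u` is the derivative at `x` of the vector field `Y` in the direction `u`. -/
def curvature (nabla : CovariantDerivative 𝓘(ℝ, E) E (fun x : M => TangentSpace 𝓘(ℝ, E) x)) (x : M)
    (u v w : TangentSpace 𝓘(ℝ, E) x) : TangentSpace 𝓘(ℝ, E) x :=
  let U : VField E M := FiberBundle.extend E u
  let V : VField E M := FiberBundle.extend E v
  let W : VField E M := FiberBundle.extend E w
  nabla (fun y => nabla W y (V y)) x u - nabla (fun y => nabla W y (U y)) x v
    - nabla W x (mlieBracket 𝓘(ℝ, E) U V x)

variable [FiniteDimensional ℝ E]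

/-- `∇` is the Chern connection of the Hermitian structure `(J, g)`: it is smooth, `∇g = 0`,
`∇J = 0`, and the `(1,1)`-part of its torsion `T` vanishes. For the complex bilinear extension of
`T`, the last condition is `T(u - iJu, v + iJv) = 0` for all real `u, v`, which amounts to
`T(Ju, Jv) = -T(u, v)`. -/
structure IsChernConnection (J : ComplexStructure E M) (g : Metric E M)
    (nabla : CovariantDerivative 𝓘(ℝ, E) E (fun x : M => TangentSpace 𝓘(ℝ, E) x)) : Prop where
  smooth : nabla.ContMDiffCovariantDerivative ∞
  metric (x : M) (Y Z : VField E M) (u : TangentSpace 𝓘(ℝ, E) x)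
    (hY : MDiffAt (T% Y) x) (hZ : MDiffAt (T% Z) x) :
    mvfderiv 𝓘(ℝ, E) (fun y => g.inner y (Y y) (Z y)) x u
      = g.inner x (nabla Y x u) (Z x) + g.inner x (Y x) (nabla Z x u)
  complex (x : M) (Y : VField E M) (u : TangentSpace 𝓘(ℝ, E) x) (hY : MDiffAt (T% Y) x) :
    nabla (J.apply Y) x u = J x (nabla Y x u)
  torsion (x : M) (u v : TangentSpace 𝓘(ℝ, E) x) :
    nabla.torsion x (J x u) (J x v) = -nabla.torsion x u v

/-- `e` is a `g`-orthonormal frame of the tangent space at `x`. -/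
def IsOrthonormalFrame (g : Metric E M) (x : M)
    (e : Fin (Module.finrank ℝ E) → TangentSpace 𝓘(ℝ, E) x) : Prop :=
  ∀ a b, g.inner x (e a) (e b) = if a = b then 1 else 0

/-- The second Chern-Ricci tensor `S_{i j̄} = g^{k l̄} R_{k l̄ i j̄}`, where
`R_{k l̄ i j̄} = g(R(Z_k, Z̄_l) Z_i, Z̄_j)`, as a real symmetric `J`-invariant tensor. For a
`g`-orthonormal frame `e` one has `∑ g^{k l̄} A(Z_k, Z̄_l) = (i/2) ∑ A(e_a, J e_a)` for all
skew-symmetric `A`, and `i Z = J Z` for `Z` of type `(1,0)`. -/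
def secondChernRicci (J : ComplexStructure E M) (g : Metric E M)
    (nabla : CovariantDerivative 𝓘(ℝ, E) E (fun x : M => TangentSpace 𝓘(ℝ, E) x)) (x : M)
    (e : Fin (Module.finrank ℝ E) → TangentSpace 𝓘(ℝ, E) x)
    (u v : TangentSpace 𝓘(ℝ, E) x) : ℝ :=
  (1 / 2 : ℝ) * ∑ a, g.inner x (curvature nabla x (e a) (J x (e a)) (J x u)) v

/-- The tensor `Q_{i j̄} = g^{k l̄} g^{m n̄} T_{i k n̄} T_{j̄ l̄ m}` as a real symmetric `J`-invariant
tensor. The sum over a unitary frame `Z_k` is `∑ g(T(Z_i, Z_k), T(Z̄_j, Z̄_k))`; for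
`Z_k = (e - iJe)/√2` and `Z` of type `(1,0)` one has `T(Z, Z_k) = √2 T(Z, e)`, and `e`, `Je`
contribute equally to the sum below. -/
def torsionSquare (g : Metric E M)
    (nabla : CovariantDerivative 𝓘(ℝ, E) E (fun x : M => TangentSpace 𝓘(ℝ, E) x)) (x : M)
    (e : Fin (Module.finrank ℝ E) → TangentSpace 𝓘(ℝ, E) x)
    (u v : TangentSpace 𝓘(ℝ, E) x) : ℝ :=
  ∑ a, g.inner x (nabla.torsion x u (e a)) (nabla.torsion x v (e a))

/-- The family `g t`, for `t` in the time interval `s`, is a solution of the pluriclosed flow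
`∂g/∂t = -S + Q` on the complex manifold `(M, J)`. At an endpoint belonging to `s` the derivative is
one-sided. -/
def IsPluriclosedFlow (J : ComplexStructure E M) (g : ℝ → Metric E M) (s : Set ℝ) : Prop :=
  ∀ t ∈ s, IsHermitian J (g t) ∧
    ∃ nabla : CovariantDerivative 𝓘(ℝ, E) E (fun x : M => TangentSpace 𝓘(ℝ, E) x),
      IsChernConnection J (g t) nabla ∧
      ∀ (x : M) (e : Fin (Module.finrank ℝ E) → TangentSpace 𝓘(ℝ, E) x),
        IsOrthonormalFrame (g t) x e → ∀ u v : TangentSpace 𝓘(ℝ, E) x,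
          HasDerivWithinAt (fun τ => (g τ).inner x u v)
            (-secondChernRicci J (g t) nabla x e u v + torsionSquare (g t) nabla x e u v) s t

end Manifold

section Quotient

/-! ### Quotients of Lie groups by discrete subgroups, and invariant structures on them -/

variable {E : Type*} [NormedAddCommGroup E] [NormedSpace ℝ E]
variable {G : Type*} [TopologicalSpace G] [ChartedSpace E G] [Group G]
variable {M : Type*} [TopologicalSpace M] [ChartedSpace E M]

variable (E) in
/-- The smooth manifold `M`, with projection `proj : G → M`, is the quotient of the Lie group `G` by
the action of the discrete subgroup `Γ` by left translations (these are the quotients to which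
left-invariant tensors descend). -/
structure IsDiscreteQuotient (Γ : Subgroup G) (proj : G → M) : Prop where
  discrete : DiscreteTopology Γ
  surjective : Function.Surjective proj
  isLocalDiffeomorph : IsLocalDiffeomorph 𝓘(ℝ, E) 𝓘(ℝ, E) ∞ proj
  eq_iff (p q : G) : proj p = proj q ↔ ∃ γ ∈ Γ, q = γ * p

/-- The lift `proj^* g` of the metric `g` on `M` to `G` is left-invariant. -/
def IsInvariantMetric [IsManifold 𝓘(ℝ, E) ∞ M] (proj : G → M) (g : Metric E M) : Prop :=
  ∀ (a p : G) (u v : TangentSpace 𝓘(ℝ, E) p),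
    g.inner (proj (a * p))
        (mfderiv 𝓘(ℝ, E) 𝓘(ℝ, E) proj (a * p) (mfderiv 𝓘(ℝ, E) 𝓘(ℝ, E) (fun q => a * q) p u))
        (mfderiv 𝓘(ℝ, E) 𝓘(ℝ, E) proj (a * p) (mfderiv 𝓘(ℝ, E) 𝓘(ℝ, E) (fun q => a * q) p v))
      = g.inner (proj p) (mfderiv 𝓘(ℝ, E) 𝓘(ℝ, E) proj p u) (mfderiv 𝓘(ℝ, E) 𝓘(ℝ, E) proj p v)

/-- The complex structure `J` on `M` lifts to a left-invariant field of endomorphisms `K` on `G`. -/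
def IsInvariantComplexStructure [IsManifold 𝓘(ℝ, E) ∞ M] (proj : G → M)
    (J : ComplexStructure E M) : Prop :=
  ∃ K : (p : G) → TangentSpace 𝓘(ℝ, E) p →L[ℝ] TangentSpace 𝓘(ℝ, E) p,
    (∀ (p : G) (u : TangentSpace 𝓘(ℝ, E) p),
      mfderiv 𝓘(ℝ, E) 𝓘(ℝ, E) proj p (K p u) = J (proj p) (mfderiv 𝓘(ℝ, E) 𝓘(ℝ, E) proj p u)) ∧
    ∀ (a p : G) (u : TangentSpace 𝓘(ℝ, E) p),
      mfderiv 𝓘(ℝ, E) 𝓘(ℝ, E) (fun q => a * q) p (K p u)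
        = K (a * p) (mfderiv 𝓘(ℝ, E) 𝓘(ℝ, E) (fun q => a * q) p u)

end Quotient

end

end Pluriclosed

/-!
The left-invariant vector fields of `G` descend to a framing of `M` with constant structure
constants. In this framing an invariant complex structure and an invariant metric are an
endomorphism `J` and an inner product `g` of the Lie algebra, the Chern connection is a constant
bilinear map, and the pluriclosed flow becomes an ordinary differential equation for `g`
(`Framing`, `Framing.velocity_eq`, `Framing.isPluriclosedFlow`,
`Framing.hasDerivWithinAt_of_isPluriclosedFlow`). It remains to see that this equation has global
solutions; the initial value determines them because the velocity is a continuously differentiable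
function of the Gram matrix of `g` (`velocityForm_flow_unique`).

*The velocity.* Let `D` be the Bismut connection, `H` its torsion three-form, so that the SKT
condition reads `dH = 0`, and let `η y = ½ ∑ ⟨D_y e_a, J e_a⟩`. For SKT metrics `-S + Q` is the
symmetric part of `(x, v) ↦ η [J x, v]` (`neg_sum_curvature_add_torsion`), and the skew-symmetric
part `β` of that form drives the torsion: `H' = dβ` (`bismutTorsion_flowBilin`). Hence the SKT
condition is preserved (`flow_bismutTorsionDeriv`). The Jacobi identity and `dH = 0` combine to a
cyclic identity for `D` (`sum_bismut_deriv_cyclic`), which yields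
`η [J x, v] = -R(x, v) + ⟨D_v w, x⟩` for some vector `w`, where
`R(x, v) = ∑ ⟨D_{D'_{e_a} v} e_a, x⟩` is the reduced Ricci tensor and `D'` is the connection with
torsion `-H` (`exists_bismutPotential_bracket_eq`).

*The energy.* Let the orthonormal frame `e` move along with `g`, and let `c` and `H` stand for the
components of the bracket and of the torsion in this frame. The first variation of
`F = -¼ |c|² - ½ ∑ c_{abk} c_{akb} - |H|² / 12` under changes of the frame and of `H` by an exact form
is given by `R` (`energy_variation`). Inner derivations of the bracket, which change `H` by an exact
form, do not change `F`, and neither do the zero variations `d(d⟨·, w⟩)` of `H`; thus the terms `⟨D_v w, x⟩` are orthogonal to `R` (`sum_structureRicci_gauge`), and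
`F' = |R|²` along the flow (`energy_variation_flow`). The derivative of `N = |c|²` also involves only
`R`, since `N` is invariant under inner derivations, and therefore `N' ≤ C (1 + F') N`: the quantity
`N exp (-C (t + F))` does not increase.

*Solvability.* In an orthonormal frame adapted to the derived series one sees that
`∑ c_{abk} c_{akb} ≥ -½ |c|²` (`sum_bracket_ge`), whence `F ≤ 0` (`structureEnergy_nonpos`). Thus `N`
grows at most exponentially (`flow_bracket_le`). The equation for a frame and its dual coframe is
polynomial, with coefficients controlled by `N`, so that Grönwall's inequality bounds its solutions
on bounded time intervals and they exist for all positive times (`exists_frame_flow`,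
`exists_flow`).

Solvability of the group `G` has to be turned into solvability of its Lie algebra. In a chart around
`1`, the commutator of two curves with leading terms `τ α` and `τ β` has the leading term
`τ² [α, β]` (`isLittleO_commutator`, `lieGroupBracket_eq_crossDeriv`). Hence iterated brackets are
the leading terms of curves in the derived series of `G`, and they vanish where that series is
trivial (`exists_curve_derivedSeries`, `derivedSpace_eq_bot`).
-/


namespace Pluriclosed

section LieHermitian

/-! ### Hermitian structures on Lie algebras -/

variable {V ι : Type*} [AddCommGroup V] [Module ℝ V] [Fintype ι]

/-- `br` is a Lie bracket and `J` an integrable complex structure for it. -/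
structure IsComplexLie (br : V →ₗ[ℝ] V →ₗ[ℝ] V) (J : V →ₗ[ℝ] V) : Prop where
  skew (x y : V) : br x y = -br y x
  jacobi (x y z : V) : br (br x y) z + br (br y z) x + br (br z x) y = 0
  sq (x : V) : J (J x) = -x
  nijenhuis (x y : V) : br x y + J (br (J x) y) + J (br x (J y)) - br (J x) (J y) = 0

/-- `g` is a symmetric `J`-invariant bilinear form, and `e` is a Parseval frame for it. (When `e` has
`dim V` members this says that `e` is an orthonormal basis; only the expansion formula is needed.) -/
structure IsParsevalFrame (J : V →ₗ[ℝ] V) (g : V →ₗ[ℝ] V →ₗ[ℝ] ℝ) (e : ι → V) : Prop where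
  symm (x y : V) : g x y = g y x
  inv (x y : V) : g (J x) (J y) = g x y
  expand (x : V) : ∑ a, g x (e a) • e a = x

/-- The torsion three-form `H` of the Bismut connection, `H(x, y, z) = dω(Jx, Jy, Jz)`. -/
def bismutTorsion (br : V →ₗ[ℝ] V →ₗ[ℝ] V) (J : V →ₗ[ℝ] V) (g : V →ₗ[ℝ] V →ₗ[ℝ] ℝ)
    (x y z : V) : ℝ :=
  -(g (br (J x) (J y)) z + g (br (J y) (J z)) x + g (br (J z) (J x)) y)

/-- The exterior derivative `dH` of the Bismut torsion. -/
def bismutTorsionDeriv (br : V →ₗ[ℝ] V →ₗ[ℝ] V) (J : V →ₗ[ℝ] V) (g : V →ₗ[ℝ] V →ₗ[ℝ] ℝ)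
    (w x y z : V) : ℝ :=
  -bismutTorsion br J g (br w x) y z + bismutTorsion br J g (br w y) x z
    - bismutTorsion br J g (br w z) x y - bismutTorsion br J g (br x y) w z
    + bismutTorsion br J g (br x z) w y - bismutTorsion br J g (br y z) w x

/-- The coefficient `g(D_x y, z)` of the Bismut connection `D`, by Koszul's formula. -/
noncomputable def bismutCoeff (br : V →ₗ[ℝ] V →ₗ[ℝ] V) (J : V →ₗ[ℝ] V) (g : V →ₗ[ℝ] V →ₗ[ℝ] ℝ)
    (x y z : V) : ℝ :=
  1 / 2 * (g (br x y) z - g (br y z) x + g (br z x) y + bismutTorsion br J g x y z)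

/-- The coefficient `g(A_x y, z)` of the Chern connection `A`. -/
noncomputable def chernCoeff (br : V →ₗ[ℝ] V →ₗ[ℝ] V) (J : V →ₗ[ℝ] V) (g : V →ₗ[ℝ] V →ₗ[ℝ] ℝ)
    (x y z : V) : ℝ :=
  1 / 2 * (g (br x y) z + g (br z x) y + g (J (br (J x) y)) z - g (J (br (J x) z)) y)

/-- The one-form `η`, minus whose differential is the Ricci form of the Bismut connection. -/
noncomputable def bismutPotential (br : V →ₗ[ℝ] V →ₗ[ℝ] V) (J : V →ₗ[ℝ] V) (g : V →ₗ[ℝ] V →ₗ[ℝ] ℝ)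
    (e : ι → V) (y : V) : ℝ :=
  1 / 2 * ∑ a, bismutCoeff br J g y (e a) (J (e a))

/-- The symmetric form with fundamental two-form `-(dη)^{1,1}`; it is the velocity of the
pluriclosed flow at an SKT metric. -/
noncomputable def flowForm (br : V →ₗ[ℝ] V →ₗ[ℝ] V) (J : V →ₗ[ℝ] V) (g : V →ₗ[ℝ] V →ₗ[ℝ] ℝ)
    (e : ι → V) (u v : V) : ℝ :=
  1 / 2 * (bismutPotential br J g e (br (J u) v) - bismutPotential br J g e (br u (J v)))

/-- The algebraic conditions on the Chern connection `A` of a left-invariant Hermitian metric. -/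
structure IsChernForm (br : V →ₗ[ℝ] V →ₗ[ℝ] V) (J : V →ₗ[ℝ] V) (g : V →ₗ[ℝ] V →ₗ[ℝ] ℝ)
    (A : V →ₗ[ℝ] V →ₗ[ℝ] V) : Prop where
  skew (x y z : V) : g (A x y) z + g y (A x z) = 0
  complex (x y : V) : A x (J y) = J (A x y)
  torsion (x y : V) : A (J x) (J y) - A (J y) (J x) - br (J x) (J y) = -(A x y - A y x - br x y)

/-- The Bismut connection `D` of `H`, and the connection `D'` with the opposite torsion. -/
structure IsBismutPair (br : V →ₗ[ℝ] V →ₗ[ℝ] V) (J : V →ₗ[ℝ] V) (g : V →ₗ[ℝ] V →ₗ[ℝ] ℝ)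
    (D D' : V →ₗ[ℝ] V →ₗ[ℝ] V) : Prop where
  skew (x y z : V) : g (D x y) z + g y (D x z) = 0
  skew' (x y z : V) : g (D' x y) z + g y (D' x z) = 0
  complex (x y : V) : D x (J y) = J (D x y)
  bracket (x y : V) : br x y = D x y - D' y x
  torsion (x y z : V) : g (D x y) z - g (D' x y) z = bismutTorsion br J g x y z

variable {br : V →ₗ[ℝ] V →ₗ[ℝ] V} {J : V →ₗ[ℝ] V} {g : V →ₗ[ℝ] V →ₗ[ℝ] ℝ} {e : ι → V}
  {A D D' : V →ₗ[ℝ] V →ₗ[ℝ] V}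

namespace IsParsevalFrame

variable (hu : IsParsevalFrame J g e)
include hu

theorem parseval (x y : V) : ∑ a, g x (e a) * g y (e a) = g x y := by
  conv_rhs => rw [← hu.expand y]
  simp [mul_comm]

theorem ext {x y : V} (h : ∀ z, g x z = g y z) : x = y := by
  rw [← hu.expand x, ← hu.expand y]
  simp [h]

theorem J_left (hJ : ∀ x, J (J x) = -x) (x y : V) : g (J x) y = -g x (J y) := by
  have := hu.inv x (J y)
  rw [hJ] at this
  simp at this
  linarith

/-- The contraction of a bilinear form does not depend on the frame. -/
theorem contraction_eq {κ : Type*} [Fintype κ] {f : κ → V} (hf : IsParsevalFrame J g f)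
    (β : V →ₗ[ℝ] V →ₗ[ℝ] ℝ) : ∑ a, β (e a) (e a) = ∑ k, β (f k) (f k) := by
  have h1 : ∀ a, β (e a) (e a) = ∑ k, g (e a) (f k) * β (f k) (e a) := by
    intro a
    have h := congrArg (fun x => β x (e a)) (hf.expand (e a))
    simpa using h.symm
  have h2 : ∀ k, β (f k) (f k) = ∑ a, g (e a) (f k) * β (f k) (e a) := by
    intro k
    have h := congrArg (β (f k)) (hu.expand (f k))
    simpa [hu.symm (f k)] using h.symm
  simp_rw [h1, h2]
  exact Finset.sum_comm

theorem J_frame (hJ : ∀ x, J (J x) = -x) : IsParsevalFrame J g (fun a => J (e a)) where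
  symm := hu.symm
  inv := hu.inv
  expand x := by
    have h := congrArg J (hu.expand (-J x))
    simp only [map_sum, map_smul, map_neg, hJ, neg_neg] at h
    conv_rhs => rw [← h]
    refine Finset.sum_congr rfl fun a _ => ?_
    rw [← neg_eq_iff_eq_neg.mpr (hu.J_left hJ x (e a))]
    simp

/-- The pairing of a skew with a symmetric endomorphism vanishes. -/
theorem sum_skew_symm {X S : V →ₗ[ℝ] V} (hX : ∀ x y, g (X x) y = -g x (X y))
    (hS : ∀ x y, g (S x) y = g x (S y)) : ∑ a, g (X (e a)) (S (e a)) = 0 := by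
  have h : ∑ a, g (X (e a)) (S (e a))
      = ∑ a, ∑ b, g (X (e a)) (e b) * g (S (e a)) (e b) :=
    Finset.sum_congr rfl fun a _ => (hu.parseval _ _).symm
  have h2 : ∑ a, ∑ b, g (X (e a)) (e b) * g (S (e a)) (e b)
      = -∑ a, ∑ b, g (X (e a)) (e b) * g (S (e a)) (e b) := by
    conv_lhs => rw [Finset.sum_comm]
    simp_rw [← Finset.sum_neg_distrib]
    refine Finset.sum_congr rfl fun a _ => Finset.sum_congr rfl fun b _ => ?_
    rw [hX, hS, hu.symm (e b) (X (e a)), hu.symm (e b) (S (e a))]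
    ring
  rw [h]
  linarith

end IsParsevalFrame

/-! ### The Bismut connection of a Hermitian Lie algebra -/

theorem bismutTorsion_swap (hc : ∀ x y, br x y = -br y x) (x y z : V) :
    bismutTorsion br J g x y z = -bismutTorsion br J g y x z := by
  simp only [bismutTorsion]
  rw [hc (J x) (J y), hc (J y) (J z), hc (J z) (J x)]
  simp
  ring

theorem bismutTorsion_rotate (x y z : V) :
    bismutTorsion br J g x y z = bismutTorsion br J g y z x := by
  simp only [bismutTorsion]
  ring

theorem bismutTorsion_add_left (x x' y z : V) : bismutTorsion br J g (x + x') y z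
    = bismutTorsion br J g x y z + bismutTorsion br J g x' y z := by
  simp [bismutTorsion]
  ring

theorem bismutTorsion_smul_left (r : ℝ) (x y z : V) : bismutTorsion br J g (r • x) y z
    = r * bismutTorsion br J g x y z := by
  simp [bismutTorsion]
  ring

namespace IsChernForm

variable (hc : IsComplexLie br J) (hA : IsChernForm br J g A)
include hc hA

/-- The torsion of the Chern connection is complex linear. -/
theorem torsion_complex (x y : V) :
    A (J x) y - A y (J x) - br (J x) y = J (A x y - A y x - br x y) := by
  have h1 := congrArg J (hA.torsion x y)
  have h3 := hA.torsion x (J y)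
  have h5 := congrArg J (hc.nijenhuis x y)
  simp only [hA.complex, hc.sq, map_neg, LinearMap.neg_apply, map_sub, map_add, map_zero] at h1 h3 h5
  simp only [hA.complex, map_sub]
  linear_combination (norm := module) (1 / 2 : ℝ) • h5 - (1 / 2 : ℝ) • h1 - (1 / 2 : ℝ) • h3

variable (hu : IsParsevalFrame J g e)
include hu

/-- The Bismut torsion is minus the skew-symmetrization of the Chern torsion. -/
theorem bismutTorsion_eq (x y z : V) : bismutTorsion br J g x y z
    = -(g (A x y - A y x - br x y) z + g (A y z - A z y - br y z) x
      + g (A z x - A x z - br z x) y) := by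
  have key : ∀ u v w : V, g (A (J u) (J v)) w = g (A (J u) (J w)) v := by
    intro u v w
    have s := hA.skew (J u) v (J w)
    rw [hA.complex] at s
    rw [hA.complex, hA.complex]
    linarith [hu.J_left hc.sq (A (J u) v) w, hu.symm v (J (A (J u) w))]
  have t : ∀ u v w : V, g (br (J u) (J v)) w
      = g (A (J u) (J v)) w - g (A (J v) (J u)) w + g (A u v - A v u - br u v) w := by
    intro u v w
    have := congrArg (fun z => g z w) (hA.torsion u v)
    simp only [map_sub, map_neg, LinearMap.sub_apply, LinearMap.neg_apply] at this ⊢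
    linarith
  simp only [bismutTorsion, t]
  linarith [key x y z, key y z x, key z x y]

/-- The Chern connection is determined by its algebraic properties. -/
theorem eq_chernCoeff (x y z : V) : g (A x y) z = chernCoeff br J g x y z := by
  have t1 := congrArg (fun w => g (J w) z) (torsion_complex hc hA x y)
  have t2 := congrArg (fun w => g (J w) y) (torsion_complex hc hA x z)
  have s := hA.skew (J x) y (J z)
  have s3 := hA.skew x y z
  have h := congrArg (fun w => g w y) (hc.skew z x)
  simp only [hA.complex, map_sub, LinearMap.sub_apply, hc.sq, map_neg, LinearMap.neg_apply]
    at t1 t2 s h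
  simp only [chernCoeff]
  linarith [hu.J_left hc.sq (A (J x) y) z, hu.symm y (J (A (J x) z)), hu.symm y (A x z)]

end IsChernForm

/-- The transpose `(x, y) ↦ (B x)ᵗ y` of a bilinear map with respect to `g`. -/
noncomputable def transposeMap (g : V →ₗ[ℝ] V →ₗ[ℝ] ℝ) (e : ι → V) (B : V →ₗ[ℝ] V →ₗ[ℝ] V) :
    V →ₗ[ℝ] V →ₗ[ℝ] V :=
  LinearMap.mk₂ ℝ (fun x y => ∑ a, g y (B x (e a)) • e a)
    (by intros; simp [add_smul, Finset.sum_add_distrib])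
    (by intros; simp [mul_smul, Finset.smul_sum])
    (by intros; simp [add_smul, Finset.sum_add_distrib])
    (by intros; simp [mul_smul, Finset.smul_sum])

theorem IsParsevalFrame.transposeMap_apply (hu : IsParsevalFrame J g e)
    (B : V →ₗ[ℝ] V →ₗ[ℝ] V) (x y z : V) :
    g (transposeMap g e B x y) z = g y (B x z) := by
  conv_rhs => rw [← hu.expand z]
  simp only [transposeMap, LinearMap.mk₂_apply, map_sum, LinearMap.sum_apply, map_smul,
    LinearMap.smul_apply, smul_eq_mul]
  refine Finset.sum_congr rfl fun a _ => ?_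
  rw [hu.symm z (e a)]
  ring

/-- The Bismut connection, from the Chern connection. -/
theorem IsChernForm.exists_isBismutPair (hc : IsComplexLie br J) (hu : IsParsevalFrame J g e)
    (hA : IsChernForm br J g A) :
    ∃ D D' : V →ₗ[ℝ] V →ₗ[ℝ] V, IsBismutPair br J g D D' ∧
      (∀ x y z, g (D' x y) z = g (A x y) z + g (A y z - A z y - br y z) x) := by
  let T : V →ₗ[ℝ] V →ₗ[ℝ] V := A - A.flip - br
  have hT : ∀ x y, T x y = A x y - A y x - br x y := fun x y => rfl
  have hTJ : ∀ x y, T (J x) y = J (T x y) := torsion_complex hc hA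
  have hsk : ∀ x y, T x y = -T y x := by
    intro x y
    rw [hT, hT, hc.skew x y]
    abel
  have hTJ' : ∀ x y, T x (J y) = J (T x y) := by
    intro x y
    rw [hsk, hTJ, hsk x y, map_neg]
  -- With the Chern torsion `T`, the connections are `D = A - T + Tᵗ` and `D' = A + (Tᵗ).flip`,
  -- where `⟨Tᵗ(x, y), z⟩ = ⟨y, T(x, z)⟩`.
  let D := A - T + transposeMap g e T
  let D' := A + (transposeMap g e T).flip
  have hD : ∀ x y z, g (D x y) z = g (A x y) z - g (T x y) z + g y (T x z) := by
    intro x y z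
    simp [D, hu.transposeMap_apply]
  have hD' : ∀ x y z, g (D' x y) z = g (A x y) z + g (T y z) x := by
    intro x y z
    simp [D', hu.transposeMap_apply, hu.symm x]
  refine ⟨D, D', ⟨?_, ?_, ?_, ?_, ?_⟩, hD'⟩
  · intro x y z
    rw [hu.symm y, hD, hD, hu.symm z, hu.symm y (T x z)]
    linarith [hA.skew x y z, hu.symm y (A x z)]
  · intro x y z
    rw [hu.symm y, hD', hD', hsk z y]
    simp only [map_neg, LinearMap.neg_apply]
    linarith [hA.skew x y z, hu.symm y (A x z)]
  · intro x y
    refine hu.ext fun z => ?_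
    have h1 := hD x (J y) z
    have h2 := hD x y (J z)
    rw [hA.complex, hTJ'] at h1
    rw [hTJ'] at h2
    have hJ := hu.J_left hc.sq
    linarith [hJ (D x y) z, hJ (A x y) z, hJ (T x y) z, hJ y (T x z)]
  · intro x y
    simp [D, D', T]
    abel
  · intro x y z
    rw [hD, hD', bismutTorsion_eq hc hA hu]
    have := hsk z x
    rw [← hT, ← hT, ← hT, this]
    simp only [map_neg, LinearMap.neg_apply]
    rw [hu.symm y (T x z)]
    ring

end LieHermitian

section Curvature

variable {V ι : Type*} [AddCommGroup V] [Module ℝ V] [Fintype ι]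
  {br : V →ₗ[ℝ] V →ₗ[ℝ] V} {J : V →ₗ[ℝ] V} {g : V →ₗ[ℝ] V →ₗ[ℝ] ℝ} {e : ι → V}
  {A D D' : V →ₗ[ℝ] V →ₗ[ℝ] V}

/-! ### Existence of the Chern connection -/

/-- The Chern connection `A` of a Hermitian Lie algebra: `A x` is the skew-symmetric part of the
complex linear endomorphism `ad x + J ∘ ad (J x)`. -/
theorem exists_isChernForm (hc : IsComplexLie br J) (hu : IsParsevalFrame J g e) :
    ∃ A, IsChernForm br J g A := by
  -- `P x = ad x + J ∘ ad (J x)` commutes with `J`, and so does its transpose `B x`.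
  let P : V →ₗ[ℝ] V →ₗ[ℝ] V := br + (br ∘ₗ J).compr₂ J
  have hP : ∀ x y, P x y = br x y + J (br (J x) y) := fun x y => rfl
  have hPJ : ∀ x y, P x (J y) = J (P x y) := by
    intro x y
    have := congrArg J (hc.nijenhuis x y)
    simp only [hP, map_add, map_sub, hc.sq, map_zero] at this ⊢
    linear_combination (norm := module) -(1 : ℝ) • this
  have hPJ' : ∀ x y, P (J x) y = -J (P x y) := by
    intro x y
    simp only [hP, map_add, map_neg, LinearMap.neg_apply, hc.sq]
    module
  have hJ := hu.J_left hc.sq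
  let B := transposeMap g e P
  have hB : ∀ x y z, g (B x y) z = g y (P x z) := hu.transposeMap_apply P
  have hBJ : ∀ x y, B x (J y) = J (B x y) := by
    intro x y
    refine hu.ext fun z => ?_
    rw [hB, hJ, hJ, hB, hPJ]
  have hBJ' : ∀ x y, B (J x) y = J (B x y) := by
    intro x y
    refine hu.ext fun z => ?_
    rw [hB, hJ, hB, hPJ, hPJ', map_neg]
  refine ⟨(1 / 2 : ℝ) • (P - B), ⟨?_, ?_, ?_⟩⟩
  · intro x y z
    simp only [LinearMap.smul_apply, LinearMap.sub_apply, map_smul, map_sub, smul_eq_mul, hB]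
    rw [hu.symm y (B x z), hB, hu.symm z]
    ring
  · intro x y
    simp only [LinearMap.smul_apply, LinearMap.sub_apply, map_smul, map_sub, hPJ, hBJ]
  · intro x y
    simp only [LinearMap.smul_apply, LinearMap.sub_apply, hPJ, hBJ, hPJ', hBJ', hc.sq, map_neg]
    have h := hc.nijenhuis x y
    simp only [hP]
    rw [hc.skew y x, hc.skew (J y) x, map_neg]
    linear_combination (norm := module) h

/-! ### Curvature identities for the Bismut connection -/

/-- The curvature `R(x, y)z` of a left-invariant connection. -/
def lieCurvature (br A : V →ₗ[ℝ] V →ₗ[ℝ] V) (x y z : V) : V :=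
  A x (A y z) - A y (A x z) - A (br x y) z

/-- The tensor `S - Q` in terms of the trace of the curvature of `D'` over the pairs
`(e_a, J e_a)`. The difference of `D'` and the Chern connection is complex antilinear, and the
curvature terms quadratic in it produce `Q`. -/
theorem sum_curvature_sub_torsion (hc : IsComplexLie br J) (hA : IsChernForm br J g A)
    (hu : IsParsevalFrame J g e)
    (hD' : ∀ x y z, g (D' x y) z = g (A x y) z + g (A y z - A z y - br y z) x) (u v : V) :
    1 / 2 * ∑ a, g (lieCurvature br A (e a) (J (e a)) (J u)) v
      - ∑ a, g (A u (e a) - A (e a) u - br u (e a)) (A v (e a) - A (e a) v - br v (e a))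
      = 1 / 2 * (1 / 2 * ∑ a, g (lieCurvature br D' (e a) (J (e a)) (J u)) v
          - 1 / 2 * ∑ a, g (lieCurvature br D' (e a) (J (e a)) u) (J v)) := by
  let T : V →ₗ[ℝ] V →ₗ[ℝ] V := A - A.flip - br
  have hT : ∀ x y, T x y = A x y - A y x - br x y := fun x y => rfl
  have hTJ : ∀ x y, T (J x) y = J (T x y) := hA.torsion_complex hc
  have hsk : ∀ x y, T x y = -T y x := by
    intro x y
    rw [hT, hT, hc.skew x y]
    abel
  have hTJ' : ∀ x y, T x (J y) = J (T x y) := by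
    intro x y
    rw [hsk, hTJ, hsk x y, map_neg]
  have hJ := hu.J_left hc.sq
  -- `B` is the complex antilinear part of `D'`, with `⟨B(x, y), z⟩ = ⟨T(y, z), x⟩`.
  let B := D' - A
  have hDB : ∀ x y, D' x y = A x y + B x y := by
    intro x y
    simp [B]
  have hB : ∀ x y z, g (B x y) z = g (T y z) x := by
    intro x y z
    simp [B, hD', hT]
  have hBJ : ∀ x y, B x (J y) = -J (B x y) := by
    intro x y
    refine hu.ext fun z => ?_
    rw [hB, map_neg, LinearMap.neg_apply, hJ, hB, hTJ, hTJ', neg_neg]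
  have hBJ' : ∀ x y, B (J x) y = J (B x y) := by
    intro x y
    refine hu.ext fun z => ?_
    rw [hB, hJ, hB, hTJ', hJ, neg_neg]
  have hBs : ∀ x y z, g (B x y) z + g y (B x z) = 0 := by
    intro x y z
    rw [hu.symm y, hB, hB, hsk z y]
    simp
  have key : ∀ x, lieCurvature br D' x (J x) (J u) + J (lieCurvature br D' x (J x) u)
      = (2 : ℝ) • lieCurvature br A x (J x) (J u) + (4 : ℝ) • B x (B x u) := by
    intro x
    simp only [lieCurvature, hDB, map_add, map_sub, map_neg, hA.complex, hBJ, hBJ', hc.sq, neg_neg]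
    module
  have key2 : ∀ x, g (lieCurvature br D' x (J x) (J u)) v - g (lieCurvature br D' x (J x) u) (J v)
      = 2 * g (lieCurvature br A x (J x) (J u)) v - 4 * g (B x u) (B x v) := by
    intro x
    have := congrArg (fun w => g w v) (key x)
    simp only [map_add, LinearMap.add_apply, map_smul, LinearMap.smul_apply, smul_eq_mul] at this
    linarith [hJ (lieCurvature br D' x (J x) u) v, hBs x (B x u) v]
  have hQ : ∑ a, g (B (e a) u) (B (e a) v) = ∑ a, g (T u (e a)) (T v (e a)) := by
    have h1 : ∀ a, g (B (e a) u) (B (e a) v) = ∑ b, g (T u (e b)) (e a) * g (T v (e b)) (e a) := by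
      intro a
      rw [← hu.parseval]
      simp_rw [hB]
    simp_rw [h1]
    rw [Finset.sum_comm]
    exact Finset.sum_congr rfl fun b _ => hu.parseval _ _
  have h3 := Finset.sum_congr rfl fun a (_ : a ∈ Finset.univ) => key2 (e a)
  simp only [Finset.sum_sub_distrib, ← Finset.mul_sum, hQ] at h3
  simp only [← hT]
  linarith

namespace IsBismutPair

/-- The Bismut connection is given by Koszul's formula. -/
theorem apply_eq (hc : IsComplexLie br J) (hB : IsBismutPair br J g D D')
    (hs : ∀ x y, g x y = g y x) (x y z : V) : g (D x y) z = bismutCoeff br J g x y z := by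
  have b : ∀ u v w, g (br u v) w = g (D u v) w - g (D' v u) w := by
    intro u v w
    rw [hB.bracket, map_sub, LinearMap.sub_apply]
  have sw := bismutTorsion_swap (J := J) (g := g) hc.skew
  have ro := bismutTorsion_rotate (br := br) (J := J) (g := g)
  simp only [bismutCoeff]
  linarith [b x y z, b y z x, b z x y, hB.torsion y x z, hB.torsion z y x, hB.torsion x z y,
    hB.skew x y z, hB.skew y z x, hB.skew z x y, hs y (D x z), hs z (D y x), hs x (D z y),
    sw x y z, ro x y z, ro y z x, sw y z x, sw z x y, hB.torsion x y z, hB.torsion y z x,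
    hB.torsion z x y]

variable (hc : IsComplexLie br J) (hB : IsBismutPair br J g D D') (hs : ∀ x y, g x y = g y x)
include hc hB hs

/-- The pair symmetry relating the curvatures of the two Bismut connections. -/
theorem curvature_swap (x y z w : V) :
    g (lieCurvature br D' z w x) y
      = g (lieCurvature br D x y z) w - 1 / 2 * bismutTorsionDeriv br J g x y z w := by
  have hD' : ∀ u v, D' u v = D v u + br u v := by
    intro u v
    rw [hc.skew, hB.bracket v u]
    abel
  have K : ∀ u v w, g (D u v) w = 1 / 2 * (g (br u v) w - g (br v w) u + g (br w u) v
      + bismutTorsion br J g u v w) := hB.apply_eq hc hs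
  have K' : ∀ u v w, g (D' u v) w = 1 / 2 * (g (br u v) w - g (br v w) u + g (br w u) v
      - bismutTorsion br J g u v w) := by
    intro u v w
    linarith [hB.torsion u v w, K u v w]
  have jac : ∀ p q r s, g (br (br p q) r) s + g (br (br q r) p) s + g (br (br r p) q) s = 0 := by
    intro p q r s
    have := congrArg (fun t => g t s) (hc.jacobi p q r)
    simpa using this
  have sk : ∀ p q s, g (br p q) s = -g (br q p) s := by
    intro p q s
    rw [hc.skew]
    simp
  have sk2 : ∀ p q r s, g (br (br p q) r) s = -g (br (br q p) r) s := by
    intro p q r s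
    rw [hc.skew p q]
    simp
  have H1 := bismutTorsion_swap (J := J) (g := g) hc.skew
  have H2 := bismutTorsion_rotate (br := br) (J := J) (g := g)
  have H3 : ∀ p q r s, bismutTorsion br J g (br p q) r s = -bismutTorsion br J g (br q p) r s := by
    intro p q r s
    rw [hc.skew, ← neg_one_smul ℝ, bismutTorsion_smul_left]
    ring
  simp only [lieCurvature, map_sub, LinearMap.sub_apply, bismutTorsionDeriv]
  have e1 := hB.skew' z (D' w x) y
  have e2 := hB.skew' w (D' z x) y
  have e3 := hB.skew x (D y z) w
  have e4 := hB.skew y (D x z) w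
  have f1 : g (D' w x) (D' z y) = g (D x w) (D y z) + g (D x w) (br z y) + g (D y z) (br w x)
      + g (br w x) (br z y) := by
    rw [hD' w x, hD' z y]
    simp only [map_add, LinearMap.add_apply]
    rw [hs (br w x) (D y z)]
    ring
  have f2 : g (D' z x) (D' w y) = g (D x z) (D y w) + g (D x z) (br w y) + g (D y w) (br z x)
      + g (br z x) (br w y) := by
    rw [hD' z x, hD' w y]
    simp only [map_add, LinearMap.add_apply]
    rw [hs (br z x) (D y w)]
    ring
  have s1 := hs (D x w) (D y z)
  have sg : ∀ p q r s, g (br p q) (br r s) = -g (br q p) (br r s) := fun p q r s => sk p q _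
  have sg2 : ∀ p q r s, g (br p q) (br r s) = -g (br p q) (br s r) := by
    intro p q r s
    rw [hc.skew r s, map_neg]
  -- In the order `x, y, z, w`, every term is a combination of `⟨[p, q], [r, s]⟩`, `⟨[[p, q], r], s⟩`
  -- and `H([p, q], r, s)`.
  have q1 : g (D x w) (br z y) = 1 / 2 * (-g (br x w) (br y z) - g (br (br y z) w) x
      - g (br (br y z) x) w - bismutTorsion br J g (br y z) x w) := by
    linarith [K x w (br z y), sg2 x w z y, sk w (br z y) x, sk2 z y w x, sk2 z y x w, H2 x w (br z y),
      H2 w (br z y) x, H3 z y x w]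
  have q2 : g (D y z) (br w x) = 1 / 2 * (-g (br y z) (br x w) - g (br (br x w) z) y
      - g (br (br x w) y) z - bismutTorsion br J g (br x w) y z) := by
    linarith [K y z (br w x), sg2 y z w x, sk z (br w x) y, sk2 w x z y, sk2 w x y z, H2 y z (br w x),
      H2 z (br w x) y, H3 w x y z]
  have q3 : g (D x z) (br w y) = 1 / 2 * (-g (br x z) (br y w) - g (br (br y w) z) x
      - g (br (br y w) x) z - bismutTorsion br J g (br y w) x z) := by
    linarith [K x z (br w y), sg2 x z w y, sk z (br w y) x, sk2 w y z x, sk2 w y x z, H2 x z (br w y),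
      H2 z (br w y) x, H3 w y x z]
  have q4 : g (D y w) (br z x) = 1 / 2 * (-g (br y w) (br x z) - g (br (br x z) w) y
      - g (br (br x z) y) w - bismutTorsion br J g (br x z) y w) := by
    linarith [K y w (br z x), sg2 y w z x, sk w (br z x) y, sk2 z x w y, sk2 z x y w, H2 y w (br z x),
      H2 w (br z x) y, H3 z x y w]
  have q5 : g (D' (br z w) x) y = 1 / 2 * (g (br (br z w) x) y - g (br x y) (br z w)
      - g (br (br z w) y) x - bismutTorsion br J g (br z w) x y) := by
    linarith [K' (br z w) x y, sk y (br z w) x]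
  have q6 : g (D (br x y) z) w = 1 / 2 * (g (br (br x y) z) w - g (br z w) (br x y)
      - g (br (br x y) w) z + bismutTorsion br J g (br x y) z w) := by
    linarith [K (br x y) z w, sk w (br x y) z]
  have p1 : g (br w x) (br z y) = g (br x w) (br y z) := by linarith [sg w x z y, sg2 x w z y]
  have p2 : g (br z x) (br w y) = g (br x z) (br y w) := by linarith [sg z x w y, sg2 x z w y]
  linarith [jac x y z w, jac x y w z, jac x z w y, jac y z w x, hs (br x w) (br y z),
    hs (br x z) (br y w), hs (br x y) (br z w), sk2 z x y w, sk2 w x y z, sk2 w x z y, sk2 w y z x,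
    hs (D' w x) (D' z y), hs (D' z x) (D' w y), hs (D x w) (D y z), hs (D y w) (D x z)]

end IsBismutPair

variable (hc : IsComplexLie br J) (hu : IsParsevalFrame J g e) (hB : IsBismutPair br J g D D')
include hc hu hB

theorem bismutPotential_eq (y : V) :
    bismutPotential br J g e y = 1 / 2 * ∑ a, g (D y (e a)) (J (e a)) := by
  simp only [bismutPotential, hB.apply_eq hc hu.symm]

/-- The Ricci form of the Bismut connection is exact: `D x` and `D y` commute with `J`, so their
commutator has no complex trace, and only `D [x, y]` contributes. -/
theorem sum_curvature_bismut (x y : V) :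
    ∑ a, g (lieCurvature br D x y (e a)) (J (e a)) = -2 * bismutPotential br J g e (br x y) := by
  have hJ := hu.J_left hc.sq
  have h := hu.sum_skew_symm (X := D x) (S := J ∘ₗ D y)
    (fun u v => by linarith [hB.skew x u v])
    (fun u v => by
      rw [LinearMap.comp_apply, LinearMap.comp_apply, hJ, ← hB.complex]
      linarith [hB.skew y u (J v)])
  simp only [LinearMap.comp_apply] at h
  rw [bismutPotential_eq hc hu hB]
  have key : ∀ a, g (lieCurvature br D x y (e a)) (J (e a))
      = 2 * g (D x (e a)) (J (D y (e a))) - g (D (br x y) (e a)) (J (e a)) := by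
    intro a
    simp only [lieCurvature, map_sub, LinearMap.sub_apply]
    have h1 := hB.skew x (D y (e a)) (J (e a))
    have h2 := hB.skew y (D x (e a)) (J (e a))
    rw [hB.complex] at h1 h2
    linarith [hJ (D y (e a)) (D x (e a)), hu.symm (D x (e a)) (J (D y (e a)))]
  simp_rw [key, Finset.sum_sub_distrib, ← Finset.mul_sum, h]
  ring

/-- The tensor `-S + Q` of a left-invariant Hermitian metric, in terms of the Bismut connection. -/
theorem neg_sum_curvature_add_torsion (hA : IsChernForm br J g A)
    (hD' : ∀ x y z, g (D' x y) z = g (A x y) z + g (A y z - A z y - br y z) x) (u v : V) :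
    -(1 / 2 * ∑ a, g (lieCurvature br A (e a) (J (e a)) (J u)) v)
      + ∑ a, g (A u (e a) - A (e a) u - br u (e a)) (A v (e a) - A (e a) v - br v (e a))
      = flowForm br J g e u v + 1 / 8 * ∑ a, (bismutTorsionDeriv br J g (J u) v (e a) (J (e a))
        - bismutTorsionDeriv br J g u (J v) (e a) (J (e a))) := by
  have h := sum_curvature_sub_torsion hc hA hu hD' u v
  have W : ∀ x y, ∑ a, g (lieCurvature br D' (e a) (J (e a)) x) y
      = -2 * bismutPotential br J g e (br x y)
        - 1 / 2 * ∑ a, bismutTorsionDeriv br J g x y (e a) (J (e a)) := by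
    intro x y
    simp_rw [hB.curvature_swap hc hu.symm]
    rw [Finset.sum_sub_distrib, sum_curvature_bismut hc hu hB, Finset.mul_sum]
  rw [W, W] at h
  rw [flowForm, Finset.sum_sub_distrib]
  linarith

/-! ### The Ricci tensor and the flow -/

omit hu in
/-- A consequence of the Jacobi identity and of `dH = 0`. The right-hand side is one half of the
action of `D v`, as a derivation, on the trilinear form `t(x, y, z)`, the sum of `H(x, y, z)` and the
cyclic permutations of `⟨[x, y], z⟩`. -/
theorem sum_bismut_deriv_cyclic (hs : ∀ x y, g x y = g y x) (v x y z : V)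
    (hH : bismutTorsionDeriv br J g v x y z = 0) :
    g (D (D' x v) y) z + g (D (D' y v) z) x + g (D (D' z v) x) y
      = 1 / 2 * (bismutTorsion br J g (D v x) y z + g (br (D v x) y) z + g (br y z) (D v x)
          + g (br z (D v x)) y)
        + 1 / 2 * (bismutTorsion br J g x (D v y) z + g (br x (D v y)) z + g (br (D v y) z) x
          + g (br z x) (D v y))
        + 1 / 2 * (bismutTorsion br J g x y (D v z) + g (br x y) (D v z) + g (br y (D v z)) x
          + g (br (D v z) x) y) := by
  have hD' : ∀ p, D' p v = D v p - br v p := by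
    intro p
    rw [hB.bracket v p]
    abel
  have K : ∀ u v w, g (D u v) w = 1 / 2 * (g (br u v) w - g (br v w) u + g (br w u) v
      + bismutTorsion br J g u v w) := hB.apply_eq hc hs
  have jac : ∀ p q r s, g (br (br p q) r) s + g (br (br q r) p) s + g (br (br r p) q) s = 0 := by
    intro p q r s
    have := congrArg (fun t => g t s) (hc.jacobi p q r)
    simpa using this
  have sk : ∀ p q s, g (br p q) s = -g (br q p) s := by
    intro p q s
    rw [hc.skew]
    simp
  have sk2 : ∀ p q r s, g (br (br p q) r) s = -g (br (br q p) r) s := by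
    intro p q r s
    rw [hc.skew p q]
    simp
  have H1 := bismutTorsion_swap (J := J) (g := g) hc.skew
  have H2 := bismutTorsion_rotate (br := br) (J := J) (g := g)
  have H3 : ∀ p q r s, bismutTorsion br J g (br p q) r s = -bismutTorsion br J g (br q p) r s := by
    intro p q r s
    rw [hc.skew, ← neg_one_smul ℝ, bismutTorsion_smul_left]
    ring
  have L : ∀ p q r, g (D (D' p v) q) r = 1 / 2 * (g (br (D v p) q) r - g (br q r) (D v p)
      + g (br r (D v p)) q + bismutTorsion br J g (D v p) q r)
      - 1 / 2 * (g (br (br v p) q) r - g (br q r) (br v p)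
      - g (br (br v p) r) q + bismutTorsion br J g (br v p) q r) := by
    intro p q r
    rw [hD', map_sub, LinearMap.sub_apply, map_sub, LinearMap.sub_apply, K, K]
    linarith [sk r (br v p) q]
  have M : ∀ p q r, g (br q r) (D v p) = 1 / 2 * (g (br v p) (br q r) + g (br (br q r) p) v
      + g (br (br q r) v) p + bismutTorsion br J g (br q r) v p) := by
    intro p q r
    rw [hs, K]
    linarith [sk p (br q r) v, H2 v p (br q r), H2 p (br q r) v]
  rw [L, L, L]
  simp only [bismutTorsionDeriv] at hH
  linarith [M x y z, M y z x, M z x y, H2 x (D v y) z, H2 x y (D v z), H2 y (D v z) x,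
    H2 (D v z) x y, jac x y z v, hs (br v x) (br y z), hs (br v y) (br z x),
    hs (br v z) (br x y), jac v y z x, sk2 z v y x, jac v z x y, sk2 x v z y, jac v x y z,
    sk2 y v x z, H3 z x v y, H2 (br v y) z x, H1 z x (br v y), H2 (br v y) x z]

end Curvature
section Ricci

variable {V ι : Type*} [AddCommGroup V] [Module ℝ V] [Fintype ι]
  {br : V →ₗ[ℝ] V →ₗ[ℝ] V} {J : V →ₗ[ℝ] V} {g : V →ₗ[ℝ] V →ₗ[ℝ] ℝ} {e : ι → V}
  {A D D' : V →ₗ[ℝ] V →ₗ[ℝ] V}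

theorem IsParsevalFrame.exists_eq_inner (hu : IsParsevalFrame J g e) (f : V →ₗ[ℝ] ℝ) :
    ∃ p, ∀ y, f y = g p y := by
  refine ⟨∑ a, f (e a) • e a, fun y => ?_⟩
  conv_lhs => rw [← hu.expand y]
  simp only [map_sum, map_smul, LinearMap.sum_apply, LinearMap.smul_apply, smul_eq_mul]
  exact Finset.sum_congr rfl fun a _ => by rw [hu.symm (e a) y, mul_comm]

/-- The derivation defined by an endomorphism in `𝔲(n)` annihilates `∑ e_a ⊗ J e_a`. -/
theorem IsParsevalFrame.sum_skew_complex (hu : IsParsevalFrame J g e) (β : V →ₗ[ℝ] V →ₗ[ℝ] ℝ)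
    {X : V →ₗ[ℝ] V} (hX : ∀ x y, g (X x) y + g x (X y) = 0) (hXJ : ∀ x, X (J x) = J (X x)) :
    ∑ a, (β (X (e a)) (J (e a)) + β (e a) (X (J (e a)))) = 0 := by
  have h : ∑ a, β (X (e a)) (J (e a)) = -∑ b, β (e b) (X (J (e b))) := by
    have h1 : ∀ a, β (X (e a)) (J (e a)) = -∑ b, g (X (e b)) (e a) * β (e b) (J (e a)) := by
      intro a
      conv_lhs => rw [← hu.expand (X (e a))]
      simp only [map_sum, map_smul, LinearMap.sum_apply, LinearMap.smul_apply, smul_eq_mul]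
      rw [← Finset.sum_neg_distrib]
      refine Finset.sum_congr rfl fun b _ => ?_
      rw [eq_neg_of_add_eq_zero_left (hX (e a) (e b)), hu.symm (e a)]
      ring
    have h2 : ∀ b, β (e b) (X (J (e b))) = ∑ a, g (X (e b)) (e a) * β (e b) (J (e a)) := by
      intro b
      conv_lhs => rw [hXJ, ← hu.expand (X (e b))]
      simp only [map_sum, map_smul, smul_eq_mul]
    simp_rw [h1, h2]
    rw [Finset.sum_neg_distrib, Finset.sum_comm]
  rw [Finset.sum_add_distrib, h]
  ring

/-- The Ricci tensor of the Bismut connection `D`, up to a Lie derivative of the metric and an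
exact two-form. -/
def reducedRicci (g : V →ₗ[ℝ] V →ₗ[ℝ] ℝ) (e : ι → V) (D D' : V →ₗ[ℝ] V →ₗ[ℝ] V) (x v : V) : ℝ :=
  ∑ a, g (D (D' (e a) v) (e a)) x

variable (hc : IsComplexLie br J) (hu : IsParsevalFrame J g e) (hB : IsBismutPair br J g D D')
include hc hu hB

/-- At an SKT metric the form `η([Jx, v])`, whose symmetric and skew-symmetric parts are the
velocity of the flow and the driving term of `H`, is minus the reduced Ricci tensor up to a
gauge term. -/
theorem exists_bismutPotential_bracket_eq (hH : ∀ v x y z, bismutTorsionDeriv br J g v x y z = 0) :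
    ∃ w, ∀ x v, bismutPotential br J g e (br (J x) v) = -reducedRicci g e D D' x v + g (D v w) x := by
  have hJ := hu.J_left hc.sq
  have H2 := bismutTorsion_rotate (br := br) (J := J) (g := g)
  -- `t` is the trilinear form on which `D v` acts in `sum_bismut_deriv_cyclic`. That identity is
  -- summed over the triples `(J x, e_a, J e_a)`; the terms in which `D v` acts on `e_a` and `J e_a`
  -- cancel by `IsParsevalFrame.sum_skew_complex`, and the one with `D v (J x)` is a linear form of
  -- `D v (J x)`.
  let t : V → V → V → ℝ := fun x y z => bismutTorsion br J g x y z + g (br x y) z + g (br y z) x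
    + g (br z x) y
  let β : V → V →ₗ[ℝ] V →ₗ[ℝ] ℝ := fun x => LinearMap.mk₂ ℝ (t x)
    (by intros; simp [t, bismutTorsion]; ring) (by intros; simp [t, bismutTorsion]; ring)
    (by intros; simp [t, bismutTorsion]; ring) (by intros; simp [t, bismutTorsion]; ring)
  let l : V →ₗ[ℝ] ℝ :=
    { toFun := fun y => 1 / 4 * ∑ a, t y (e a) (J (e a)) - 1 / 2 * ∑ a, g (D y (e a)) (J (e a))
      map_add' := by
        intro x y
        simp only [t, bismutTorsion_add_left, map_add, LinearMap.add_apply, Finset.sum_add_distrib]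
        ring
      map_smul' := by
        intro r x
        simp only [t, bismutTorsion_smul_left, map_smul, LinearMap.smul_apply, smul_eq_mul,
          RingHom.id_apply, ← mul_add, ← Finset.mul_sum]
        ring }
  obtain ⟨p, hp⟩ := hu.exists_eq_inner l
  refine ⟨J p, fun x v => ?_⟩
  have hbr : br (J x) v = D' (J x) v - D v (J x) := by
    rw [hc.skew, hB.bracket]
    abel
  have h0 : ∀ a, g (D (D' (J x) v) (e a)) (J (e a)) + g (D (D' (e a) v) (J (e a))) (J x)
      + g (D (D' (J (e a)) v) (J x)) (e a)
      = 1 / 2 * t (D v (J x)) (e a) (J (e a)) + 1 / 2 * (β (J x) (D v (e a)) (J (e a))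
        + β (J x) (e a) (D v (J (e a)))) := by
    intro a
    rw [sum_bismut_deriv_cyclic hc hB hu.symm v (J x) (e a) (J (e a)) (hH _ _ _ _)]
    simp only [t, β, LinearMap.mk₂_apply]
    ring
  have h1 := Finset.sum_congr rfl fun a (_ : a ∈ Finset.univ) => h0 a
  simp only [Finset.sum_add_distrib, ← Finset.mul_sum] at h1
  have h2 := hu.sum_skew_complex (β (J x)) (hB.skew v) (hB.complex v)
  rw [Finset.sum_add_distrib] at h2
  have h3 : ∑ a, g (D (D' (e a) v) (J (e a))) (J x) = reducedRicci g e D D' x v := by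
    simp only [reducedRicci, hB.complex, hu.inv]
  have h4 : ∑ a, g (D (D' (J (e a)) v) (J x)) (e a) = reducedRicci g e D D' x v := by
    let γ : V →ₗ[ℝ] V →ₗ[ℝ] ℝ := LinearMap.mk₂ ℝ (fun y z => g (D (D' y v) z) x)
      (by intros; simp) (by intros; simp) (by intros; simp) (by intros; simp)
    rw [reducedRicci]
    refine Eq.trans (Finset.sum_congr rfl fun a _ => ?_)
      (hu.contraction_eq (hu.J_frame hc.sq) γ).symm
    simp only [γ, LinearMap.mk₂_apply, hB.complex]
    linarith [hB.skew (D' (J (e a)) v) x (e a), hJ (D (D' (J (e a)) v) x) (e a),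
      hJ (D (D' (J (e a)) v) (e a)) x, hu.symm x (D (D' (J (e a)) v) (e a)),
      hB.skew (D' (J (e a)) v) x (J (e a)), hB.complex (D' (J (e a)) v) (e a),
      hu.symm x (J (D (D' (J (e a)) v) (e a))),
      congrArg (g x) (hB.complex (D' (J (e a)) v) (e a))]
  have h5 : g (D v (J p)) x = l (D v (J x)) := by
    rw [hp, hB.complex, hB.complex, hJ]
    linarith [hB.skew v p (J x), congrArg (g p) (hB.complex v x)]
  rw [bismutPotential_eq hc hu hB, hbr, h5]
  simp only [map_sub, LinearMap.sub_apply, Finset.sum_sub_distrib]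
  simp only [l, LinearMap.coe_mk, AddHom.coe_mk]
  linarith

end Ricci
section Arrays

/-! ### The energy of structure constants and its first variation -/

variable {ι : Type*} [Fintype ι]

/-- The energy `F` of structure constants `c a b k = ⟨[e_a, e_b], e_k⟩` and a three-form `H`: the
scalar curvature, without its mean curvature term, minus `|H|² / 12`. -/
noncomputable def structureEnergy (c H : ι → ι → ι → ℝ) : ℝ :=
  -(1 / 4) * ∑ a, ∑ b, ∑ k, c a b k * c a b k - 1 / 2 * ∑ a, ∑ b, ∑ k, c a b k * c a k b
    - 1 / 12 * ∑ a, ∑ b, ∑ k, H a b k * H a b k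

/-- The components of the reduced Ricci tensor in terms of structure constants. -/
noncomputable def structureRicci (c H : ι → ι → ι → ℝ) (x v : ι) : ℝ :=
  ∑ a, ∑ k, 1 / 2 * (c a v k - c v k a + c k a v - H a v k)
    * (1 / 2 * (c k a x - c a x k + c x k a + H k a x))

/-- The variation of structure constants when the frame varies by `e_a' = ∑ m a i e_i`. -/
def bracketVariation (m : ι → ι → ℝ) (c : ι → ι → ι → ℝ) (a b k : ι) : ℝ :=
  ∑ i, (m a i * c i b k + m b i * c a i k - m i k * c a b i)

/-- The variation of the components of a three-form `H` when the frame varies by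
`e_a' = ∑ m a i e_i` and the form itself by `H' = dβ` with the two-form `β`. -/
def formVariation (m β : ι → ι → ℝ) (c H : ι → ι → ι → ℝ) (x y z : ι) : ℝ :=
  ∑ i, (m x i * H i y z + m y i * H x i z + m z i * H x y i)
    - ∑ i, (c x y i * β i z + c y z i * β i x + c z x i * β i y)

/-- The derivative of `|c|² / 2` in the direction of the frame variation `m`. -/
def normVariation (c : ι → ι → ι → ℝ) (m : ι → ι → ℝ) : ℝ :=
  ∑ a, ∑ b, ∑ k, c a b k * bracketVariation m c a b k

theorem sum_swap_fst (f : ι → ι → ι → ι → ℝ) :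
    ∑ a, ∑ i, ∑ b, ∑ k, f a i b k = ∑ a, ∑ i, ∑ b, ∑ k, f i a b k :=
  Finset.sum_comm

theorem sum_swap_snd (f : ι → ι → ι → ι → ℝ) :
    ∑ a, ∑ i, ∑ b, ∑ k, f a i b k = ∑ a, ∑ i, ∑ b, ∑ k, f a b i k :=
  Finset.sum_congr rfl fun _ _ => Finset.sum_comm

theorem sum_swap_thd (f : ι → ι → ι → ι → ℝ) :
    ∑ a, ∑ i, ∑ b, ∑ k, f a i b k = ∑ a, ∑ i, ∑ b, ∑ k, f a i k b :=
  Finset.sum_congr rfl fun _ _ => Finset.sum_congr rfl fun _ _ => Finset.sum_comm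

variable {c H : ι → ι → ι → ℝ} (hc : ∀ a b k, c a b k = -c b a k)
  (hH : ∀ a b k, H a b k = -H b a k) (hH' : ∀ a b k, H a b k = H b k a)
include hc hH hH'

theorem structureRicci_eq (x v : ι) : structureRicci c H x v
    = 1 / 4 * ∑ b, ∑ k, ((H k b x + c k b x) * (c k b v - H k b v)
      - (c x b k + c x k b) * (c v b k + c v k b)) := by
  have h : ∑ b, ∑ k, (H k b x + c k b x) * (c v b k + c v k b) = 0 := by
    have : ∑ b, ∑ k, (H k b x + c k b x) * (c v b k + c v k b)
        = -∑ b, ∑ k, (H k b x + c k b x) * (c v b k + c v k b) := by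
      conv_lhs => rw [Finset.sum_comm]
      simp_rw [← Finset.sum_neg_distrib]
      refine Finset.sum_congr rfl fun b _ => Finset.sum_congr rfl fun k _ => ?_
      rw [hH, hc]
      ring
    linarith
  have h' : ∑ b, ∑ k, (c x b k + c x k b) * (c k b v - H k b v) = 0 := by
    have : ∑ b, ∑ k, (c x b k + c x k b) * (c k b v - H k b v)
        = -∑ b, ∑ k, (c x b k + c x k b) * (c k b v - H k b v) := by
      conv_lhs => rw [Finset.sum_comm]
      simp_rw [← Finset.sum_neg_distrib]
      refine Finset.sum_congr rfl fun b _ => Finset.sum_congr rfl fun k _ => ?_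
      rw [hH, hc k b]
      ring
    linarith
  have e : structureRicci c H x v = 1 / 4 * ∑ b, ∑ k, ((H k b x + c k b x) * (c k b v - H k b v)
      - (c x b k + c x k b) * (c v b k + c v k b))
      + 1 / 4 * ∑ b, ∑ k, (c x b k + c x k b) * (c k b v - H k b v)
      - 1 / 4 * ∑ b, ∑ k, (H k b x + c k b x) * (c v b k + c v k b) := by
    simp_rw [structureRicci, Finset.mul_sum, ← Finset.sum_add_distrib, ← Finset.sum_sub_distrib]
    refine Finset.sum_congr rfl fun b _ => Finset.sum_congr rfl fun k _ => ?_
    rw [hc b v, hc b x, hH' k b v]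
    ring
  rw [e, h, h']
  ring

omit hH hH' in
theorem normVariation_eq (m : ι → ι → ℝ) : normVariation c m
      = 2 * (∑ a, ∑ i, ∑ b, ∑ k, m a i * (c a b k * c i b k))
        - ∑ a, ∑ i, ∑ b, ∑ k, m a i * (c b k a * c b k i) := by
  rw [normVariation]
  have A1 : ∑ a, ∑ b, ∑ k, ∑ i, c a b k * (m a i * c i b k)
      = ∑ a, ∑ i, ∑ b, ∑ k, m a i * (c a b k * c i b k) := by
    rw [sum_swap_thd, sum_swap_snd]
    exact Finset.sum_congr rfl fun a _ => Finset.sum_congr rfl fun i _ =>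
      Finset.sum_congr rfl fun b _ => Finset.sum_congr rfl fun k _ => by ring
  have A2 : ∑ a, ∑ b, ∑ k, ∑ i, c a b k * (m b i * c a i k)
      = ∑ a, ∑ i, ∑ b, ∑ k, m a i * (c a b k * c i b k) := by
    rw [sum_swap_fst, ← A1]
    refine Finset.sum_congr rfl fun a _ => Finset.sum_congr rfl fun b _ =>
      Finset.sum_congr rfl fun k _ => Finset.sum_congr rfl fun i _ => ?_
    rw [hc b a, hc b i]
    ring
  have A3 : ∑ a, ∑ b, ∑ k, ∑ i, c a b k * (m i k * c a b i)
      = ∑ a, ∑ i, ∑ b, ∑ k, m a i * (c b k a * c b k i) := by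
    rw [sum_swap_snd, sum_swap_fst, sum_swap_thd, sum_swap_snd, sum_swap_fst]
    exact Finset.sum_congr rfl fun a _ => Finset.sum_congr rfl fun i _ =>
      Finset.sum_congr rfl fun b _ => Finset.sum_congr rfl fun k _ => by ring
  rw [two_mul, ← A3]
  nth_rw 1 [← A1]
  rw [← A2]
  simp only [bracketVariation, mul_add, mul_sub, Finset.mul_sum, Finset.sum_add_distrib,
    Finset.sum_sub_distrib]

/-- The first variation of the energy: its gradient is twice the symmetric part of the reduced Ricci
tensor `R` for changes of the frame, and `-R` for changes of `H` by an exact form. -/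
theorem energy_variation (m β : ι → ι → ℝ) (hβ : ∀ a i, β a i = -β i a) :
    -(1 / 2) * normVariation c m
      - ∑ a, ∑ b, ∑ k, c a k b * bracketVariation m c a b k
      - 1 / 6 * ∑ a, ∑ b, ∑ k, H a b k * formVariation m β c H a b k
    = ∑ a, ∑ i, (structureRicci c H a i + structureRicci c H i a) * m a i
      - ∑ a, ∑ i, structureRicci c H a i * β a i := by
  have R1 : ∑ a, ∑ i, (structureRicci c H a i + structureRicci c H i a) * m a i
      = 1 / 2 * (∑ a, ∑ i, ∑ b, ∑ k, m a i * (c b k a * c b k i))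
        - 1 / 2 * (∑ a, ∑ i, ∑ b, ∑ k, m a i * (H a b k * H i b k))
        - (∑ a, ∑ i, ∑ b, ∑ k, m a i * (c a b k * c i b k))
        - (∑ a, ∑ i, ∑ b, ∑ k, m a i * (c a k b * c i b k)) := by
    have e1 : ∑ a, ∑ i, ∑ b, ∑ k, m a i * (c a k b * c i b k)
        = ∑ a, ∑ i, ∑ b, ∑ k, m a i * (c a b k * c i k b) := sum_swap_thd _
    have e2 : ∑ a, ∑ i, ∑ b, ∑ k, m a i * (c a b k * c i b k)
        = ∑ a, ∑ i, ∑ b, ∑ k, m a i * (c a k b * c i k b) := sum_swap_thd _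
    have e3 : ∑ a, ∑ i, (structureRicci c H a i + structureRicci c H i a) * m a i
      = 1 / 2 * (∑ a, ∑ i, ∑ b, ∑ k, m a i * (c b k a * c b k i))
        - 1 / 2 * (∑ a, ∑ i, ∑ b, ∑ k, m a i * (H a b k * H i b k))
        - 1 / 2 * (∑ a, ∑ i, ∑ b, ∑ k, m a i * (c a b k * c i b k))
        - 1 / 2 * (∑ a, ∑ i, ∑ b, ∑ k, m a i * (c a k b * c i k b))
        - 1 / 2 * (∑ a, ∑ i, ∑ b, ∑ k, m a i * (c a k b * c i b k))
        - 1 / 2 * (∑ a, ∑ i, ∑ b, ∑ k, m a i * (c a b k * c i k b)) := by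
      simp_rw [Finset.mul_sum, ← Finset.sum_sub_distrib]
      refine Finset.sum_congr rfl fun a _ => Finset.sum_congr rfl fun i _ => ?_
      rw [structureRicci_eq hc hH hH', structureRicci_eq hc hH hH', ← mul_add,
        ← Finset.sum_add_distrib, mul_assoc, Finset.sum_mul, Finset.mul_sum]
      refine Finset.sum_congr rfl fun b _ => ?_
      rw [← Finset.sum_add_distrib, Finset.sum_mul, Finset.mul_sum]
      refine Finset.sum_congr rfl fun k _ => ?_
      rw [hc k b a, hc k b i, hH' a b k, hH' i b k, hH k b a, hH k b i]
      ring
    linarith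
  have R2 : ∑ a, ∑ i, structureRicci c H a i * β a i
      = -(1 / 2) * ∑ a, ∑ i, ∑ b, ∑ k, β a i * (c b k a * H b k i) := by
    have e1 : ∑ a, ∑ i, structureRicci c H a i * β a i
        = ∑ a, ∑ i, structureRicci c H i a * β i a := Finset.sum_comm
    have e2 : ∑ a, ∑ i, ∑ b, ∑ k, β a i * (c b k a * H b k i)
        = ∑ a, ∑ i, ∑ b, ∑ k, β i a * (c b k i * H b k a) := sum_swap_fst _
    have e3 : ∑ a, ∑ i, structureRicci c H a i * β a i + ∑ a, ∑ i, structureRicci c H i a * β i a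
        = -(1 / 2) * (∑ a, ∑ i, ∑ b, ∑ k, β a i * (c b k a * H b k i))
          - 1 / 2 * (∑ a, ∑ i, ∑ b, ∑ k, β i a * (c b k i * H b k a)) := by
      simp_rw [Finset.mul_sum, ← Finset.sum_sub_distrib, ← Finset.sum_add_distrib]
      refine Finset.sum_congr rfl fun a _ => Finset.sum_congr rfl fun i _ => ?_
      rw [structureRicci_eq hc hH hH', structureRicci_eq hc hH hH', hβ i a, mul_neg,
        ← sub_eq_add_neg, ← sub_mul, ← mul_sub, ← Finset.sum_sub_distrib, mul_assoc,
        Finset.sum_mul, Finset.mul_sum]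
      refine Finset.sum_congr rfl fun b _ => ?_
      rw [← Finset.sum_sub_distrib, Finset.sum_mul, Finset.mul_sum]
      refine Finset.sum_congr rfl fun k _ => ?_
      rw [hc k b a, hc k b i, hH k b a, hH k b i]
      ring
    linarith
  have B1 : ∑ a, ∑ b, ∑ k, ∑ i, c a k b * (m a i * c i b k)
      = ∑ a, ∑ i, ∑ b, ∑ k, m a i * (c a k b * c i b k) := by
    rw [sum_swap_thd, sum_swap_snd]
    exact Finset.sum_congr rfl fun a _ => Finset.sum_congr rfl fun i _ =>
      Finset.sum_congr rfl fun b _ => Finset.sum_congr rfl fun k _ => by ring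
  have B2 : ∑ a, ∑ b, ∑ k, ∑ i, c a k b * (m b i * c a i k)
      = ∑ a, ∑ b, ∑ k, ∑ i, c a k b * (m i k * c a b i) := by
    rw [sum_swap_snd, sum_swap_thd]
    exact Finset.sum_congr rfl fun a _ => Finset.sum_congr rfl fun i _ =>
      Finset.sum_congr rfl fun b _ => Finset.sum_congr rfl fun k _ => by ring
  -- The three contributions of the frame to the norm of `H`.
  have H1 : ∑ a, ∑ b, ∑ k, ∑ i, H a b k * (m a i * H i b k)
      = ∑ a, ∑ i, ∑ b, ∑ k, m a i * (H a b k * H i b k) := by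
    rw [sum_swap_thd, sum_swap_snd]
    exact Finset.sum_congr rfl fun a _ => Finset.sum_congr rfl fun i _ =>
      Finset.sum_congr rfl fun b _ => Finset.sum_congr rfl fun k _ => by ring
  have H2 : ∑ a, ∑ b, ∑ k, ∑ i, H a b k * (m b i * H a i k)
      = ∑ a, ∑ i, ∑ b, ∑ k, m a i * (H a b k * H i b k) := by
    rw [sum_swap_fst, ← H1]
    refine Finset.sum_congr rfl fun a _ => Finset.sum_congr rfl fun b _ =>
      Finset.sum_congr rfl fun k _ => Finset.sum_congr rfl fun i _ => ?_
    rw [hH b a, hH b i]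
    ring
  have H3 : ∑ a, ∑ b, ∑ k, ∑ i, H a b k * (m k i * H a b i)
      = ∑ a, ∑ i, ∑ b, ∑ k, m a i * (H a b k * H i b k) := by
    rw [sum_swap_snd, sum_swap_fst, sum_swap_thd, sum_swap_snd]
    exact Finset.sum_congr rfl fun a _ => Finset.sum_congr rfl fun i _ =>
      Finset.sum_congr rfl fun b _ => Finset.sum_congr rfl fun k _ => by rw [hH' a b k, hH' i b k]; ring
  -- The three contributions of `β`.
  have T1 : ∑ a, ∑ b, ∑ k, ∑ i, H a b k * (c a b i * β i k)
      = ∑ a, ∑ i, ∑ b, ∑ k, β a i * (c b k a * H b k i) := by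
    rw [sum_swap_snd, sum_swap_fst, sum_swap_thd, sum_swap_snd, sum_swap_fst]
    exact Finset.sum_congr rfl fun a _ => Finset.sum_congr rfl fun i _ =>
      Finset.sum_congr rfl fun b _ => Finset.sum_congr rfl fun k _ => by ring
  have T2 : ∑ a, ∑ b, ∑ k, ∑ i, H a b k * (c b k i * β i a)
      = ∑ a, ∑ i, ∑ b, ∑ k, β a i * (c b k a * H b k i) := by
    rw [sum_swap_thd, sum_swap_snd, sum_swap_fst]
    exact Finset.sum_congr rfl fun a _ => Finset.sum_congr rfl fun i _ =>
      Finset.sum_congr rfl fun b _ => Finset.sum_congr rfl fun k _ => by rw [hH' i b k]; ring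
  have T3 : ∑ a, ∑ b, ∑ k, ∑ i, H a b k * (c k a i * β i b)
      = ∑ a, ∑ i, ∑ b, ∑ k, β a i * (c b k a * H b k i) := by
    rw [sum_swap_thd, sum_swap_snd, sum_swap_fst, sum_swap_snd, sum_swap_thd]
    exact Finset.sum_congr rfl fun a _ => Finset.sum_congr rfl fun i _ =>
      Finset.sum_congr rfl fun b _ => Finset.sum_congr rfl fun k _ => by rw [hH' k i b, hH' i b k]; ring
  have E2 : ∑ a, ∑ b, ∑ k, c a k b * bracketVariation m c a b k
      = ∑ a, ∑ i, ∑ b, ∑ k, m a i * (c a k b * c i b k) := by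
    rw [← B1, ← add_sub_cancel_right (∑ a, ∑ b, ∑ k, ∑ i, c a k b * (m a i * c i b k))
      (∑ a, ∑ b, ∑ k, ∑ i, c a k b * (m b i * c a i k))]
    nth_rw 2 [B2]
    simp only [bracketVariation, mul_add, mul_sub, Finset.mul_sum, Finset.sum_add_distrib,
      Finset.sum_sub_distrib]
  have E3 : ∑ a, ∑ b, ∑ k, H a b k * formVariation m β c H a b k
      = 3 * (∑ a, ∑ i, ∑ b, ∑ k, m a i * (H a b k * H i b k))
        - 3 * ∑ a, ∑ i, ∑ b, ∑ k, β a i * (c b k a * H b k i) := by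
    have h3 : ∀ x : ℝ, 3 * x = x + x + x := fun x => by ring
    rw [h3, h3]
    nth_rw 1 [← H1]
    nth_rw 1 [← H2]
    nth_rw 1 [← H3]
    nth_rw 1 [← T1]
    nth_rw 1 [← T2]
    rw [← T3]
    simp only [formVariation, mul_add, mul_sub, Finset.mul_sum, Finset.sum_add_distrib,
      Finset.sum_sub_distrib]
  rw [R1, R2, normVariation_eq hc, E2, E3]
  ring

end Arrays
/-! ### The growth of the norm of structure constants -/

section Norm

variable {ι : Type*} [Fintype ι] {c : ι → ι → ι → ℝ} (hc : ∀ a b k, c a b k = -c b a k)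

theorem normVariation_add (m m' : ι → ι → ℝ) :
    normVariation c (fun a i => m a i + m' a i) = normVariation c m + normVariation c m' := by
  simp only [normVariation, bracketVariation, ← Finset.sum_add_distrib, ← mul_add]
  refine Finset.sum_congr rfl fun a _ => Finset.sum_congr rfl fun b _ =>
    Finset.sum_congr rfl fun k _ => congrArg _ (Finset.sum_congr rfl fun i _ => by ring)

theorem normVariation_smul (r : ℝ) (m : ι → ι → ℝ) :
    normVariation c (fun a i => r * m a i) = r * normVariation c m := by
  simp only [normVariation, bracketVariation, Finset.mul_sum]
  refine Finset.sum_congr rfl fun a _ => Finset.sum_congr rfl fun b _ =>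
    Finset.sum_congr rfl fun k _ => (Finset.sum_congr rfl fun i _ => by ring)

include hc

theorem normVariation_eq_sum (m : ι → ι → ℝ) : normVariation c m
    = ∑ a, ∑ i, ∑ b, ∑ k, m a i * (2 * (c a b k * c i b k) - c b k a * c b k i) := by
  simp only [normVariation_eq hc, mul_sub, Finset.sum_sub_distrib, Finset.mul_sum]
  congr 1
  exact Finset.sum_congr rfl fun a _ => Finset.sum_congr rfl fun i _ =>
    Finset.sum_congr rfl fun b _ => Finset.sum_congr rfl fun k _ => by ring

theorem normVariation_transpose (m : ι → ι → ℝ) :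
    normVariation c (fun a i => m i a) = normVariation c m := by
  rw [normVariation_eq_sum hc, normVariation_eq_sum hc, sum_swap_fst]
  exact Finset.sum_congr rfl fun a _ => Finset.sum_congr rfl fun i _ =>
    Finset.sum_congr rfl fun b _ => Finset.sum_congr rfl fun k _ => by ring

/-- A crude bound for the variation of the norm, linear in `|c|²` and quadratic in `m`. -/
theorem normVariation_le (m : ι → ι → ℝ) : normVariation c m
    ≤ 3 / 2 * (Fintype.card ι : ℝ) ^ 4 * (1 + ∑ a, ∑ i, m a i ^ 2)
      * ∑ a, ∑ b, ∑ k, c a b k * c a b k := by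
  set N := ∑ a, ∑ b, ∑ k, c a b k * c a b k
  set Q := ∑ a, ∑ i, m a i ^ 2
  have hN : ∀ a b k, c a b k * c a b k ≤ N := by
    intro a b k
    refine le_trans (Finset.single_le_sum (f := fun k => c a b k * c a b k)
      (fun _ _ => mul_self_nonneg _) (Finset.mem_univ k)) ?_
    refine le_trans (Finset.single_le_sum (f := fun b => ∑ k, c a b k * c a b k)
      (fun _ _ => Finset.sum_nonneg fun _ _ => mul_self_nonneg _) (Finset.mem_univ b)) ?_
    exact Finset.single_le_sum (f := fun a => ∑ b, ∑ k, c a b k * c a b k)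
      (fun _ _ => Finset.sum_nonneg fun _ _ => Finset.sum_nonneg fun _ _ => mul_self_nonneg _)
      (Finset.mem_univ a)
  have hQ : ∀ a i, m a i ^ 2 ≤ Q := by
    intro a i
    refine le_trans (Finset.single_le_sum (f := fun i => m a i ^ 2)
      (fun _ _ => sq_nonneg _) (Finset.mem_univ i)) ?_
    exact Finset.single_le_sum (f := fun a => ∑ i, m a i ^ 2)
      (fun _ _ => Finset.sum_nonneg fun _ _ => sq_nonneg _) (Finset.mem_univ a)
  have key : ∀ a i b k, m a i * (2 * (c a b k * c i b k) - c b k a * c b k i)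
      ≤ 3 / 2 * (1 + Q) * N := by
    intro a i b k
    have h1 : |2 * (c a b k * c i b k) - c b k a * c b k i| ≤ 3 * N := by
      rw [abs_le]
      constructor <;> nlinarith [hN a b k, hN i b k, hN b k a, hN b k i, sq_nonneg (c a b k - c i b k),
        sq_nonneg (c a b k + c i b k), sq_nonneg (c b k a - c b k i), sq_nonneg (c b k a + c b k i)]
    have h2 : |m a i| ≤ 1 / 2 * (1 + Q) := by
      rw [abs_le]
      constructor <;> nlinarith [hQ a i, sq_nonneg (m a i - 1), sq_nonneg (m a i + 1)]
    calc _ ≤ |m a i * (2 * (c a b k * c i b k) - c b k a * c b k i)| := le_abs_self _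
      _ = |m a i| * |2 * (c a b k * c i b k) - c b k a * c b k i| := abs_mul _ _
      _ ≤ 1 / 2 * (1 + Q) * (3 * N) := mul_le_mul h2 h1 (abs_nonneg _) ((abs_nonneg _).trans h2)
      _ = _ := by ring
  rw [normVariation_eq_sum hc]
  calc _ ≤ ∑ _a : ι, ∑ _i : ι, ∑ _b : ι, ∑ _k : ι, 3 / 2 * (1 + Q) * N :=
        Finset.sum_le_sum fun a _ => Finset.sum_le_sum fun i _ => Finset.sum_le_sum fun b _ =>
          Finset.sum_le_sum fun k _ => key a i b k
    _ = _ := by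
      simp only [Finset.sum_const, Finset.card_univ, nsmul_eq_mul]
      ring

end Norm

/-! ### Structure constants of a Hermitian Lie algebra -/

section Frame

variable {V ι : Type*} [AddCommGroup V] [Module ℝ V] [Fintype ι]
  {br : V →ₗ[ℝ] V →ₗ[ℝ] V} {J : V →ₗ[ℝ] V} {g : V →ₗ[ℝ] V →ₗ[ℝ] ℝ} {e : ι → V}
  {A D D' : V →ₗ[ℝ] V →ₗ[ℝ] V}

/-- The structure constants of `br` in the frame `e`. -/
def frameBracket (br : V →ₗ[ℝ] V →ₗ[ℝ] V) (g : V →ₗ[ℝ] V →ₗ[ℝ] ℝ) (e : ι → V) (a b k : ι) : ℝ :=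
  g (br (e a) (e b)) (e k)

/-- The components of the Bismut torsion in the frame `e`. -/
def frameTorsion (br : V →ₗ[ℝ] V →ₗ[ℝ] V) (J : V →ₗ[ℝ] V) (g : V →ₗ[ℝ] V →ₗ[ℝ] ℝ) (e : ι → V)
    (a b k : ι) : ℝ :=
  bismutTorsion br J g (e a) (e b) (e k)

/-- The two-form `β` with `∂H/∂t = dβ` along the flow. -/
noncomputable def torsionPotential (br : V →ₗ[ℝ] V →ₗ[ℝ] V) (J : V →ₗ[ℝ] V) (g : V →ₗ[ℝ] V →ₗ[ℝ] ℝ)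
    (e : ι → V) (u v : V) : ℝ :=
  1 / 2 * (bismutPotential br J g e (br (J u) v) + bismutPotential br J g e (br u (J v)))

theorem IsParsevalFrame.sum_mul_apply (hu : IsParsevalFrame J g e) (f : V →ₗ[ℝ] ℝ) (x : V) :
    ∑ i, g x (e i) * f (e i) = f x := by
  conv_rhs => rw [← hu.expand x]
  simp

variable (hc : IsComplexLie br J) (hu : IsParsevalFrame J g e)
include hc

omit [Fintype ι] in
theorem frameBracket_swap (a b k : ι) : frameBracket br g e a b k = -frameBracket br g e b a k := by
  simp only [frameBracket]
  rw [hc.skew]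
  simp

omit [Fintype ι] in
theorem frameTorsion_swap (a b k : ι) :
    frameTorsion br J g e a b k = -frameTorsion br J g e b a k :=
  bismutTorsion_swap hc.skew _ _ _

omit [Fintype ι] hc in
theorem frameTorsion_rotate (a b k : ι) : frameTorsion br J g e a b k = frameTorsion br J g e b k a :=
  bismutTorsion_rotate _ _ _

include hu

/-- Inner derivations preserve the bracket, by the Jacobi identity. -/
theorem bracketVariation_inner (w : V) (a b k : ι) :
    bracketVariation (fun a i => g (br w (e a)) (e i)) (frameBracket br g e) a b k = 0 := by
  simp only [bracketVariation, frameBracket, Finset.sum_add_distrib, Finset.sum_sub_distrib]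
  have h1 := hu.sum_mul_apply ((g.flip (e k)) ∘ₗ br.flip (e b)) (br w (e a))
  have h2 := hu.sum_mul_apply ((g.flip (e k)) ∘ₗ br (e a)) (br w (e b))
  have h3 := hu.sum_mul_apply ((g.flip (e k)) ∘ₗ br w) (br (e a) (e b))
  simp only [LinearMap.comp_apply, LinearMap.flip_apply] at h1 h2 h3
  have h4 : ∑ i, g (br w (e i)) (e k) * g (br (e a) (e b)) (e i)
      = g (br w (br (e a) (e b))) (e k) := by
    rw [← h3]
    exact Finset.sum_congr rfl fun i _ => mul_comm _ _
  rw [h1, h2, h4]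
  have j := congrArg (fun t => g t (e k)) (hc.jacobi w (e a) (e b))
  rw [hc.skew (br (e a) (e b)) w, hc.skew (e b) w, map_neg, LinearMap.neg_apply,
    hc.skew (br w (e b)) (e a)] at j
  simp at j
  linarith

/-- A closed form `H` does not change when the frame moves by the inner derivation `ad w` and `H`
itself by `d (H(w, ·, ·))`: this is Cartan's formula for the Lie derivative along `w`. -/
theorem formVariation_inner (w : V) (hH : ∀ x y z, bismutTorsionDeriv br J g w x y z = 0)
    (a b k : ι) :
    formVariation (fun a i => g (br w (e a)) (e i))
      (fun a i => bismutTorsion br J g w (e a) (e i))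
      (frameBracket br g e) (frameTorsion br J g e) a b k = 0 := by
  have H2 := bismutTorsion_rotate (br := br) (J := J) (g := g)
  have H1 := bismutTorsion_swap (J := J) (g := g) hc.skew
  let T : V → V → V →ₗ[ℝ] ℝ := fun y z =>
    { toFun := fun x => bismutTorsion br J g x y z
      map_add' := fun x x' => bismutTorsion_add_left x x' y z
      map_smul' := fun r x => by simp [bismutTorsion_smul_left] }
  have hT : ∀ x y z, ∑ i, g x (e i) * bismutTorsion br J g (e i) y z = bismutTorsion br J g x y z :=
    fun x y z => hu.sum_mul_apply (T y z) x
  simp only [formVariation, frameBracket, frameTorsion, Finset.sum_add_distrib]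
  have r1 : ∀ x y z, ∑ i, g x (e i) * bismutTorsion br J g y (e i) z = bismutTorsion br J g y x z := by
    intro x y z
    rw [H2 y x z, ← hT]
    exact Finset.sum_congr rfl fun i _ => by rw [H2 y (e i) z]
  have r2 : ∀ x y z, ∑ i, g x (e i) * bismutTorsion br J g y z (e i) = bismutTorsion br J g y z x := by
    intro x y z
    rw [← H2 x y z, ← hT]
    exact Finset.sum_congr rfl fun i _ => by rw [H2 (e i) y z]
  rw [hT, r1, r2, r1, r1, r1]
  have h := hH (e a) (e b) (e k)
  simp only [bismutTorsionDeriv] at h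
  rw [hc.skew (e k) (e a)]
  have n : bismutTorsion br J g w (-br (e a) (e k)) (e b)
      = -bismutTorsion br J g w (br (e a) (e k)) (e b) := by
    rw [H2, ← neg_one_smul ℝ (br (e a) (e k)), bismutTorsion_smul_left, ← H2]
    ring
  rw [n]
  linarith [H1 (br w (e b)) (e a) (e k), H2 (e a) (e b) (br w (e k)), H2 (e b) (br w (e k)) (e a),
    H1 w (br (e a) (e b)) (e k), H1 w (br (e a) (e k)) (e b), H1 w (br (e b) (e k)) (e a)]

/-- `structureRicci` computes the components of the reduced Ricci tensor. -/
theorem structureRicci_frame (hB : IsBismutPair br J g D D') (x v : ι) :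
    structureRicci (frameBracket br g e) (frameTorsion br J g e) x v
      = reducedRicci g e D D' (e x) (e v) := by
  have K := hB.apply_eq hc hu.symm
  rw [structureRicci, reducedRicci]
  refine Finset.sum_congr rfl fun a _ => ?_
  have h0 := hu.sum_mul_apply ((g.flip (e x)) ∘ₗ D.flip (e a)) (D' (e a) (e v))
  simp only [LinearMap.comp_apply, LinearMap.flip_apply] at h0
  rw [← h0]
  refine Finset.sum_congr rfl fun k _ => ?_
  rw [K]
  have h := hB.torsion (e a) (e v) (e k)
  rw [K] at h
  simp only [bismutCoeff, frameBracket, frameTorsion] at h ⊢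
  congr 1
  linarith

variable (hH : ∀ v x y z, bismutTorsionDeriv br J g v x y z = 0)
include hH

/-- The reduced Ricci tensor is orthogonal to the gauge terms `⟨D_v w, x⟩`: it is the gradient of
an energy which is invariant under inner derivations and under exact two-forms. -/
theorem sum_structureRicci_gauge (hB : IsBismutPair br J g D D') (w : V) :
    ∑ x, ∑ v, structureRicci (frameBracket br g e) (frameTorsion br J g e) x v
      * g (D (e v) w) (e x) = 0 := by
  set R := structureRicci (frameBracket br g e) (frameTorsion br J g e)
  have H1 := bismutTorsion_swap (J := J) (g := g) hc.skew
  have H2 := bismutTorsion_rotate (br := br) (J := J) (g := g)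
  -- The variation by the inner derivation `ad w`, which does not change the energy.
  have v1 := energy_variation (c := frameBracket br g e) (frameBracket_swap hc) (frameTorsion_swap hc)
    (frameTorsion_rotate (br := br) (J := J) (g := g) (e := e)) (fun a i => g (br w (e a)) (e i))
    (fun a i => bismutTorsion br J g w (e a) (e i))
    (fun a i => by rw [H2, H1, H2 w])
  -- The frame is fixed, and `H` varies by the derivative of `d⟨·, w⟩`, which is `0`.
  have v2 := energy_variation (c := frameBracket br g e) (frameBracket_swap hc) (frameTorsion_swap hc)
    (frameTorsion_rotate (br := br) (J := J) (g := g) (e := e)) (fun a i => 0)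
    (fun a i => g (br (e a) (e i)) w) (fun a i => by rw [hc.skew]; simp)
  have z : ∀ a b k, formVariation (fun a i => 0) (fun a i => g (br (e a) (e i)) w)
      (frameBracket br g e) (frameTorsion br J g e) a b k = 0 := by
    intro a b k
    have h : ∀ x y, ∑ i, g x (e i) * g (br (e i) y) w = g (br x y) w := fun x y =>
      hu.sum_mul_apply ((g.flip w) ∘ₗ br.flip y) x
    simp only [formVariation, frameBracket, Finset.sum_add_distrib, h, zero_mul,
      Finset.sum_const_zero]
    have := congrArg (fun t => g t w) (hc.jacobi (e a) (e b) (e k))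
    simp at this
    linarith
  have b0 : ∀ a b k, bracketVariation (fun a i => 0) (frameBracket br g e) a b k = 0 := by
    intro a b k
    simp [bracketVariation]
  simp only [normVariation, bracketVariation_inner hc hu, formVariation_inner hc hu w (hH w), z, b0,
    mul_zero, Finset.sum_const_zero, sub_zero, zero_sub] at v1 v2
  have K := hB.apply_eq hc hu.symm
  have s1 : ∑ x, ∑ v, (R x v + R v x) * g (br w (e x)) (e v)
      = ∑ x, ∑ v, R x v * (g (br w (e x)) (e v) + g (br w (e v)) (e x)) := by
    have : ∑ x, ∑ v, R v x * g (br w (e x)) (e v) = ∑ x, ∑ v, R x v * g (br w (e v)) (e x) :=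
      Finset.sum_comm
    simp only [add_mul, mul_add, Finset.sum_add_distrib]
    rw [this]
  have s2 : ∑ x, ∑ v, R x v * g (D (e v) w) (e x)
      = -(1 / 2) * (∑ x, ∑ v, R x v * (g (br w (e x)) (e v) + g (br w (e v)) (e x)))
        + 1 / 2 * (∑ x, ∑ v, R x v * g (br (e x) (e v)) w)
        + 1 / 2 * ∑ x, ∑ v, R x v * bismutTorsion br J g w (e x) (e v) := by
    simp only [Finset.mul_sum, ← Finset.sum_add_distrib]
    refine Finset.sum_congr rfl fun x _ => Finset.sum_congr rfl fun v _ => ?_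
    rw [K, bismutCoeff, hc.skew (e v) w, H2]
    simp only [map_neg, LinearMap.neg_apply]
    ring
  rw [s2]
  linarith

/-- Along the pluriclosed flow the energy grows at the rate `|R|²`, where `R` is the reduced Ricci
tensor, and this rate controls the growth of the bracket. -/
theorem energy_variation_flow :
    (∃ R : ι → ι → ℝ,
      -(1 / 2) * normVariation (frameBracket br g e) (fun a i => -(1 / 2) * flowForm br J g e (e a) (e i))
      - (∑ a, ∑ b, ∑ k, frameBracket br g e a k b * bracketVariation
          (fun a i => -(1 / 2) * flowForm br J g e (e a) (e i)) (frameBracket br g e) a b k)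
      - 1 / 6 * (∑ a, ∑ b, ∑ k, frameTorsion br J g e a b k * formVariation
          (fun a i => -(1 / 2) * flowForm br J g e (e a) (e i))
          (fun a i => torsionPotential br J g e (e a) (e i))
          (frameBracket br g e) (frameTorsion br J g e) a b k)
      = ∑ a, ∑ i, R a i ^ 2 ∧
    2 * normVariation (frameBracket br g e) (fun a i => -(1 / 2) * flowForm br J g e (e a) (e i))
      ≤ 3 / 2 * (Fintype.card ι : ℝ) ^ 4 * (1 + ∑ a, ∑ i, R a i ^ 2)
      * ∑ a, ∑ b, ∑ k, frameBracket br g e a b k * frameBracket br g e a b k) := by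
  obtain ⟨A, hA⟩ := exists_isChernForm hc hu
  obtain ⟨D, D', hB, -⟩ := hA.exists_isBismutPair hc hu
  obtain ⟨w, hw⟩ := exists_bismutPotential_bracket_eq hc hu hB hH
  set c := frameBracket br g e
  set R := structureRicci c (frameTorsion br J g e)
  have hR : ∀ a i, R a i = reducedRicci g e D D' (e a) (e i) := structureRicci_frame hc hu hB
  have hg := sum_structureRicci_gauge hc hu hH hB w
  -- The gauge term. The velocity of the flow and `torsionPotential` are the symmetric and the
  -- skew-symmetric part of `-R + L`.
  let L : ι → ι → ℝ := fun a i => g (D (e i) w) (e a)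
  have hU : ∀ a i, bismutPotential br J g e (br (J (e a)) (e i)) = -R a i + L a i := fun a i => by
    rw [hw, hR]
  have η1 : ∀ x, bismutPotential br J g e (-x) = -bismutPotential br J g e x := by
    intro x
    rw [bismutPotential_eq hc hu hB, bismutPotential_eq hc hu hB]
    simp
  have hU' : ∀ a i, bismutPotential br J g e (br (e a) (J (e i))) = -(-R i a + L i a) := fun a i => by
    rw [hc.skew, η1, hU]
  have hP : ∀ a i, flowForm br J g e (e a) (e i) = 1 / 2 * ((-R a i + L a i) + (-R i a + L i a)) := by
    intro a i
    rw [flowForm, hU, hU']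
    ring
  have hβ : ∀ a i, torsionPotential br J g e (e a) (e i)
      = 1 / 2 * ((-R a i + L a i) - (-R i a + L i a)) := by
    intro a i
    rw [torsionPotential, hU, hU']
    ring
  refine ⟨R, ?_, ?_⟩
  · rw [energy_variation (c := frameBracket br g e) (frameBracket_swap hc) (frameTorsion_swap hc)
      (frameTorsion_rotate (br := br) (J := J) (g := g) (e := e)) _ _
      (fun a i => by rw [hβ, hβ]; ring)]
    have t1 : ∑ a, ∑ i, (R a i + R i a) * (-(1 / 2) * flowForm br J g e (e a) (e i))
        = -∑ a, ∑ i, R a i * flowForm br J g e (e a) (e i) := by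
      have : ∑ a, ∑ i, R i a * flowForm br J g e (e a) (e i)
          = ∑ a, ∑ i, R a i * flowForm br J g e (e a) (e i) := by
        rw [Finset.sum_comm]
        refine Finset.sum_congr rfl fun a _ => Finset.sum_congr rfl fun i _ => ?_
        rw [hP, hP]
        ring
      simp only [add_mul, mul_left_comm, ← Finset.mul_sum, Finset.sum_add_distrib, this]
      ring
    rw [t1, ← sub_zero (∑ a, ∑ i, R a i ^ 2), ← hg]
    simp only [← Finset.sum_sub_distrib, ← Finset.sum_neg_distrib]
    refine Finset.sum_congr rfl fun a _ => Finset.sum_congr rfl fun i _ => ?_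
    rw [hP, hβ]
    simp only [L]
    ring
  · refine le_of_eq_of_le ?_ (normVariation_le (frameBracket_swap hc) R)
    have hM : normVariation c (fun a i => g (br w (e a)) (e i)) = 0 := by
      simp only [normVariation, c, bracketVariation_inner hc hu, mul_zero, Finset.sum_const_zero]
    -- The symmetric part of the gauge term is the one of an inner derivation, to which the norm of
    -- the bracket is insensitive.
    have hL : ∀ a i, L a i + L i a = -(g (br w (e a)) (e i) + g (br w (e i)) (e a)) := by
      intro a i
      have H1 := bismutTorsion_swap (J := J) (g := g) hc.skew
      have H2 := bismutTorsion_rotate (br := br) (J := J) (g := g)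
      simp only [L, hB.apply_eq hc hu.symm, bismutCoeff]
      rw [hc.skew (e i) w, hc.skew (e a) w, hc.skew (e i) (e a), H2 (e i) w, H1 w]
      simp only [map_neg, LinearMap.neg_apply]
      linarith [H2 (e a) w (e i), H2 w (e i) (e a), H1 w (e i) (e a), H1 (e a) w (e i), H2 (e i) w (e a)]
    have hm : (fun a i => -(1 / 2) * flowForm br J g e (e a) (e i))
        = fun a i => 1 / 4 * ((R a i + R i a)
          + (g (br w (e a)) (e i) + g (br w (e i)) (e a))) := by
      funext a i
      rw [hP]
      linarith [hL a i]
    have T := normVariation_transpose (c := c) (frameBracket_swap hc)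
    rw [hm, normVariation_smul, normVariation_add, normVariation_add, normVariation_add,
      T R, T (fun a i => g (br w (e a)) (e i)), hM]
    ring

end Frame
section Solvable

/-! ### The energy of a solvable Lie algebra -/

/-- In a finite-dimensional inner product space, a descending chain of subspaces admits an adapted
Parseval frame. -/
theorem exists_adapted_frame {V : Type*} [NormedAddCommGroup V] [InnerProductSpace ℝ V]
    [FiniteDimensional ℝ V] (W : ℕ → Submodule ℝ V) (h0 : W 0 = ⊤) (hW : Antitone W) {n : ℕ}
    (hn : W n = ⊥) :
    ∃ (κ : Type) (_ : Fintype κ) (f : κ → V) (l : κ → ℕ),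
      (∀ x, ∑ k, inner ℝ x (f k) • f k = x) ∧
      ∀ k, f k ∈ W (l k) ∧ ∀ y ∈ W (l k + 1), inner ℝ y (f k) = 0 := by
  -- The frame consists of orthonormal bases of the complements of `W (j + 1)` in `W j`; the
  -- expansion of a vector is a telescoping sum of projections.
  let U : Fin n → Submodule ℝ V := fun j => W j ⊓ (W (j + 1))ᗮ
  let b := fun j => stdOrthonormalBasis ℝ (U j)
  refine ⟨(j : Fin n) × Fin (Module.finrank ℝ (U j)), inferInstance, fun k => (b k.1 k.2 : V),
    fun k => k.1, fun x => ?_, fun k => ⟨(b k.1 k.2).2.1, fun y hy => (b k.1 k.2).2.2 y hy⟩⟩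
  rw [Fintype.sum_sigma]
  have key : ∀ j : Fin n, ∑ i, inner ℝ x (b j i : V) • (b j i : V)
      = (W j).starProjection x - (W (j + 1)).starProjection x := by
    intro j
    have hmem : (W j).starProjection x - (W (j + 1)).starProjection x ∈ U j := by
      refine ⟨sub_mem (Submodule.starProjection_apply_mem _ _) (hW (Nat.le_succ _)
        (Submodule.starProjection_apply_mem _ _)), ?_⟩
      have e : (W j).starProjection x - (W (j + 1)).starProjection x
          = (x - (W (j + 1)).starProjection x) - (x - (W j).starProjection x) := by abel
      rw [e]
      exact sub_mem (Submodule.sub_starProjection_mem_orthogonal _)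
        (Submodule.orthogonal_le (hW (Nat.le_succ _))
          (Submodule.sub_starProjection_mem_orthogonal _))
    have h := congrArg Subtype.val ((b j).sum_repr' ⟨_, hmem⟩)
    refine Eq.trans ?_ h
    push_cast
    refine Finset.sum_congr rfl fun i _ => ?_
    congr 1
    have h1 : inner ℝ (b j i : V) (x - (W j).starProjection x) = 0 :=
      Submodule.sub_starProjection_mem_orthogonal x _ (b j i).2.1
    have h2 : inner ℝ ((W (j + 1)).starProjection x) (b j i : V) = 0 :=
      (b j i).2.2 _ (Submodule.starProjection_apply_mem _ _)
    rw [Submodule.coe_inner, real_inner_comm]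
    simp only [inner_sub_right] at h1 ⊢
    rw [real_inner_comm] at h2
    linarith
  rw [Finset.sum_congr rfl fun j _ => key j, Fin.sum_univ_eq_sum_range
    (fun j => (W j).starProjection x - (W (j + 1)).starProjection x), Finset.sum_range_sub', h0, hn]
  simp [Submodule.starProjection_top]

variable {V ι : Type*} [AddCommGroup V] [Module ℝ V] [Fintype ι]
  {br : V →ₗ[ℝ] V →ₗ[ℝ] V} {J : V →ₗ[ℝ] V} {g : V →ₗ[ℝ] V →ₗ[ℝ] ℝ} {e : ι → V}

/-- The derived series of a bracket. -/
def derivedSpace (br : V →ₗ[ℝ] V →ₗ[ℝ] V) : ℕ → Submodule ℝ V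
  | 0 => ⊤
  | n + 1 => Submodule.map₂ br (derivedSpace br n) (derivedSpace br n)

theorem IsParsevalFrame.exists_adapted (hu : IsParsevalFrame J g e) (W : ℕ → Submodule ℝ V)
    (h0 : W 0 = ⊤) (hW : Antitone W) {n : ℕ} (hn : W n = ⊥) :
    ∃ (κ : Type) (_ : Fintype κ) (f : κ → V) (l : κ → ℕ), IsParsevalFrame J g f ∧
      ∀ k, f k ∈ W (l k) ∧ ∀ y ∈ W (l k + 1), g y (f k) = 0 := by
  have hfin : FiniteDimensional ℝ V := by
    classical
    refine ⟨⟨Finset.univ.image e, ?_⟩⟩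
    rw [eq_top_iff]
    intro x _
    rw [← hu.expand x]
    exact Submodule.sum_mem _ fun a _ => Submodule.smul_mem _ _ (Submodule.subset_span (by simp))
  let C : InnerProductSpace.Core ℝ V :=
    { inner := fun x y => g x y
      conj_inner_symm := fun x y => by simp [hu.symm x y]
      re_inner_nonneg := fun x => by
        simp only [← hu.parseval x x]
        exact Finset.sum_nonneg fun _ _ => mul_self_nonneg _
      add_left := fun x y z => by simp
      smul_left := fun x y r => by simp
      definite := fun x hx => by
        have hx' : ∑ a, g x (e a) * g x (e a) = 0 := by rw [hu.parseval]; exact hx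
        rw [Finset.sum_eq_zero_iff_of_nonneg fun _ _ => mul_self_nonneg _] at hx'
        rw [← hu.expand x]
        refine Finset.sum_eq_zero fun a _ => ?_
        rw [mul_self_eq_zero.mp (hx' a (Finset.mem_univ a)), zero_smul] }
  let _ : NormedAddCommGroup V := C.toNormedAddCommGroup
  let _ : InnerProductSpace ℝ V := InnerProductSpace.ofCore C.toCore
  obtain ⟨κ, hκ, f, l, hf, hl⟩ := exists_adapted_frame W h0 hW hn
  exact ⟨κ, hκ, f, l, ⟨hu.symm, hu.inv, hf⟩, hl⟩

theorem derivedSpace_antitone : Antitone (derivedSpace br) := by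
  refine antitone_nat_of_succ_le fun n => ?_
  induction n with
  | zero => exact le_top
  | succ n ih => exact Submodule.map₂_le_map₂ ih ih

theorem bracket_mem_derivedSpace (hc : IsComplexLie br J) (n : ℕ) (x : V) {y : V}
    (hy : y ∈ derivedSpace br n) : br x y ∈ derivedSpace br n := by
  induction n generalizing x y with
  | zero => trivial
  | succ n ih =>
    suffices h : derivedSpace br (n + 1) ≤ (derivedSpace br (n + 1)).comap (br x) from h hy
    refine Submodule.map₂_le.mpr fun p hp q hq => ?_
    have h : br x (br p q) = br (br x p) q + br p (br x q) := by
      have := hc.jacobi x p q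
      rw [hc.skew (br p q) x, hc.skew q x, map_neg, LinearMap.neg_apply, hc.skew (br x q)] at this
      linear_combination (norm := module) -(1 : ℝ) • this
    rw [Submodule.mem_comap, h]
    exact add_mem (Submodule.apply_mem_map₂ _ (ih x hp) hq) (Submodule.apply_mem_map₂ _ hp (ih x hq))

namespace IsParsevalFrame

variable {κ : Type*} [Fintype κ] {f : κ → V}

theorem sum_sq_bracket_eq (hu : IsParsevalFrame J g e) (hf : IsParsevalFrame J g f) :
    ∑ a, ∑ b, ∑ k, frameBracket br g e a b k * frameBracket br g e a b k
      = ∑ a, ∑ b, ∑ k, frameBracket br g f a b k * frameBracket br g f a b k := by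
  simp only [frameBracket, hu.parseval, hf.parseval]
  have h1 : ∀ x, ∑ b, g (br x (e b)) (br x (e b)) = ∑ b, g (br x (f b)) (br x (f b)) :=
    fun x => hu.contraction_eq hf (g.compl₁₂ (br x) (br x))
  simp_rw [h1]
  refine Finset.sum_comm.trans (Eq.trans ?_ Finset.sum_comm)
  exact Finset.sum_congr rfl fun b _ =>
    hu.contraction_eq hf (g.compl₁₂ (br.flip (f b)) (br.flip (f b)))

theorem sum_bracket_eq (hu : IsParsevalFrame J g e) (hf : IsParsevalFrame J g f) :
    ∑ a, ∑ b, ∑ k, frameBracket br g e a b k * frameBracket br g e a k b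
      = ∑ a, ∑ b, ∑ k, frameBracket br g f a b k * frameBracket br g f a k b := by
  have q : ∀ a b, ∑ k, frameBracket br g e a b k * frameBracket br g e a k b
      = g (br (e a) (br (e a) (e b))) (e b) := fun a b =>
    hu.sum_mul_apply (g.flip (e b) ∘ₗ br (e a)) (br (e a) (e b))
  have q' : ∀ a b, ∑ k, frameBracket br g f a b k * frameBracket br g f a k b
      = g (br (f a) (br (f a) (f b))) (f b) := fun a b =>
    hf.sum_mul_apply (g.flip (f b) ∘ₗ br (f a)) (br (f a) (f b))
  have h1 : ∀ x, ∑ b, g (br x (br x (e b))) (e b) = ∑ b, g (br x (br x (f b))) (f b) :=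
    fun x => hu.contraction_eq hf (g ∘ₗ br x ∘ₗ br x)
  simp_rw [q, q', h1]
  refine Finset.sum_comm.trans (Eq.trans ?_ Finset.sum_comm)
  exact Finset.sum_congr rfl fun b _ =>
    hu.contraction_eq hf (LinearMap.mk₂ ℝ (fun x y => g (br x (br y (f b))) (f b))
      (by intros; simp) (by intros; simp) (by intros; simp) (by intros; simp))

end IsParsevalFrame

/-- For a solvable Lie algebra the Killing form cannot outweigh the norm of the bracket: in a frame
adapted to the derived series `[e_a, e_b]` only has components of level at least those of `e_a` and
`e_b`, and of higher level when the two agree. -/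
theorem sum_bracket_ge (hc : IsComplexLie br J) (hu : IsParsevalFrame J g e) {n : ℕ}
    (hn : derivedSpace br n = ⊥) :
    -(1 / 2) * ∑ a, ∑ b, ∑ k, frameBracket br g e a b k * frameBracket br g e a b k
      ≤ ∑ a, ∑ b, ∑ k, frameBracket br g e a b k * frameBracket br g e a k b := by
  obtain ⟨κ, _, f, l, hf, hl⟩ := hu.exists_adapted (derivedSpace br) rfl derivedSpace_antitone hn
  rw [hu.sum_sq_bracket_eq hf, hu.sum_bracket_eq hf]
  set c := frameBracket br g f
  have hskew : ∀ a b k, c a b k = -c b a k := frameBracket_swap hc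
  have z : ∀ a b k j, br (f a) (f b) ∈ derivedSpace br j → l k < j → c a b k = 0 :=
    fun a b k j h hj => (hl k).2 _ (derivedSpace_antitone hj h)
  have z1 : ∀ a b k, l k < l b → c a b k = 0 := fun a b k h =>
    z a b k _ (bracket_mem_derivedSpace hc _ _ (hl b).1) h
  have z2 : ∀ a b k, l k < l a → c a b k = 0 := fun a b k h => by
    rw [hskew, z1 b a k h, neg_zero]
  have z3 : ∀ a b k, l a = l b → l k ≤ l a → c a b k = 0 := by
    intro a b k hab h
    refine z a b k (l a + 1) ?_ (Nat.lt_succ_of_le h)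
    refine Submodule.apply_mem_map₂ _ (hl a).1 ?_
    rw [hab]
    exact (hl b).1
  -- The products `c a b k * c a k b` that do not vanish have `l a < l b = l k`; `χ` selects these.
  -- Of `(a, b)` and `(b, a)` at most one is selected, which gives the factor `1 / 2`.
  let χ : κ → κ → κ → ℝ := fun a b k => if l a < l b ∧ l b = l k then 1 else 0
  have p1 : ∀ a b k, -(1 / 2) * (χ a b k * (c a b k * c a b k))
      - 1 / 2 * (χ a k b * (c a k b * c a k b)) ≤ c a b k * c a k b := by
    intro a b k
    simp only [χ]
    rcases lt_trichotomy (l k) (l b) with h | h | h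
    · rw [z1 a b k h]
      split_ifs <;> nlinarith [mul_self_nonneg (c a k b)]
    · rcases lt_trichotomy (l a) (l b) with h' | h' | h'
      · rw [if_pos ⟨h', h.symm⟩, if_pos ⟨h ▸ h', h⟩]
        nlinarith [mul_self_nonneg (c a b k + c a k b)]
      · rw [z3 a b k h' (by omega), z3 a k b (by omega) (by omega)]
        simp
      · rw [z2 a b k (by omega), z2 a k b (by omega)]
        simp
    · rw [z1 a k b h]
      split_ifs <;> nlinarith [mul_self_nonneg (c a b k)]
  have p2 : ∀ a b k, χ a b k * (c a b k * c a b k) + χ b a k * (c b a k * c b a k)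
      ≤ c a b k * c a b k := by
    intro a b k
    rw [hskew b a k]
    simp only [χ]
    split_ifs <;> first | omega | nlinarith [mul_self_nonneg (c a b k)]
  have s1 := Finset.sum_le_sum fun a (_ : a ∈ Finset.univ) => Finset.sum_le_sum
    fun b (_ : b ∈ Finset.univ) => Finset.sum_le_sum fun k (_ : k ∈ Finset.univ) => p1 a b k
  have s2 := Finset.sum_le_sum fun a (_ : a ∈ Finset.univ) => Finset.sum_le_sum
    fun b (_ : b ∈ Finset.univ) => Finset.sum_le_sum fun k (_ : k ∈ Finset.univ) => p2 a b k
  have c1 : ∑ a, ∑ b, ∑ k, χ a k b * (c a k b * c a k b)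
      = ∑ a, ∑ b, ∑ k, χ a b k * (c a b k * c a b k) :=
    Finset.sum_congr rfl fun a _ => Finset.sum_comm
  have c2 : ∑ a, ∑ b, ∑ k, χ b a k * (c b a k * c b a k)
      = ∑ a, ∑ b, ∑ k, χ a b k * (c a b k * c a b k) := Finset.sum_comm
  simp only [Finset.sum_sub_distrib, Finset.sum_add_distrib, ← Finset.mul_sum, c1, c2] at s1 s2
  linarith

/-- On a solvable Lie algebra the energy is nonpositive. -/
theorem structureEnergy_nonpos (hc : IsComplexLie br J) (hu : IsParsevalFrame J g e) {n : ℕ}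
    (hn : derivedSpace br n = ⊥) :
    structureEnergy (frameBracket br g e) (frameTorsion br J g e) ≤ 0 := by
  have h := sum_bracket_ge hc hu hn
  have hH : 0 ≤ ∑ a, ∑ b, ∑ k, frameTorsion br J g e a b k * frameTorsion br J g e a b k :=
    Finset.sum_nonneg fun _ _ => Finset.sum_nonneg fun _ _ => Finset.sum_nonneg fun _ _ =>
      mul_self_nonneg _
  rw [structureEnergy]
  linarith

end Solvable
section ODE

/-! ### Global solutions of ordinary differential equations with a priori bounds -/

open Set

variable {X : Type*} [NormedAddCommGroup X] [NormedSpace ℝ X] [FiniteDimensional ℝ X] {f : X → X}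

/-- A continuously differentiable vector field agrees on any ball with a bounded Lipschitz one. -/
theorem exists_lipschitz_cutoff (hf : ContDiff ℝ 1 f) (R : ℝ) :
    ∃ (F : X → X) (K C : NNReal), LipschitzWith K F ∧ (∀ x, ‖F x‖ ≤ C) ∧ ∀ x, ‖x‖ ≤ R → F x = f x := by
  let χ : ContDiffBump (0 : X) := ⟨|R| + 1, |R| + 2, by positivity, by linarith⟩
  have hs : HasCompactSupport fun x => χ x • f x := χ.hasCompactSupport.smul_right
  have hd : ContDiff ℝ 1 fun x => χ x • f x := χ.contDiff.smul hf
  obtain ⟨K, hK⟩ := hd.lipschitzWith_of_hasCompactSupport hs one_ne_zero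
  obtain ⟨C, hC⟩ := hs.exists_bound_of_continuous hd.continuous
  refine ⟨_, K, C.toNNReal, hK, fun x => (hC x).trans (Real.le_coe_toNNReal C), fun x hx => ?_⟩
  have h1 : χ x = 1 := χ.one_of_mem_closedBall (by
    rw [mem_closedBall_zero_iff]
    exact hx.trans ((le_abs_self R).trans (by simp [χ])))
  simp [h1]

/-- Solutions on a compact interval remain in a ball, where the vector field is Lipschitz. -/
theorem ode_unique (hf : ContDiff ℝ 1 f) {a : ℝ} {y z : ℝ → X} (h0 : y 0 = z 0)
    (hy : ∀ t ∈ Icc 0 a, HasDerivWithinAt y (f (y t)) (Icc 0 a) t)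
    (hz : ∀ t ∈ Icc 0 a, HasDerivWithinAt z (f (z t)) (Icc 0 a) t) : EqOn y z (Icc 0 a) := by
  have cy : ContinuousOn y (Icc 0 a) := fun t ht => (hy t ht).continuousWithinAt
  have cz : ContinuousOn z (Icc 0 a) := fun t ht => (hz t ht).continuousWithinAt
  obtain ⟨R, hR⟩ := (isCompact_Icc.image_of_continuousOn cy).isBounded.exists_norm_le
  obtain ⟨R', hR'⟩ := (isCompact_Icc.image_of_continuousOn cz).isBounded.exists_norm_le
  obtain ⟨F, K, -, hF, -, hFf⟩ := exists_lipschitz_cutoff hf (max R R')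
  have mono : ∀ t ∈ Ico 0 a, Icc 0 a ∈ nhdsWithin t (Ici t) := fun t ht =>
    Filter.mem_of_superset (Icc_mem_nhdsGE ht.2) (Icc_subset_Icc_left ht.1)
  refine ODE_solution_unique (v := fun _ => F) (fun _ => hF) cy (fun t ht => ?_) cz
    (fun t ht => ?_) h0
  · rw [hFf _ ((hR _ (mem_image_of_mem _ (Ico_subset_Icc_self ht))).trans (le_max_left _ _))]
    exact (hy t (Ico_subset_Icc_self ht)).mono_of_mem_nhdsWithin (mono t ht)
  · rw [hFf _ ((hR' _ (mem_image_of_mem _ (Ico_subset_Icc_self ht))).trans (le_max_right _ _))]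
    exact (hz t (Ico_subset_Icc_self ht)).mono_of_mem_nhdsWithin (mono t ht)

/-- If all solutions starting at `x₀` stay in the ball of radius `R`, the solution for the vector
field cut off outside the ball of radius `R + 1` never notices the cutoff. -/
theorem exists_ode_solution_Icc (hf : ContDiff ℝ 1 f) (x₀ : X) {T R : ℝ} (hT : 0 ≤ T)
    (hb : ∀ s ∈ Icc 0 T, ∀ y : ℝ → X, y 0 = x₀ →
      (∀ t ∈ Icc 0 s, HasDerivWithinAt y (f (y t)) (Icc 0 s) t) → ‖y s‖ ≤ R) :
    ∃ y : ℝ → X, y 0 = x₀ ∧ ∀ t ∈ Icc 0 T, HasDerivWithinAt y (f (y t)) (Icc 0 T) t := by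
  obtain ⟨F, K, C, hF, hC, hFf⟩ := exists_lipschitz_cutoff hf (R + 1)
  have hPL : IsPicardLindelof (fun _ => F) (tmin := 0) (tmax := T) ⟨0, by simp [hT]⟩ x₀
      (C * T.toNNReal) 0 C K := by
    refine IsPicardLindelof.of_time_independent (fun x _ => hC x) hF.lipschitzOnWith ?_
    simp [hT]
  obtain ⟨y, hy0, hy⟩ := hPL.exists_eq_forall_mem_Icc_hasDerivWithinAt₀
  have hy0 : y 0 = x₀ := hy0
  have cy : ContinuousOn y (Icc 0 T) := fun t ht => (hy t ht).continuousWithinAt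
  have hx₀ : ‖x₀‖ ≤ R := by
    have := hb 0 ⟨le_rfl, hT⟩ (fun t => x₀) rfl (fun t ht => by
      rw [Icc_self]
      exact HasFDerivWithinAt.singleton)
    exact this
  have hlt : ∀ t ∈ Icc 0 T, ‖y t‖ < R + 1 := by
    by_contra! hcon
    obtain ⟨t₁, ht₁, hlarge⟩ := hcon
    have hS : IsCompact {t ∈ Icc 0 T | R + 1 ≤ ‖y t‖} := by
      have := cy.norm.preimage_isClosed_of_isClosed isClosed_Icc (isClosed_Ici (a := R + 1))
      exact isCompact_Icc.of_isClosed_subset this (fun t ht => ht.1)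
    -- Up to the first time `τ` with `R + 1 ≤ ‖y τ‖` the curve solves the original equation, so that
    -- its norm is at most `R` before `τ`, which contradicts continuity at `τ`.
    obtain ⟨τ, ⟨hτ, hτR⟩, hτl⟩ := hS.exists_isLeast ⟨t₁, ht₁, hlarge⟩
    have hτ0 : 0 < τ := by
      rcases hτ.1.eq_or_lt with h | h
      · rw [← h, hy0] at hτR
        linarith
      · exact h
    have hbefore : ∀ s ∈ Ico 0 τ, ‖y s‖ ≤ R := by
      intro s hs
      have hsT : Icc 0 s ⊆ Icc 0 T := Icc_subset_Icc_right (hs.2.le.trans hτ.2)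
      refine hb s ⟨hs.1, hs.2.le.trans hτ.2⟩ y hy0 fun t ht => ?_
      have : ‖y t‖ < R + 1 := by
        by_contra! h
        exact absurd (hτl ⟨hsT ht, h⟩) (not_le.mpr (ht.2.trans_lt hs.2))
      rw [← hFf _ this.le]
      exact (hy t (hsT ht)).mono hsT
    have hcτ : Filter.Tendsto (fun t => ‖y t‖) (nhdsWithin τ (Ico 0 τ)) (nhds ‖y τ‖) :=
      ((cy τ hτ).mono (Ico_subset_Icc_self.trans (Icc_subset_Icc_right hτ.2))).norm
    have hne : (nhdsWithin τ (Ico 0 τ)).NeBot := by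
      rw [← mem_closure_iff_nhdsWithin_neBot, closure_Ico hτ0.ne]
      exact ⟨hτ0.le, le_rfl⟩
    have := le_of_tendsto hcτ (Filter.eventually_of_mem self_mem_nhdsWithin hbefore)
    linarith
  refine ⟨y, hy0, fun t ht => ?_⟩
  rw [← hFf _ (hlt t ht).le]
  exact hy t ht

/-- A continuously differentiable vector field has a solution for all positive times if its
solutions are bounded on each bounded time interval. -/
theorem exists_ode_solution_of_bounded (hf : ContDiff ℝ 1 f) (x₀ : X)
    (hb : ∀ T, ∃ R, ∀ s ∈ Icc 0 T, ∀ y : ℝ → X, y 0 = x₀ →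
      (∀ t ∈ Icc 0 s, HasDerivWithinAt y (f (y t)) (Icc 0 s) t) → ‖y s‖ ≤ R) :
    ∃ y : ℝ → X, y 0 = x₀ ∧ ∀ t ∈ Ici 0, HasDerivWithinAt y (f (y t)) (Ici 0) t := by
  have h : ∀ n : ℕ, ∃ y : ℝ → X, y 0 = x₀ ∧
      ∀ t ∈ Icc 0 (n + 1 : ℝ), HasDerivWithinAt y (f (y t)) (Icc 0 (n + 1 : ℝ)) t := by
    intro n
    obtain ⟨R, hR⟩ := hb (n + 1)
    exact exists_ode_solution_Icc hf x₀ (by positivity) hR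
  choose y hy0 hy using h
  have huniq : ∀ n m, n ≤ m → EqOn (y n) (y m) (Icc 0 (n + 1 : ℝ)) := by
    intro n m hnm
    have hsub : Icc (0 : ℝ) (n + 1) ⊆ Icc 0 (m + 1) := Icc_subset_Icc_right (by simpa using hnm)
    exact ode_unique hf ((hy0 n).trans (hy0 m).symm) (hy n)
      (fun t ht => (hy m t (hsub ht)).mono hsub)
  refine ⟨fun t => y ⌊t⌋₊ t, by simp [hy0], fun t ht => ?_⟩
  have hlt : t < ⌊t⌋₊ + 1 := Nat.lt_floor_add_one t
  have heq : ∀ s ∈ Ico (0 : ℝ) (⌊t⌋₊ + 1), y ⌊s⌋₊ s = y ⌊t⌋₊ s := by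
    intro s hs
    refine huniq _ _ ?_ ⟨hs.1, (Nat.lt_floor_add_one s).le⟩
    have : (⌊s⌋₊ : ℝ) < ⌊t⌋₊ + 1 := (Nat.floor_le hs.1).trans_lt hs.2
    exact Nat.lt_succ_iff.mp (by exact_mod_cast this)
  have hmem : Ico (0 : ℝ) (⌊t⌋₊ + 1) ∈ nhdsWithin t (Ici 0) := by
    rw [← Ici_inter_Iio]
    exact inter_mem_nhdsWithin _ (Iio_mem_nhds hlt)
  have h1 := (hy ⌊t⌋₊ t ⟨ht, hlt.le⟩).mono_of_mem_nhdsWithin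
    (Filter.mem_of_superset hmem Ico_subset_Icc_self)
  exact h1.congr_of_eventuallyEq (Filter.eventually_of_mem hmem heq) rfl

end ODE
section FrameFlow

/-! ### The evolution of the Bismut torsion -/

section Algebra

variable {V ι : Type*} [AddCommGroup V] [Module ℝ V] [Fintype ι]
  {br : V →ₗ[ℝ] V →ₗ[ℝ] V} {J : V →ₗ[ℝ] V} {g : V →ₗ[ℝ] V →ₗ[ℝ] ℝ} {e : ι → V}

theorem bismutPotential_add (x y : V) : bismutPotential br J g e (x + y)
    = bismutPotential br J g e x + bismutPotential br J g e y := by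
  simp only [bismutPotential, bismutCoeff, bismutTorsion_add_left, map_add, LinearMap.add_apply,
    ← mul_add, ← Finset.sum_add_distrib]
  exact congrArg _ (Finset.sum_congr rfl fun a _ => by ring)

theorem bismutPotential_smul (r : ℝ) (x : V) : bismutPotential br J g e (r • x)
    = r * bismutPotential br J g e x := by
  simp only [bismutPotential, bismutCoeff, bismutTorsion_smul_left, map_smul, LinearMap.smul_apply,
    smul_eq_mul, Finset.mul_sum]
  exact Finset.sum_congr rfl fun a _ => by ring

theorem bismutPotential_neg (x : V) : bismutPotential br J g e (-x)
    = -bismutPotential br J g e x := by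
  rw [← neg_one_smul ℝ, bismutPotential_smul, neg_one_mul]

/-- The velocity of the flow as a bilinear form. -/
noncomputable def flowBilin (br : V →ₗ[ℝ] V →ₗ[ℝ] V) (J : V →ₗ[ℝ] V) (g : V →ₗ[ℝ] V →ₗ[ℝ] ℝ)
    (e : ι → V) : V →ₗ[ℝ] V →ₗ[ℝ] ℝ :=
  LinearMap.mk₂ ℝ (flowForm br J g e)
    (by intros; simp only [flowForm, map_add, LinearMap.add_apply, bismutPotential_add]; ring)
    (by intros; simp only [flowForm, map_smul, LinearMap.smul_apply, bismutPotential_smul,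
      smul_eq_mul]; ring)
    (by intros; simp only [flowForm, map_add, bismutPotential_add]; ring)
    (by intros; simp only [flowForm, map_smul, bismutPotential_smul, smul_eq_mul]; ring)

@[simp]
theorem flowBilin_apply (x y : V) : flowBilin br J g e x y = flowForm br J g e x y := rfl

theorem flowForm_symm (hs : ∀ x y, br x y = -br y x) (x y : V) :
    flowForm br J g e x y = flowForm br J g e y x := by
  rw [flowForm, flowForm, hs (J x) y, hs x (J y), bismutPotential_neg, bismutPotential_neg]
  ring

theorem flowForm_J (hJ : ∀ x, J (J x) = -x) (x y : V) :
    flowForm br J g e (J x) (J y) = flowForm br J g e x y := by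
  simp only [flowForm, hJ, map_neg, LinearMap.neg_apply, bismutPotential_neg]
  ring

/-- The evolution `∂H/∂t = dβ` of the Bismut torsion. -/
theorem bismutTorsion_flowBilin (hc : IsComplexLie br J) (x y z : V) :
    bismutTorsion br J (flowBilin br J g e) x y z
      = -(torsionPotential br J g e (br x y) z + torsionPotential br J g e (br y z) x
        + torsionPotential br J g e (br z x) y) := by
  have hn : ∀ x y z, bismutPotential br J g e (br (J (br (J x) (J y))) z)
      = bismutPotential br J g e (br (J (br x y)) z) - bismutPotential br J g e (br (br (J x) y) z)
        - bismutPotential br J g e (br (br x (J y)) z) := by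
    intro x y z
    have h : J (br (J x) (J y)) = J (br x y) - br (J x) y - br x (J y) := by
      have := congrArg J (hc.nijenhuis x y)
      simp only [map_add, map_sub, hc.sq, map_zero] at this
      linear_combination (norm := module) -(1 : ℝ) • this
    rw [h]
    simp only [sub_eq_add_neg, map_add, map_neg, LinearMap.add_apply, LinearMap.neg_apply,
      bismutPotential_add, bismutPotential_neg]
  have hj : ∀ x y z, bismutPotential br J g e (br (br x y) z)
      + bismutPotential br J g e (br (br y z) x) + bismutPotential br J g e (br (br z x) y) = 0 := by
    intro x y z
    rw [← bismutPotential_add, ← bismutPotential_add, hc.jacobi, ← zero_smul ℝ (0 : V),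
      bismutPotential_smul, zero_mul]
  simp only [bismutTorsion, flowBilin_apply, flowForm, torsionPotential, hn]
  linarith [hj (J x) (J y) (J z), hj (J x) y z, hj x (J y) z, hj x y (J z)]

theorem torsionPotential_swap (hs : ∀ x y, br x y = -br y x) (x y : V) :
    torsionPotential br J g e x y = -torsionPotential br J g e y x := by
  rw [torsionPotential, torsionPotential, hs (J x) y, hs x (J y), bismutPotential_neg,
    bismutPotential_neg]
  ring

theorem torsionPotential_add (x x' y : V) : torsionPotential br J g e (x + x') y
    = torsionPotential br J g e x y + torsionPotential br J g e x' y := by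
  simp only [torsionPotential, map_add, LinearMap.add_apply, bismutPotential_add]
  ring

theorem torsionPotential_smul (r : ℝ) (x y : V) : torsionPotential br J g e (r • x) y
    = r * torsionPotential br J g e x y := by
  simp only [torsionPotential, map_smul, LinearMap.smul_apply, bismutPotential_smul]
  ring

/-- The derivative of `H` along the flow is exact, hence closed. -/
theorem bismutTorsionDeriv_flowBilin (hc : IsComplexLie br J) (w x y z : V) :
    bismutTorsionDeriv br J (flowBilin br J g e) w x y z = 0 := by
  have hsw := torsionPotential_swap (J := J) (g := g) (e := e) hc.skew
  have hj : ∀ x y z w, torsionPotential br J g e (br (br x y) z) w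
      + torsionPotential br J g e (br (br y z) x) w
      + torsionPotential br J g e (br (br z x) y) w = 0 := by
    intro x y z w
    rw [← torsionPotential_add, ← torsionPotential_add, hc.jacobi, ← zero_smul ℝ (0 : V),
      torsionPotential_smul, zero_mul]
  have hn : ∀ x y z, torsionPotential br J g e (br x y) z = -torsionPotential br J g e (br y x) z := by
    intro x y z
    rw [hc.skew, ← neg_one_smul ℝ, torsionPotential_smul, neg_one_mul]
  have hn' : ∀ x y z w, torsionPotential br J g e (br (br x y) z) w
      = -torsionPotential br J g e (br (br y x) z) w := by
    intro x y z w
    rw [hc.skew x y, map_neg, LinearMap.neg_apply, ← neg_one_smul ℝ (br (br y x) z),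
      torsionPotential_smul, neg_one_mul]
  simp only [bismutTorsionDeriv, bismutTorsion_flowBilin hc]
  linarith [hj w x y z, hj w x z y, hj w y z x, hj x y z w, hsw (br w x) (br y z), hsw (br w y) (br x z),
    hsw (br w z) (br x y), hn z (br w x) y, hn z (br w y) x, hn y (br w z) x, hn z (br x y) w,
    hn y (br x z) w, hn x (br y z) w, hn' y w x z, hn' z w x y, hn' z w y x, hn' z x y w]

end Algebra

end FrameFlow
/-! ### The flow as an evolution equation for frames -/

section FrameODE

variable {V ι : Type*} [NormedAddCommGroup V] [NormedSpace ℝ V] [Fintype ι]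
  {br : V →ₗ[ℝ] V →ₗ[ℝ] V} {J : V →ₗ[ℝ] V}

/-- The bilinear form `∑ θ_a ⊗ θ_a` of a coframe. -/
noncomputable def coframeForm (θ : ι → V →L[ℝ] ℝ) : V →ₗ[ℝ] V →ₗ[ℝ] ℝ :=
  LinearMap.mk₂ ℝ (fun x y => ∑ a, θ a x * θ a y)
    (by intros; simp [add_mul, Finset.sum_add_distrib])
    (by intros; simp [Finset.mul_sum, mul_assoc])
    (by intros; simp [mul_add, Finset.sum_add_distrib])
    (by intros; simp [Finset.mul_sum, mul_left_comm])

theorem coframeForm_apply (θ : ι → V →L[ℝ] ℝ) (x y : V) :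
    coframeForm θ x y = ∑ a, θ a x * θ a y := rfl

/-- The components of the velocity of the flow at the metric defined by a frame and its coframe. -/
noncomputable def flowMatrix (br : V →ₗ[ℝ] V →ₗ[ℝ] V) (J : V →ₗ[ℝ] V)
    (p : (ι → V) × (ι → V →L[ℝ] ℝ)) (a b : ι) : ℝ :=
  flowForm br J (coframeForm p.2) p.1 (p.1 a) (p.1 b)

/-- The evolution equation for a frame and its coframe which induces the flow of the metric. -/
noncomputable def flowField (br : V →ₗ[ℝ] V →ₗ[ℝ] V) (J : V →ₗ[ℝ] V)
    (p : (ι → V) × (ι → V →L[ℝ] ℝ)) : (ι → V) × (ι → V →L[ℝ] ℝ) :=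
  (fun b => -(1 / 2 : ℝ) • ∑ a, flowMatrix br J p b a • p.1 a,
    fun a => (1 / 2 : ℝ) • ∑ b, flowMatrix br J p a b • p.2 b)

section Smooth

variable [FiniteDimensional ℝ V] {X : Type*} [NormedAddCommGroup X] [NormedSpace ℝ X]

theorem contDiffAt_bilinear {W : Type*} [NormedAddCommGroup W] [NormedSpace ℝ W]
    (B : V →ₗ[ℝ] V →ₗ[ℝ] W) {x y : X → V} {q : X} (hx : ContDiffAt ℝ 1 x q)
    (hy : ContDiffAt ℝ 1 y q) : ContDiffAt ℝ 1 (fun p => B (x p) (y p)) q := by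
  let B' : V →L[ℝ] V →L[ℝ] W := (LinearMap.toContinuousLinearMap.toLinearMap ∘ₗ B).toContinuousLinearMap
  exact (B'.contDiff.contDiffAt.comp q hx).clm_apply hy

theorem contDiffAt_linear {W : Type*} [NormedAddCommGroup W] [NormedSpace ℝ W]
    (B : V →ₗ[ℝ] W) {x : X → V} {q : X} (hx : ContDiffAt ℝ 1 x q) :
    ContDiffAt ℝ 1 (fun p => B (x p)) q :=
  B.toContinuousLinearMap.contDiff.contDiffAt.comp q hx

variable {x y z : X → V} {e : X → ι → V} {g : X → V →ₗ[ℝ] V →ₗ[ℝ] ℝ} {q : X}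
  (hg : ∀ {x y : X → V}, ContDiffAt ℝ 1 x q → ContDiffAt ℝ 1 y q →
    ContDiffAt ℝ 1 (fun p => g p (x p) (y p)) q)
include hg

theorem contDiffAt_bismutTorsion (hx : ContDiffAt ℝ 1 x q) (hy : ContDiffAt ℝ 1 y q)
    (hz : ContDiffAt ℝ 1 z q) :
    ContDiffAt ℝ 1 (fun p => bismutTorsion br J (g p) (x p) (y p) (z p)) q := by
  have c : ∀ {u v w : X → V}, ContDiffAt ℝ 1 u q → ContDiffAt ℝ 1 v q → ContDiffAt ℝ 1 w q →
      ContDiffAt ℝ 1 (fun p => g p (br (J (u p)) (J (v p))) (w p)) q := fun hu hv hw =>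
    hg (contDiffAt_bilinear br (contDiffAt_linear J hu) (contDiffAt_linear J hv)) hw
  exact (((c hx hy hz).add (c hy hz hx)).add (c hz hx hy)).neg

theorem contDiffAt_bismutCoeff (hx : ContDiffAt ℝ 1 x q) (hy : ContDiffAt ℝ 1 y q)
    (hz : ContDiffAt ℝ 1 z q) :
    ContDiffAt ℝ 1 (fun p => bismutCoeff br J (g p) (x p) (y p) (z p)) q := by
  have c : ∀ {u v w : X → V}, ContDiffAt ℝ 1 u q → ContDiffAt ℝ 1 v q → ContDiffAt ℝ 1 w q →
      ContDiffAt ℝ 1 (fun p => g p (br (u p) (v p)) (w p)) q := fun hu hv hw =>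
    hg (contDiffAt_bilinear br hu hv) hw
  exact contDiffAt_const.mul ((((c hx hy hz).sub (c hy hz hx)).add (c hz hx hy)).add
    (contDiffAt_bismutTorsion hg hx hy hz))

theorem contDiffAt_bismutPotential (he : ∀ a, ContDiffAt ℝ 1 (fun p => e p a) q)
    (hx : ContDiffAt ℝ 1 x q) :
    ContDiffAt ℝ 1 (fun p => bismutPotential br J (g p) (e p) (x p)) q :=
  contDiffAt_const.mul (ContDiffAt.sum fun a _ =>
    contDiffAt_bismutCoeff hg hx (he a) (contDiffAt_linear J (he a)))

theorem contDiffAt_flowForm (he : ∀ a, ContDiffAt ℝ 1 (fun p => e p a) q)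
    (hx : ContDiffAt ℝ 1 x q) (hy : ContDiffAt ℝ 1 y q) :
    ContDiffAt ℝ 1 (fun p => flowForm br J (g p) (e p) (x p) (y p)) q :=
  contDiffAt_const.mul ((contDiffAt_bismutPotential hg he
    (contDiffAt_bilinear br (contDiffAt_linear J hx) hy)).sub
    (contDiffAt_bismutPotential hg he (contDiffAt_bilinear br hx (contDiffAt_linear J hy))))

end Smooth

theorem contDiffAt_coframeForm {X : Type*} [NormedAddCommGroup X] [NormedSpace ℝ X] {x y : X → V}
    {θ : X → ι → V →L[ℝ] ℝ} {q : X} (hθ : ∀ a, ContDiffAt ℝ 1 (fun p => θ p a) q)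
    (hx : ContDiffAt ℝ 1 x q) (hy : ContDiffAt ℝ 1 y q) :
    ContDiffAt ℝ 1 (fun p => coframeForm (θ p) (x p) (y p)) q := by
  simp only [coframeForm_apply]
  exact ContDiffAt.sum fun a _ => ((hθ a).clm_apply hx).mul ((hθ a).clm_apply hy)

theorem contDiff_flowMatrix [FiniteDimensional ℝ V] (a b : ι) :
    ContDiff ℝ 1 fun p : (ι → V) × (ι → V →L[ℝ] ℝ) => flowMatrix br J p a b := by
  rw [contDiff_iff_contDiffAt]
  intro q
  have he : ∀ a, ContDiffAt ℝ 1 (fun p : (ι → V) × (ι → V →L[ℝ] ℝ) => p.1 a) q :=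
    fun a => by fun_prop
  have hθ : ∀ a, ContDiffAt ℝ 1 (fun p : (ι → V) × (ι → V →L[ℝ] ℝ) => p.2 a) q :=
    fun a => by fun_prop
  exact contDiffAt_flowForm (contDiffAt_coframeForm hθ) he (he a) (he b)

theorem contDiff_flowField [FiniteDimensional ℝ V] :
    ContDiff ℝ 1 (flowField br J : (ι → V) × (ι → V →L[ℝ] ℝ) → (ι → V) × (ι → V →L[ℝ] ℝ)) := by
  have he : ∀ a, ContDiff ℝ 1 fun p : (ι → V) × (ι → V →L[ℝ] ℝ) => p.1 a := fun a => by fun_prop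
  have hθ : ∀ a, ContDiff ℝ 1 fun p : (ι → V) × (ι → V →L[ℝ] ℝ) => p.2 a := fun a => by fun_prop
  refine ContDiff.prodMk (contDiff_pi.mpr fun b => ?_) (contDiff_pi.mpr fun a => ?_)
  · exact (ContDiff.sum fun a _ => (contDiff_flowMatrix b a).smul (he a)).const_smul _
  · exact (ContDiff.sum fun b _ => (contDiff_flowMatrix a b).smul (hθ b)).const_smul _

section Solution

variable {y : ℝ → (ι → V) × (ι → V →L[ℝ] ℝ)} {S : Set ℝ} {t : ℝ}

theorem hasDerivWithinAt_frame (h : HasDerivWithinAt y (flowField br J (y t)) S t) (b : ι) :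
    HasDerivWithinAt (fun s => (y s).1 b)
      (-(1 / 2 : ℝ) • ∑ a, flowMatrix br J (y t) b a • (y t).1 a) S t :=
  hasDerivWithinAt_pi.mp h.fst b

theorem hasDerivWithinAt_coframe (h : HasDerivWithinAt y (flowField br J (y t)) S t) (a : ι) :
    HasDerivWithinAt (fun s => (y s).2 a)
      ((1 / 2 : ℝ) • ∑ b, flowMatrix br J (y t) a b • (y t).2 b) S t :=
  hasDerivWithinAt_pi.mp h.snd a

variable (hc : IsComplexLie br J) (h : HasDerivWithinAt y (flowField br J (y t)) S t)
include hc h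

/-- The frame and the coframe remain dual to each other. -/
theorem hasDerivWithinAt_expansion (x : V) :
    HasDerivWithinAt (fun s => ∑ a, (y s).2 a x • (y s).1 a) 0 S t := by
  have h1 := HasDerivWithinAt.fun_sum fun a (_ : a ∈ Finset.univ) =>
    ((hasDerivWithinAt_coframe h a).clm_apply (hasDerivWithinAt_const t S x)).smul
      (hasDerivWithinAt_frame h a)
  refine h1.congr_deriv ?_
  have hs : ∀ a b, flowMatrix br J (y t) a b = flowMatrix br J (y t) b a := fun a b =>
    flowForm_symm hc.skew _ _
  have h2 : ∑ a, ∑ b, (flowMatrix br J (y t) a b * (y t).2 a x) • (y t).1 b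
      = ∑ a, ∑ b, (flowMatrix br J (y t) a b * (y t).2 b x) • (y t).1 a := by
    rw [Finset.sum_comm]
    exact Finset.sum_congr rfl fun a _ => Finset.sum_congr rfl fun b _ => by rw [hs]
  simp only [map_zero, add_zero, _root_.smul_apply, _root_.sum_apply,
    smul_eq_mul, Finset.sum_add_distrib, smul_smul, Finset.smul_sum,
    Finset.sum_smul] at h2 ⊢
  rw [← sub_eq_zero] at h2
  have h3 := congrArg (fun w => -(1 / 2 : ℝ) • w) h2
  simp only [smul_zero, smul_sub, Finset.smul_sum, smul_smul] at h3
  rw [← h3, sub_eq_add_neg]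
  congr 1
  · exact Finset.sum_congr rfl fun a _ => Finset.sum_congr rfl fun b _ => congrArg (· • _) (by ring)
  · simp only [← Finset.sum_neg_distrib]
    exact Finset.sum_congr rfl fun a _ => Finset.sum_congr rfl fun b _ => by
      rw [← neg_smul]
      exact congrArg (· • _) (by ring)

variable (hexp : ∀ x, ∑ a, (y t).2 a x • (y t).1 a = x)
include hexp

omit hc h in
theorem flowForm_eq_sum (u v : V) :
    flowForm br J (coframeForm (y t).2) (y t).1 u v
      = ∑ a, ∑ b, (y t).2 a u * (y t).2 b v * flowMatrix br J (y t) a b := by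
  have h1 := congrArg₂ (fun u v => flowBilin br J (coframeForm (y t).2) (y t).1 u v)
    (hexp u) (hexp v)
  rw [← flowBilin_apply, ← h1]
  simp only [map_sum, map_smul, LinearMap.sum_apply, LinearMap.smul_apply, smul_eq_mul, Finset.mul_sum,
    flowBilin_apply, flowMatrix]
  rw [Finset.sum_comm]
  exact Finset.sum_congr rfl fun a _ => Finset.sum_congr rfl fun b _ => by ring

/-- The form `∑ θ_a ⊗ θ_a` moves with the velocity of the flow. -/
theorem hasDerivWithinAt_coframeForm {u v : ℝ → V} {u' v' : V} (hu : HasDerivWithinAt u u' S t)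
    (hv : HasDerivWithinAt v v' S t) :
    HasDerivWithinAt (fun s => coframeForm (y s).2 (u s) (v s))
      (flowForm br J (coframeForm (y t).2) (y t).1 (u t) (v t)
        + coframeForm (y t).2 u' (v t) + coframeForm (y t).2 (u t) v') S t := by
  have h1 := HasDerivWithinAt.fun_sum fun a (_ : a ∈ Finset.univ) =>
    ((hasDerivWithinAt_coframe h a).clm_apply hu).mul ((hasDerivWithinAt_coframe h a).clm_apply hv)
  refine h1.congr_deriv ?_
  have hs : ∀ a b, flowMatrix br J (y t) a b = flowMatrix br J (y t) b a := fun a b =>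
    flowForm_symm hc.skew _ _
  have e1 : ∑ a, ∑ b, (y t).2 a (u t) * (y t).2 b (v t) * flowMatrix br J (y t) a b
      = ∑ a, ∑ b, (y t).2 b (u t) * (y t).2 a (v t) * flowMatrix br J (y t) a b := by
    rw [Finset.sum_comm]
    exact Finset.sum_congr rfl fun a _ => Finset.sum_congr rfl fun b _ => by rw [hs]
  have e2 : ∑ a, ((1 / 2 : ℝ) * ∑ b, flowMatrix br J (y t) a b * (y t).2 b (u t)) * (y t).2 a (v t)
      = 1 / 2 * ∑ a, ∑ b, (y t).2 b (u t) * (y t).2 a (v t) * flowMatrix br J (y t) a b := by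
    simp only [Finset.mul_sum, Finset.sum_mul]
    exact Finset.sum_congr rfl fun a _ => Finset.sum_congr rfl fun b _ => by ring
  have e3 : ∑ a, (y t).2 a (u t) * ((1 / 2 : ℝ) * ∑ b, flowMatrix br J (y t) a b * (y t).2 b (v t))
      = 1 / 2 * ∑ a, ∑ b, (y t).2 a (u t) * (y t).2 b (v t) * flowMatrix br J (y t) a b := by
    simp only [Finset.mul_sum]
    exact Finset.sum_congr rfl fun a _ => Finset.sum_congr rfl fun b _ => by ring
  simp only [flowForm_eq_sum hexp, coframeForm_apply, _root_.smul_apply, _root_.sum_apply,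
    smul_eq_mul, mul_add, add_mul, Finset.sum_add_distrib, e2, e3]
  linarith

variable [FiniteDimensional ℝ V]

omit hc h hexp in
theorem hasDerivWithinAt_bilinear {W : Type*} [NormedAddCommGroup W] [NormedSpace ℝ W]
    (B : V →ₗ[ℝ] V →ₗ[ℝ] W) {u v : ℝ → V} {u' v' : V} (hu : HasDerivWithinAt u u' S t)
    (hv : HasDerivWithinAt v v' S t) :
    HasDerivWithinAt (fun s => B (u s) (v s)) (B u' (v t) + B (u t) v') S t := by
  let B' : V →L[ℝ] V →L[ℝ] W := (LinearMap.toContinuousLinearMap.toLinearMap ∘ₗ B).toContinuousLinearMap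
  exact (B'.hasFDerivAt.comp_hasDerivWithinAt t hu).clm_apply hv

omit hc h hexp in
theorem hasDerivWithinAt_linear {W : Type*} [NormedAddCommGroup W] [NormedSpace ℝ W]
    (B : V →ₗ[ℝ] W) {u : ℝ → V} {u' : V} (hu : HasDerivWithinAt u u' S t) :
    HasDerivWithinAt (fun s => B (u s)) (B u') S t :=
  B.toContinuousLinearMap.hasFDerivAt.comp_hasDerivWithinAt t hu

theorem hasDerivWithinAt_bismutTorsion {u v w : ℝ → V} {u' v' w' : V}
    (hu : HasDerivWithinAt u u' S t) (hv : HasDerivWithinAt v v' S t)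
    (hw : HasDerivWithinAt w w' S t) :
    HasDerivWithinAt (fun s => bismutTorsion br J (coframeForm (y s).2) (u s) (v s) (w s))
      (bismutTorsion br J (flowBilin br J (coframeForm (y t).2) (y t).1) (u t) (v t) (w t)
        + bismutTorsion br J (coframeForm (y t).2) u' (v t) (w t)
        + bismutTorsion br J (coframeForm (y t).2) (u t) v' (w t)
        + bismutTorsion br J (coframeForm (y t).2) (u t) (v t) w') S t := by
  have hJ : ∀ {u : ℝ → V} {u' : V}, HasDerivWithinAt u u' S t →
      HasDerivWithinAt (fun s => J (u s)) (J u') S t := hasDerivWithinAt_linear J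
  have c : ∀ {u v w : ℝ → V} {u' v' w' : V}, HasDerivWithinAt u u' S t →
      HasDerivWithinAt v v' S t → HasDerivWithinAt w w' S t →
      HasDerivWithinAt (fun s => coframeForm (y s).2 (br (J (u s)) (J (v s))) (w s)) _ S t :=
    fun hu hv hw => hasDerivWithinAt_coframeForm hc h hexp
      (hasDerivWithinAt_bilinear br (hJ hu) (hJ hv)) hw
  refine (((c hu hv hw).add (c hv hw hu)).add (c hw hu hv)).neg.congr_deriv ?_
  simp only [bismutTorsion, flowBilin_apply, map_add, LinearMap.add_apply]
  ring

variable (hu : IsParsevalFrame J (coframeForm (y t).2) (y t).1)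
include hu

theorem hasDerivWithinAt_frameBracket (a b k : ι) :
    HasDerivWithinAt (fun s => frameBracket br (coframeForm (y s).2) (y s).1 a b k)
      (bracketVariation (fun a i => -(1 / 2) * flowMatrix br J (y t) a i)
        (frameBracket br (coframeForm (y t).2) (y t).1) a b k) S t := by
  have he := hasDerivWithinAt_frame h
  refine (hasDerivWithinAt_coframeForm hc h hexp
    (hasDerivWithinAt_bilinear br (he a) (he b)) (he k)).congr_deriv ?_
  have h1 := hu.sum_mul_apply ((flowBilin br J (coframeForm (y t).2) (y t).1).flip ((y t).1 k))
    (br ((y t).1 a) ((y t).1 b))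
  simp only [LinearMap.flip_apply, flowBilin_apply] at h1
  have hs : ∀ a b, flowMatrix br J (y t) a b = flowMatrix br J (y t) b a := fun a b =>
    flowForm_symm hc.skew _ _
  rw [← h1]
  simp only [bracketVariation, frameBracket, map_add, LinearMap.add_apply, map_smul,
    LinearMap.smul_apply, map_sum, LinearMap.sum_apply, smul_eq_mul, Finset.mul_sum,
    ← Finset.sum_add_distrib]
  refine Finset.sum_congr rfl fun i _ => ?_
  rw [hs k i, flowMatrix, flowMatrix, flowMatrix]
  ring

theorem hasDerivWithinAt_frameTorsion (a b k : ι) :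
    HasDerivWithinAt (fun s => frameTorsion br J (coframeForm (y s).2) (y s).1 a b k)
      (formVariation (fun a i => -(1 / 2) * flowMatrix br J (y t) a i)
        (fun a i => torsionPotential br J (coframeForm (y t).2) (y t).1 ((y t).1 a) ((y t).1 i))
        (frameBracket br (coframeForm (y t).2) (y t).1)
        (frameTorsion br J (coframeForm (y t).2) (y t).1) a b k) S t := by
  have he := hasDerivWithinAt_frame h
  refine (hasDerivWithinAt_bismutTorsion hc h hexp (he a) (he b) (he k)).congr_deriv ?_
  rw [bismutTorsion_flowBilin hc]
  let T : V → V →ₗ[ℝ] ℝ := fun v =>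
    { toFun := fun x => torsionPotential br J (coframeForm (y t).2) (y t).1 x v
      map_add' := fun x x' => torsionPotential_add x x' v
      map_smul' := fun r x => torsionPotential_smul r x v }
  have hT : ∀ x v, torsionPotential br J (coframeForm (y t).2) (y t).1 x v
      = ∑ i, coframeForm (y t).2 x ((y t).1 i)
        * torsionPotential br J (coframeForm (y t).2) (y t).1 ((y t).1 i) v :=
    fun x v => (hu.sum_mul_apply (T v) x).symm
  let L : V → V → V →ₗ[ℝ] ℝ := fun v w =>
    { toFun := fun x => bismutTorsion br J (coframeForm (y t).2) x v w
      map_add' := fun x x' => bismutTorsion_add_left x x' v w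
      map_smul' := fun r x => bismutTorsion_smul_left r x v w }
  have hL : ∀ (c : ι → ℝ) v w, bismutTorsion br J (coframeForm (y t).2)
      (-(1 / 2 : ℝ) • ∑ i, c i • (y t).1 i) v w
      = ∑ i, -(1 / 2) * c i * bismutTorsion br J (coframeForm (y t).2) ((y t).1 i) v w := by
    intro c v w
    change L v w _ = _
    simp only [map_smul, map_sum, smul_eq_mul, Finset.mul_sum, ← mul_assoc]
    rfl
  have H2 := bismutTorsion_rotate (br := br) (J := J) (g := coframeForm (y t).2)
  rw [H2 ((y t).1 a) (_ • _), ← H2 (_ • _) ((y t).1 a), hL, hL, hL, hT, hT (br _ ((y t).1 k)), hT]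
  simp only [formVariation, frameBracket, frameTorsion, Finset.sum_add_distrib]
  simp only [H2 ((y t).1 a) _ ((y t).1 k), ← H2 _ ((y t).1 a) ((y t).1 b)]
  ring

end Solution

end FrameODE
/-! ### A priori bounds -/

section EnergyDerivative

variable {ι : Type*} [Fintype ι] {c H : ℝ → ι → ι → ι → ℝ} {S : Set ℝ} {t : ℝ}

theorem hasDerivWithinAt_sum_mul {f g : ℝ → ι → ι → ι → ℝ} {f' g' : ι → ι → ι → ℝ}
    (hf : ∀ a b k, HasDerivWithinAt (fun s => f s a b k) (f' a b k) S t)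
    (hg : ∀ a b k, HasDerivWithinAt (fun s => g s a b k) (g' a b k) S t) :
    HasDerivWithinAt (fun s => ∑ a, ∑ b, ∑ k, f s a b k * g s a b k)
      (∑ a, ∑ b, ∑ k, g t a b k * f' a b k + ∑ a, ∑ b, ∑ k, f t a b k * g' a b k) S t := by
  have h := HasDerivWithinAt.fun_sum fun a (_ : a ∈ Finset.univ) =>
    HasDerivWithinAt.fun_sum fun b (_ : b ∈ Finset.univ) =>
      HasDerivWithinAt.fun_sum fun k (_ : k ∈ Finset.univ) => (hf a b k).mul (hg a b k)
  refine h.congr_deriv ?_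
  simp only [Finset.sum_add_distrib, mul_comm]

theorem hasDerivWithinAt_structureEnergy {c' H' : ι → ι → ι → ℝ}
    (hc : ∀ a b k, HasDerivWithinAt (fun s => c s a b k) (c' a b k) S t)
    (hH : ∀ a b k, HasDerivWithinAt (fun s => H s a b k) (H' a b k) S t) :
    HasDerivWithinAt (fun s => structureEnergy (c s) (H s))
      (-(1 / 2) * (∑ a, ∑ b, ∑ k, c t a b k * c' a b k) - ∑ a, ∑ b, ∑ k, c t a k b * c' a b k
      - 1 / 6 * ∑ a, ∑ b, ∑ k, H t a b k * H' a b k) S t := by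
  refine ((((hasDerivWithinAt_sum_mul hc hc).const_mul (-(1 / 4))).sub
    ((hasDerivWithinAt_sum_mul hc (g := fun s a b k => c s a k b)
      (fun a b k => hc a k b)).const_mul (1 / 2))).sub
    ((hasDerivWithinAt_sum_mul hH hH).const_mul (1 / 12))).congr_deriv ?_
  have : ∑ a, ∑ b, ∑ k, c t a b k * c' a k b = ∑ a, ∑ b, ∑ k, c t a k b * c' a b k :=
    Finset.sum_congr rfl fun a _ => Finset.sum_comm
  rw [this]
  ring

theorem eq_of_hasDerivWithinAt_zero {W : Type*} [NormedAddCommGroup W] [NormedSpace ℝ W]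
    {f : ℝ → W} (hS : Convex ℝ S) (h : ∀ t ∈ S, HasDerivWithinAt f 0 S t) {s t : ℝ} (hs : s ∈ S)
    (ht : t ∈ S) : f t = f s := by
  have := hS.norm_image_sub_le_of_norm_hasDerivWithin_le (C := 0) h (by simp) hs ht
  rw [zero_mul] at this
  exact sub_eq_zero.mp (norm_le_zero_iff.mp this)

end EnergyDerivative

section Bound

variable {V ι : Type*} [AddCommGroup V] [Module ℝ V] [Fintype ι]
  {br : V →ₗ[ℝ] V →ₗ[ℝ] V} {J : V →ₗ[ℝ] V} {g : V →ₗ[ℝ] V →ₗ[ℝ] ℝ} {e : ι → V}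

namespace IsParsevalFrame

variable (hu : IsParsevalFrame J g e)
include hu

theorem nonneg (x : V) : 0 ≤ g x x := by
  rw [← hu.parseval]
  exact Finset.sum_nonneg fun _ _ => mul_self_nonneg _

theorem frame_le_one (a : ι) : g (e a) (e a) ≤ 1 := by
  have h : g (e a) (e a) * g (e a) (e a) ≤ g (e a) (e a) := by
    conv_rhs => rw [← hu.parseval (e a) (e a)]
    exact Finset.single_le_sum (f := fun b => g (e a) (e b) * g (e a) (e b))
      (fun _ _ => mul_self_nonneg _) (Finset.mem_univ a)
  nlinarith [hu.nonneg (e a)]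

/-- The Cauchy–Schwarz inequality for the bracket. -/
theorem bracket_sq_le (x y z : V) : g (br x y) z ^ 2
    ≤ (∑ a, ∑ b, ∑ k, frameBracket br g e a b k * frameBracket br g e a b k)
      * (g x x * g y y * g z z) := by
  have h1 : g (br x y) z = ∑ p : ι × ι × ι, frameBracket br g e p.1 p.2.1 p.2.2
      * (g x (e p.1) * g y (e p.2.1) * g z (e p.2.2)) := by
    have e1 := hu.sum_mul_apply (g.flip z ∘ₗ br.flip y) x
    have e2 : ∀ a, ∑ b, g y (e b) * g (br (e a) (e b)) z = g (br (e a) y) z := fun a =>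
      hu.sum_mul_apply (g.flip z ∘ₗ br (e a)) y
    have e3 : ∀ a b, ∑ k, g z (e k) * g (br (e a) (e b)) (e k) = g (br (e a) (e b)) z := fun a b =>
      hu.sum_mul_apply (g (br (e a) (e b))) z
    simp only [LinearMap.comp_apply, LinearMap.flip_apply] at e1
    simp only [← e1, ← e2, ← e3, Fintype.sum_prod_type, Finset.mul_sum, frameBracket]
    exact Finset.sum_congr rfl fun a _ => Finset.sum_congr rfl fun b _ =>
      Finset.sum_congr rfl fun k _ => by ring
  have h2 : g x x * g y y * g z z
      = ∑ p : ι × ι × ι, (g x (e p.1) * g y (e p.2.1) * g z (e p.2.2)) ^ 2 := by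
    rw [← hu.parseval x x, ← hu.parseval y y, ← hu.parseval z z]
    rw [Finset.sum_mul_sum, Finset.sum_mul]
    simp_rw [Fintype.sum_prod_type, Finset.sum_mul_sum]
    exact Finset.sum_congr rfl fun a _ => Finset.sum_congr rfl fun b _ =>
      Finset.sum_congr rfl fun k _ => by ring
  have h3 : ∑ a, ∑ b, ∑ k, frameBracket br g e a b k * frameBracket br g e a b k
      = ∑ p : ι × ι × ι, frameBracket br g e p.1 p.2.1 p.2.2 ^ 2 := by
    simp only [Fintype.sum_prod_type, sq]
  rw [h1, h2, h3]
  exact Finset.sum_mul_sq_le_sq_mul_sq _ _ _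

/-- The velocity of the flow is bounded quadratically by the bracket. -/
theorem abs_flowForm_le (a b : ι) :
    |flowForm br J g e (e a) (e b)| ≤ 3 / 2 * Fintype.card ι
      * ∑ a, ∑ b, ∑ k, frameBracket br g e a b k * frameBracket br g e a b k := by
  set N := ∑ a, ∑ b, ∑ k, frameBracket br g e a b k * frameBracket br g e a b k
  have hN : 0 ≤ N := Finset.sum_nonneg fun _ _ => Finset.sum_nonneg fun _ _ =>
    Finset.sum_nonneg fun _ _ => mul_self_nonneg _
  have n := hu.nonneg
  have hc : ∀ x y z, |g (br x y) z| ≤ √N * (√(g x x) * √(g y y) * √(g z z)) := by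
    intro x y z
    rw [← Real.sqrt_mul (n x), ← Real.sqrt_mul (mul_nonneg (n x) (n y)), ← Real.sqrt_mul hN]
    exact Real.abs_le_sqrt (hu.bracket_sq_le x y z)
  have hbr : ∀ x y, √(g (br x y) (br x y)) ≤ √N * (√(g x x) * √(g y y)) := by
    intro x y
    set z := br x y
    rcases (Real.sqrt_nonneg (g z z)).eq_or_lt with h | h
    · rw [← h]
      positivity
    · have h1 : √(g z z) * √(g z z) ≤ √N * (√(g x x) * √(g y y) * √(g z z)) := by
        rw [Real.mul_self_sqrt (n z)]
        exact (le_abs_self _).trans (hc x y z)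
      refine le_of_mul_le_mul_right ?_ h
      linarith
  have he : ∀ a, √(g (e a) (e a)) ≤ 1 := fun a => Real.sqrt_le_one.mpr (hu.frame_le_one a)
  have hH : ∀ x y z, |bismutTorsion br J g x y z| ≤ 3 * (√N * (√(g x x) * √(g y y) * √(g z z))) := by
    intro x y z
    have h1 := hc (J x) (J y) z
    have h2 := hc (J y) (J z) x
    have h3 := hc (J z) (J x) y
    rw [hu.inv, hu.inv] at h1 h2 h3
    rw [abs_le] at h1 h2 h3 ⊢
    rw [bismutTorsion]
    constructor <;> nlinarith
  have hK : ∀ x y z, |bismutCoeff br J g x y z| ≤ 3 * (√N * (√(g x x) * √(g y y) * √(g z z))) := by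
    intro x y z
    have h1 := hc x y z
    have h2 := hc y z x
    have h3 := hc z x y
    have h4 := hH x y z
    rw [abs_le] at h1 h2 h3 h4 ⊢
    rw [bismutCoeff]
    constructor <;> nlinarith
  have hη : ∀ x, |bismutPotential br J g e x| ≤ 3 / 2 * Fintype.card ι * (√N * √(g x x)) := by
    intro x
    have h1 : ∀ a, |bismutCoeff br J g x (e a) (J (e a))| ≤ 3 * (√N * √(g x x)) := by
      intro a
      refine (hK _ _ _).trans ?_
      rw [hu.inv]
      have h0 := Real.sqrt_nonneg (g (e a) (e a))
      have h2 : √(g (e a) (e a)) * √(g (e a) (e a)) ≤ 1 := mul_le_one₀ (he a) h0 (he a)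
      have h3 : √(g x x) * √(g (e a) (e a)) * √(g (e a) (e a)) ≤ √(g x x) := by
        rw [mul_assoc]
        exact mul_le_of_le_one_right (Real.sqrt_nonneg _) h2
      gcongr
    rw [bismutPotential, abs_mul]
    have h2 := (Finset.abs_sum_le_sum_abs (fun a => bismutCoeff br J g x (e a) (J (e a)))
      Finset.univ).trans (Finset.sum_le_sum fun a _ => h1 a)
    simp only [Finset.sum_const, Finset.card_univ, nsmul_eq_mul] at h2
    rw [abs_of_pos (by norm_num : (0 : ℝ) < 1 / 2)]
    linarith
  have hb : ∀ x y, √(g x x) ≤ 1 → √(g y y) ≤ 1 →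
      |bismutPotential br J g e (br x y)| ≤ 3 / 2 * Fintype.card ι * N := by
    intro x y hx hy
    refine (hη _).trans ?_
    have h1 : √(g (br x y) (br x y)) ≤ √N := (hbr x y).trans
      (mul_le_of_le_one_right (Real.sqrt_nonneg _) (mul_le_one₀ hx (Real.sqrt_nonneg _) hy))
    have h2 : √N * √(g (br x y) (br x y)) ≤ N := by
      calc _ ≤ √N * √N := by gcongr
        _ = N := Real.mul_self_sqrt hN
    gcongr
  have h1 := hb (J (e a)) (e b) (by rw [hu.inv]; exact he a) (he b)
  have h2 := hb (e a) (J (e b)) (he a) (by rw [hu.inv]; exact he b)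
  rw [flowForm]
  rw [abs_le] at h1 h2 ⊢
  constructor <;> linarith

end IsParsevalFrame

end Bound

section Flow

variable {V ι : Type*} [NormedAddCommGroup V] [NormedSpace ℝ V] [FiniteDimensional ℝ V] [Fintype ι]
  {br : V →ₗ[ℝ] V →ₗ[ℝ] V} {J : V →ₗ[ℝ] V} {y : ℝ → (ι → V) × (ι → V →L[ℝ] ℝ)} {S : Set ℝ}

omit [FiniteDimensional ℝ V] in
/-- A frame which expands all vectors by means of a coframe with the right number of members is
orthonormal for the form defined by the coframe. -/
theorem coframeForm_frame (hcard : Fintype.card ι = Module.finrank ℝ V) {e : ι → V}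
    {θ : ι → V →L[ℝ] ℝ} (hexp : ∀ x, ∑ a, θ a x • e a = x) (x : V) (b : ι) :
    coframeForm θ x (e b) = θ b x := by
  classical
  have hspan : ⊤ ≤ Submodule.span ℝ (Set.range e) := by
    intro x _
    rw [← hexp x]
    exact Submodule.sum_mem _ fun a _ => Submodule.smul_mem _ _ (Submodule.subset_span ⟨a, rfl⟩)
  have hli := linearIndependent_of_top_le_span_of_card_eq_finrank hspan hcard
  have h1 : ∀ a, θ a (e b) = if a = b then 1 else 0 := by
    have h2 : ∑ a, (θ a (e b) - if a = b then 1 else 0) • e a = 0 := by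
      simp [sub_smul, hexp]
    intro a
    have := Fintype.linearIndependent_iff.mp hli _ h2 a
    linarith
  simp [coframeForm_apply, h1]

variable (hc : IsComplexLie br J) (hcard : Fintype.card ι = Module.finrank ℝ V) (hS : Convex ℝ S)
  (h0 : (0 : ℝ) ∈ S) (hy : ∀ t ∈ S, HasDerivWithinAt y (flowField br J (y t)) S t)
include hc hS h0 hy

omit [FiniteDimensional ℝ V] in
theorem flow_expansion (hexp : ∀ x, ∑ a, (y 0).2 a x • (y 0).1 a = x) {t : ℝ} (ht : t ∈ S) (x : V) :
    ∑ a, (y t).2 a x • (y t).1 a = x :=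
  (eq_of_hasDerivWithinAt_zero hS (fun t ht => hasDerivWithinAt_expansion hc (hy t ht) x) h0 ht).trans
    (hexp x)

variable (hexp : ∀ x, ∑ a, (y 0).2 a x • (y 0).1 a = x)
include hexp

/-- The SKT condition is preserved. -/
theorem flow_bismutTorsionDeriv
    (hH : ∀ w u v z, bismutTorsionDeriv br J (coframeForm (y 0).2) w u v z = 0) {t : ℝ} (ht : t ∈ S)
    (w u v z : V) : bismutTorsionDeriv br J (coframeForm (y t).2) w u v z = 0 := by
  refine Eq.trans (eq_of_hasDerivWithinAt_zero
    (f := fun s => bismutTorsionDeriv br J (coframeForm (y s).2) w u v z) hS (fun t ht => ?_) h0 ht)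
    (hH w u v z)
  have hexp' := flow_expansion hc hS h0 hy hexp ht
  have hk : ∀ u v w : V, HasDerivWithinAt (fun s => bismutTorsion br J (coframeForm (y s).2) u v w)
      (bismutTorsion br J (flowBilin br J (coframeForm (y t).2) (y t).1) u v w) S t := by
    intro u v w
    refine (hasDerivWithinAt_bismutTorsion hc (hy t ht) hexp' (hasDerivWithinAt_const t S u)
      (hasDerivWithinAt_const t S v) (hasDerivWithinAt_const t S w)).congr_deriv ?_
    simp [bismutTorsion]
  refine ((((((hk _ _ _).neg.add (hk _ _ _)).sub (hk _ _ _)).sub (hk _ _ _)).add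
    (hk _ _ _)).sub (hk _ _ _)).congr_deriv ?_
  exact bismutTorsionDeriv_flowBilin hc w u v z

variable (hu : IsParsevalFrame J (coframeForm (y 0).2) (y 0).1)
include hcard hu

omit [FiniteDimensional ℝ V] in
/-- The frame remains a Parseval frame of the metric, and the metric remains Hermitian. -/
theorem flow_isParsevalFrame {t : ℝ} (ht : t ∈ S) :
    IsParsevalFrame J (coframeForm (y t).2) (y t).1 where
  symm u v := by simp only [coframeForm_apply, mul_comm]
  inv u v := by
    have hd : ∀ t ∈ S, HasDerivWithinAt (fun s => coframeForm (y s).2 (J u) (J v)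
        - coframeForm (y s).2 u v) 0 S t := by
      intro t ht
      have hexp' := flow_expansion hc hS h0 hy hexp ht
      have hk : ∀ u : V, HasDerivWithinAt (fun _ : ℝ => u) 0 S t := hasDerivWithinAt_const t S
      refine ((hasDerivWithinAt_coframeForm hc (hy t ht) hexp' (hk (J u)) (hk (J v))).sub
        (hasDerivWithinAt_coframeForm hc (hy t ht) hexp' (hk u) (hk v))).congr_deriv ?_
      rw [flowForm_J hc.sq]
      simp
    have := eq_of_hasDerivWithinAt_zero hS hd h0 ht
    rw [hu.inv, sub_self] at this
    linarith
  expand x := by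
    have hexp' := flow_expansion hc hS h0 hy hexp ht
    simp only [coframeForm_frame hcard hexp', hexp']

/-- On a solvable Lie algebra the bracket grows at most exponentially along the flow: the energy is
nonpositive, and its rate of change controls that of the bracket. -/
theorem flow_bracket_le (hH : ∀ w u v z, bismutTorsionDeriv br J (coframeForm (y 0).2) w u v z = 0)
    {n : ℕ} (hn : derivedSpace br n = ⊥) {t : ℝ} (ht : t ∈ S) (ht0 : 0 ≤ t) :
    ∑ a, ∑ b, ∑ k, frameBracket br (coframeForm (y t).2) (y t).1 a b k
        * frameBracket br (coframeForm (y t).2) (y t).1 a b k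
      ≤ (∑ a, ∑ b, ∑ k, frameBracket br (coframeForm (y 0).2) (y 0).1 a b k
        * frameBracket br (coframeForm (y 0).2) (y 0).1 a b k)
        * Real.exp (3 / 2 * (Fintype.card ι : ℝ) ^ 4 * (t - structureEnergy
          (frameBracket br (coframeForm (y 0).2) (y 0).1)
          (frameTorsion br J (coframeForm (y 0).2) (y 0).1))) := by
  set c : ℝ → ι → ι → ι → ℝ := fun s => frameBracket br (coframeForm (y s).2) (y s).1
  set H : ℝ → ι → ι → ι → ℝ := fun s => frameTorsion br J (coframeForm (y s).2) (y s).1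
  set N : ℝ → ℝ := fun s => ∑ a, ∑ b, ∑ k, c s a b k * c s a b k
  set F : ℝ → ℝ := fun s => structureEnergy (c s) (H s)
  set C : ℝ := 3 / 2 * (Fintype.card ι : ℝ) ^ 4
  have hN : ∀ s, 0 ≤ N s := fun s => Finset.sum_nonneg fun _ _ => Finset.sum_nonneg fun _ _ =>
    Finset.sum_nonneg fun _ _ => mul_self_nonneg _
  -- `N` satisfies `N' ≤ C (1 + F') N`.
  have key : ∀ s ∈ S, ∃ E' ≤ (0 : ℝ),
      HasDerivWithinAt (fun s => Real.exp (-(C * (s + F s))) * N s) E' S s := by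
    intro s hs
    have hus := flow_isParsevalFrame hc hcard hS h0 hy hexp hu hs
    have hexps := flow_expansion hc hS h0 hy hexp hs
    obtain ⟨R, hR1, hR2⟩ := energy_variation_flow hc hus
      (flow_bismutTorsionDeriv hc hS h0 hy hexp hH hs)
    have hc' := hasDerivWithinAt_frameBracket hc (hy s hs) hexps hus
    have hF : HasDerivWithinAt F (∑ a, ∑ i, R a i ^ 2) S s :=
      (hasDerivWithinAt_structureEnergy hc'
        (hasDerivWithinAt_frameTorsion hc (hy s hs) hexps hus)).congr_deriv hR1
    have hN' : HasDerivWithinAt N (2 * normVariation (c s)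
        (fun a i => -(1 / 2) * flowMatrix br J (y s) a i)) S s :=
      (hasDerivWithinAt_sum_mul hc' hc').congr_deriv (two_mul _).symm
    have hE := ((((hasDerivWithinAt_id s S).add hF).const_mul C).neg.exp).mul hN'
    refine ⟨_, ?_, hE⟩
    have h1 : 2 * normVariation (c s) (fun a i => -(1 / 2) * flowMatrix br J (y s) a i)
        ≤ C * (1 + ∑ a, ∑ i, R a i ^ 2) * N s := hR2
    have h2 := Real.exp_pos (-(C * (s + F s)))
    have h3 : Real.exp (-(C * (s + F s))) * (-(C * (1 + ∑ a, ∑ i, R a i ^ 2))) * N s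
        + Real.exp (-(C * (s + F s))) * (2 * normVariation (c s)
          (fun a i => -(1 / 2) * flowMatrix br J (y s) a i)) ≤ 0 := by
      nlinarith
    exact h3
  choose! E' hE'0 hE' using key
  have hanti : AntitoneOn (fun s => Real.exp (-(C * (s + F s))) * N s) S :=
    antitoneOn_of_hasDerivWithinAt_nonpos hS (fun s hs => (hE' s hs).continuousWithinAt)
      (fun s hs => (hE' s (interior_subset hs)).mono interior_subset)
      (fun s hs => hE'0 s (interior_subset hs))
  have h1 := hanti h0 ht ht0
  -- This is where solvability enters.
  have hFt : F t ≤ 0 :=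
    structureEnergy_nonpos hc (flow_isParsevalFrame hc hcard hS h0 hy hexp hu ht) hn
  simp only [zero_add] at h1
  have h2 : N t ≤ N 0 * Real.exp (C * (t + F t - F 0)) := by
    have h3 := mul_le_mul_of_nonneg_left h1 (Real.exp_pos (C * (t + F t))).le
    rw [← mul_assoc, ← Real.exp_add, add_neg_cancel, Real.exp_zero, one_mul, ← mul_assoc,
      ← Real.exp_add] at h3
    calc N t ≤ _ := h3
      _ = N 0 * Real.exp (C * (t + F t - F 0)) := by
        rw [mul_comm]
        congr 2
        ring
  refine h2.trans (mul_le_mul_of_nonneg_left (Real.exp_le_exp.mpr ?_) (hN 0))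
  have hC : 0 ≤ C := by positivity
  exact mul_le_mul_of_nonneg_left (by linarith) hC

end Flow

/-! ### Long-time existence -/

section GlobalFlow

variable {V ι : Type*} [NormedAddCommGroup V] [NormedSpace ℝ V] [FiniteDimensional ℝ V] [Fintype ι]
  {br : V →ₗ[ℝ] V →ₗ[ℝ] V} {J : V →ₗ[ℝ] V}

omit [FiniteDimensional ℝ V] in
/-- The frame equation is linear up to the factors `flowMatrix`. -/
theorem norm_flowField_le {p : (ι → V) × (ι → V →L[ℝ] ℝ)} {M : ℝ} (hM : 0 ≤ M)
    (h : ∀ a b, |flowMatrix br J p a b| ≤ M) :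
    ‖flowField br J p‖ ≤ 1 / 2 * (Fintype.card ι * M) * ‖p‖ := by
  have h1 : ∀ a, ‖p.1 a‖ ≤ ‖p‖ := fun a => (norm_le_pi_norm p.1 a).trans (norm_fst_le p)
  have h2 : ∀ a, ‖p.2 a‖ ≤ ‖p‖ := fun a => (norm_le_pi_norm p.2 a).trans (norm_snd_le p)
  have h3 : ∀ {W : Type _} [NormedAddCommGroup W] [NormedSpace ℝ W] (w : ι → W) (a : ι),
      (∀ b, ‖w b‖ ≤ ‖p‖) → ‖∑ b, flowMatrix br J p a b • w b‖ ≤ Fintype.card ι * M * ‖p‖ := by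
    intro W _ _ w a hw
    refine (norm_sum_le _ _).trans ((Finset.sum_le_sum fun b _ =>
      (norm_smul_le _ _).trans (mul_le_mul (h a b) (hw b) (norm_nonneg _) hM)).trans ?_)
    simp [mul_assoc]
  have hr : 0 ≤ 1 / 2 * (Fintype.card ι * M) * ‖p‖ := by positivity
  rw [flowField, norm_prod_le_iff, pi_norm_le_iff_of_nonneg hr, pi_norm_le_iff_of_nonneg hr]
  constructor <;> intro a <;> rw [norm_smul]
  · have := h3 p.1 a h1
    norm_num
    linarith
  · have := h3 p.2 a h2
    norm_num
    linarith

/-- Long-time existence for the frame equation on a solvable Lie algebra. -/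
theorem exists_frame_flow (hc : IsComplexLie br J) (hcard : Fintype.card ι = Module.finrank ℝ V)
    {n : ℕ} (hn : derivedSpace br n = ⊥) (p : (ι → V) × (ι → V →L[ℝ] ℝ))
    (hexp : ∀ x, ∑ a, p.2 a x • p.1 a = x) (hu : IsParsevalFrame J (coframeForm p.2) p.1)
    (hH : ∀ w u v z, bismutTorsionDeriv br J (coframeForm p.2) w u v z = 0) :
    ∃ y : ℝ → (ι → V) × (ι → V →L[ℝ] ℝ), y 0 = p ∧
      ∀ t ∈ Set.Ici 0, HasDerivWithinAt y (flowField br J (y t)) (Set.Ici 0) t := by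
  refine exists_ode_solution_of_bounded contDiff_flowField p fun T => ?_
  set N₀ := ∑ a, ∑ b, ∑ k, frameBracket br (coframeForm p.2) p.1 a b k
        * frameBracket br (coframeForm p.2) p.1 a b k
  have hN₀ : 0 ≤ N₀ := Finset.sum_nonneg fun _ _ => Finset.sum_nonneg fun _ _ =>
    Finset.sum_nonneg fun _ _ => mul_self_nonneg _
  set F₀ := structureEnergy (frameBracket br (coframeForm p.2) p.1)
    (frameTorsion br J (coframeForm p.2) p.1)
  set B := N₀ * Real.exp (3 / 2 * (Fintype.card ι : ℝ) ^ 4 * (T - F₀))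
  set M := 3 / 2 * Fintype.card ι * B
  have hM : 0 ≤ M := by positivity
  set K := 1 / 2 * (Fintype.card ι * M)
  have hK : 0 ≤ K := by positivity
  refine ⟨‖p‖ * Real.exp (K * T), fun s hs y hy0 hy => ?_⟩
  have h0 : (0 : ℝ) ∈ Set.Icc 0 s := ⟨le_rfl, hs.1⟩
  have hbound : ∀ t ∈ Set.Icc 0 s, ‖flowField br J (y t)‖ ≤ K * ‖y t‖ := by
    intro t ht
    subst hy0
    have hut := flow_isParsevalFrame hc hcard (convex_Icc 0 s) h0 hy hexp hu ht
    refine norm_flowField_le hM fun a b => (hut.abs_flowForm_le a b).trans ?_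
    refine mul_le_mul_of_nonneg_left ?_ (by positivity)
    refine (flow_bracket_le hc hcard (convex_Icc 0 s) h0 hy hexp hu hH hn ht ht.1).trans ?_
    refine mul_le_mul_of_nonneg_left (Real.exp_le_exp.mpr ?_) hN₀
    exact mul_le_mul_of_nonneg_left (sub_le_sub_right (ht.2.trans hs.2) _) (by positivity)
  have hg := norm_le_gronwallBound_of_norm_deriv_right_le (δ := ‖p‖) (K := K) (ε := 0)
    (fun t ht => (hy t ht).continuousWithinAt) (fun t ht =>
      (hy t (Set.Ico_subset_Icc_self ht)).mono_of_mem_nhdsWithin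
        (Filter.mem_of_superset (Icc_mem_nhdsGE ht.2) (Set.Icc_subset_Icc_left ht.1)))
    (by rw [hy0]) (fun t ht => by
      rw [add_zero]
      exact hbound t (Set.Ico_subset_Icc_self ht)) s ⟨hs.1, le_rfl⟩
  rw [sub_zero, gronwallBound_ε0] at hg
  refine hg.trans ?_
  gcongr
  exact hs.2

/-- Long-time existence of the flow for SKT metrics on a solvable Lie algebra. -/
theorem exists_flow (hc : IsComplexLie br J) (hcard : Fintype.card ι = Module.finrank ℝ V)
    {n : ℕ} (hn : derivedSpace br n = ⊥) {g₀ : V →ₗ[ℝ] V →ₗ[ℝ] ℝ} {e₀ : ι → V}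
    (hu : IsParsevalFrame J g₀ e₀) (hH : ∀ w u v z, bismutTorsionDeriv br J g₀ w u v z = 0) :
    ∃ (g : ℝ → V →ₗ[ℝ] V →ₗ[ℝ] ℝ) (e : ℝ → ι → V), g 0 = g₀ ∧
      ∀ t ∈ Set.Ici 0, IsParsevalFrame J (g t) (e t) ∧
        (∀ w u v z, bismutTorsionDeriv br J (g t) w u v z = 0) ∧
        ∀ u v, HasDerivWithinAt (fun s => g s u v) (flowForm br J (g t) (e t) u v) (Set.Ici 0) t := by
  obtain ⟨p, hp, rfl, hexp⟩ : ∃ p : (ι → V) × (ι → V →L[ℝ] ℝ), coframeForm p.2 = g₀ ∧ p.1 = e₀ ∧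
      ∀ x, ∑ a, p.2 a x • p.1 a = x := by
    refine ⟨(e₀, fun a => (g₀ (e₀ a)).toContinuousLinearMap), ?_, rfl, fun x => ?_⟩
    · refine LinearMap.ext₂ fun x y => ?_
      rw [coframeForm_apply, ← hu.parseval]
      exact Finset.sum_congr rfl fun a _ => by rw [hu.symm x, hu.symm y]; rfl
    · conv_rhs => rw [← hu.expand x]
      exact Finset.sum_congr rfl fun a _ => by rw [hu.symm x]; rfl
  obtain ⟨y, rfl, hy⟩ := exists_frame_flow hc hcard hn p hexp (hp ▸ hu) (hp ▸ hH)
  have h0 : (0 : ℝ) ∈ Set.Ici (0 : ℝ) := Set.self_mem_Ici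
  have hS := convex_Ici (𝕜 := ℝ) (0 : ℝ)
  refine ⟨fun t => coframeForm (y t).2, fun t => (y t).1, hp, fun t ht => ⟨?_, ?_, fun u v => ?_⟩⟩
  · exact flow_isParsevalFrame hc hcard hS h0 hy hexp (hp ▸ hu) ht
  · exact flow_bismutTorsionDeriv hc hS h0 hy hexp (hp ▸ hH) ht
  · refine (hasDerivWithinAt_coframeForm hc (hy t ht) (flow_expansion hc hS h0 hy hexp ht)
      (hasDerivWithinAt_const t _ u) (hasDerivWithinAt_const t _ v)).congr_deriv ?_
    simp

end GlobalFlow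

/-! ### Uniqueness -/

section LocalUniqueness

open Set

/-- Uniqueness for a vector field which is continuously differentiable near each point of one of the
two trajectories. -/
theorem ode_unique_of_contDiffAt {X : Type*} [NormedAddCommGroup X] [NormedSpace ℝ X] {f : X → X}
    {y z : ℝ → X} {a : ℝ} (hf : ∀ t ∈ Ico 0 a, ContDiffAt ℝ 1 f (y t)) (h0 : y 0 = z 0)
    (hy : ∀ t ∈ Ico 0 a, HasDerivWithinAt y (f (y t)) (Ico 0 a) t)
    (hz : ∀ t ∈ Ico 0 a, HasDerivWithinAt z (f (z t)) (Ico 0 a) t) : EqOn y z (Ico 0 a) := by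
  have cy : ContinuousOn y (Ico 0 a) := fun t ht => (hy t ht).continuousWithinAt
  have cz : ContinuousOn z (Ico 0 a) := fun t ht => (hz t ht).continuousWithinAt
  intro b hb
  have hba : Icc 0 b ⊆ Ico 0 a := fun t ht => ⟨ht.1, ht.2.trans_lt hb.2⟩
  have hright : ∀ t ∈ Ico 0 a, Ico 0 a ∈ nhdsWithin t (Ici t) := fun t ht =>
    Filter.mem_of_superset (Ico_mem_nhdsGE ht.2) (Ico_subset_Ico_left ht.1)
  suffices h : Icc 0 b ⊆ {t | y t = z t} from h ⟨hb.1, le_rfl⟩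
  -- The set of times up to which the curves agree is closed and open to the right.
  have hclosed : IsClosed ({t | y t = z t} ∩ Icc 0 b) := by
    have := ((cy.mono hba).prodMk (cz.mono hba)).preimage_isClosed_of_isClosed isClosed_Icc
      (isClosed_diagonal (X := X))
    rwa [inter_comm] at this
  refine hclosed.Icc_subset_of_forall_mem_nhdsWithin h0 fun t ht => ?_
  have hta : t ∈ Ico 0 a := hba ⟨ht.2.1, ht.2.2.le⟩
  obtain ⟨K, s, hs, hK⟩ := (hf t hta).exists_lipschitzOnWith
  have h1 : ∀ᶠ r in nhdsWithin t (Ici t), r ∈ Ico 0 a ∧ y r ∈ s ∧ z r ∈ s := by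
    have hr : ∀ᶠ r in nhdsWithin t (Ici t), r ∈ Ico 0 a := hright t hta
    refine hr.and (Filter.Eventually.and ?_ ?_)
    · exact ((cy t hta).mono_of_mem_nhdsWithin (hright t hta)).eventually hs
    · have : s ∈ nhds (z t) := by
        have e : y t = z t := ht.1
        rwa [← e]
      exact ((cz t hta).mono_of_mem_nhdsWithin (hright t hta)).eventually this
  obtain ⟨δ, hδ, hsub⟩ := (mem_nhdsGE_iff_exists_Icc_subset).mp h1
  have hδ : t < δ := hδ
  have heq := ODE_solution_unique_of_mem_Icc_right (v := fun _ => f) (s := fun _ => s) (K := K)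
    (f := y) (g := z) (a := t) (b := δ) (fun _ _ => hK)
    (cy.mono fun r hr => (hsub hr).1)
    (fun r hr => (hy r (hsub (Ico_subset_Icc_self hr)).1).mono_of_mem_nhdsWithin
      (hright r (hsub (Ico_subset_Icc_self hr)).1))
    (fun r hr => (hsub (Ico_subset_Icc_self hr)).2.1)
    (cz.mono fun r hr => (hsub hr).1)
    (fun r hr => (hz r (hsub (Ico_subset_Icc_self hr)).1).mono_of_mem_nhdsWithin
      (hright r (hsub (Ico_subset_Icc_self hr)).1))
    (fun r hr => (hsub (Ico_subset_Icc_self hr)).2.2) ht.1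
  exact Filter.mem_of_superset (Ioc_mem_nhdsGT hδ) fun r hr => heq (Ioc_subset_Icc_self hr)

end LocalUniqueness

section MetricUniqueness

variable {V ι : Type*} [NormedAddCommGroup V] [NormedSpace ℝ V] [FiniteDimensional ℝ V]
  {br : V →ₗ[ℝ] V →ₗ[ℝ] V} {J : V →ₗ[ℝ] V}

/-- The tensor `-S + Q` of a left-invariant Hermitian metric, in terms of its Bismut connection. -/
noncomputable def velocityForm {ι : Type*} [Fintype ι] (br : V →ₗ[ℝ] V →ₗ[ℝ] V) (J : V →ₗ[ℝ] V)
    (g : V →ₗ[ℝ] V →ₗ[ℝ] ℝ) (e : ι → V) (u v : V) : ℝ :=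
  flowForm br J g e u v + 1 / 8 * ∑ a, (bismutTorsionDeriv br J g (J u) v (e a) (J (e a))
        - bismutTorsionDeriv br J g u (J v) (e a) (J (e a)))

/-- The bilinear form whose contraction is `velocityForm`. -/
noncomputable def velocityIntegrand (br : V →ₗ[ℝ] V →ₗ[ℝ] V) (J : V →ₗ[ℝ] V)
    (g : V →ₗ[ℝ] V →ₗ[ℝ] ℝ) (u v x y : V) : ℝ :=
  1 / 2 * (1 / 2 * bismutCoeff br J g (br (J u) v) x (J y)
      - 1 / 2 * bismutCoeff br J g (br u (J v)) x (J y))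
    + 1 / 8 * (bismutTorsionDeriv br J g (J u) v x (J y)
      - bismutTorsionDeriv br J g u (J v) x (J y))

omit [FiniteDimensional ℝ V] in
theorem velocityForm_eq {ι : Type*} [Fintype ι] (g : V →ₗ[ℝ] V →ₗ[ℝ] ℝ) (e : ι → V) (u v : V) :
    velocityForm br J g e u v = ∑ a, velocityIntegrand br J g u v (e a) (e a) := by
  simp only [velocityForm, velocityIntegrand, flowForm, bismutPotential, Finset.sum_add_distrib,
    ← Finset.mul_sum, Finset.sum_sub_distrib]

/-- The map `V → V*` defined by a bilinear form. -/
noncomputable def flatMap (g : V →ₗ[ℝ] V →ₗ[ℝ] ℝ) : V →L[ℝ] V →L[ℝ] ℝ :=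
  (LinearMap.toContinuousLinearMap.toLinearMap ∘ₗ g).toContinuousLinearMap

@[simp]
theorem flatMap_apply (g : V →ₗ[ℝ] V →ₗ[ℝ] ℝ) (x y : V) : flatMap g x y = g x y := rfl

variable [Fintype ι]

theorem IsParsevalFrame.exists_equiv {κ : Type*} [Fintype κ] {g : V →ₗ[ℝ] V →ₗ[ℝ] ℝ} {e : κ → V}
    (hu : IsParsevalFrame J g e) :
    ∃ Φ : V ≃L[ℝ] (V →L[ℝ] ℝ), (Φ : V →L[ℝ] V →L[ℝ] ℝ) = flatMap g := by
  have hinj : Function.Injective (flatMap g) := by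
    refine (injective_iff_map_eq_zero _).mpr fun x hx => ?_
    rw [← hu.expand x]
    exact Finset.sum_eq_zero fun a _ => by
      have := congrArg (fun f => f (e a)) hx
      simp only [flatMap_apply, _root_.zero_apply] at this
      rw [this, zero_smul]
  have hdim : Module.finrank ℝ V = Module.finrank ℝ (V →L[ℝ] ℝ) := by
    rw [← (LinearMap.toContinuousLinearMap (𝕜 := ℝ) (E := V) (F' := ℝ)).finrank_eq]
    exact (Subspace.dual_finrank_eq (K := ℝ) (V := V)).symm
  let Φ := LinearEquiv.ofInjectiveOfFinrankEq (flatMap g).toLinearMap hinj hdim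
  exact ⟨Φ.toContinuousLinearEquiv, by ext; rfl⟩

/-- A contraction over a Parseval frame in terms of the inverse of the metric. -/
theorem IsParsevalFrame.contraction_eq_inverse {κ : Type*} [Fintype κ] {g : V →ₗ[ℝ] V →ₗ[ℝ] ℝ}
    {e : κ → V} (hu : IsParsevalFrame J g e) (f : Module.Basis ι ℝ V) (β : V →ₗ[ℝ] V →ₗ[ℝ] ℝ) :
    ∑ a, β (e a) (e a) = ∑ k, β (ContinuousLinearMap.inverse (flatMap g)
      (f.coord k).toContinuousLinearMap) (f k) := by
  obtain ⟨Φ, hΦ⟩ := hu.exists_equiv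
  have h : ∀ k, ContinuousLinearMap.inverse (flatMap g) (f.coord k).toContinuousLinearMap
      = ∑ a, f.coord k (e a) • e a := by
    intro k
    rw [← hΦ, ContinuousLinearMap.inverse_equiv]
    change Φ.symm _ = _
    rw [ContinuousLinearEquiv.symm_apply_eq]
    ext y
    have h1 : Φ (∑ a, f.coord k (e a) • e a) y = g (∑ a, f.coord k (e a) • e a) y :=
      congrArg (fun L : V →L[ℝ] V →L[ℝ] ℝ => L _ y) hΦ
    rw [h1]
    have h2 := hu.sum_mul_apply (f.coord k) y
    simp only [map_sum, map_smul, LinearMap.sum_apply, LinearMap.smul_apply, smul_eq_mul]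
    rw [LinearMap.coe_toContinuousLinearMap', ← h2]
    exact Finset.sum_congr rfl fun a _ => by rw [hu.symm y, mul_comm]
  simp_rw [h, map_sum, LinearMap.sum_apply, map_smul, LinearMap.smul_apply]
  rw [Finset.sum_comm]
  refine Finset.sum_congr rfl fun a _ => ?_
  have h3 := congrArg (β (e a)) (f.sum_repr (e a))
  rw [map_sum] at h3
  rw [← h3]
  exact Finset.sum_congr rfl fun k _ => by rw [map_smul, Module.Basis.coord_apply]

/-- `velocityIntegrand` as a bilinear form in its last two arguments. -/
noncomputable def velocityBilin (br : V →ₗ[ℝ] V →ₗ[ℝ] V) (J : V →ₗ[ℝ] V)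
    (g : V →ₗ[ℝ] V →ₗ[ℝ] ℝ) (u v : V) : V →ₗ[ℝ] V →ₗ[ℝ] ℝ :=
  LinearMap.mk₂ ℝ (velocityIntegrand br J g u v)
    (by
      intros
      simp only [velocityIntegrand, bismutCoeff, bismutTorsionDeriv, bismutTorsion,
        map_add, LinearMap.add_apply]
      ring)
    (by
      intros
      simp only [velocityIntegrand, bismutCoeff, bismutTorsionDeriv, bismutTorsion,
        map_smul, LinearMap.smul_apply, smul_eq_mul]
      ring)
    (by
      intros
      simp only [velocityIntegrand, bismutCoeff, bismutTorsionDeriv, bismutTorsion,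
        map_add, LinearMap.add_apply]
      ring)
    (by
      intros
      simp only [velocityIntegrand, bismutCoeff, bismutTorsionDeriv, bismutTorsion,
        map_smul, LinearMap.smul_apply, smul_eq_mul]
      ring)

section Gram

variable [DecidableEq ι] (f : Module.Basis ι ℝ V)

/-- The bilinear form with a given matrix of components in a basis. -/
noncomputable def gramForm (G : ι → ι → ℝ) : V →ₗ[ℝ] V →ₗ[ℝ] ℝ :=
  Matrix.toBilin f (Matrix.of G)

omit [FiniteDimensional ℝ V] in
theorem gramForm_self (g : V →ₗ[ℝ] V →ₗ[ℝ] ℝ) : gramForm f (fun i j => g (f i) (f j)) = g := by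
  refine Eq.trans (congrArg (Matrix.toBilin f) ?_) (Matrix.toBilin_toMatrix f g)
  ext i j
  exact (LinearMap.BilinForm.toMatrix_apply f g i j).symm

theorem contDiffAt_gramForm {X : Type*} [NormedAddCommGroup X] [NormedSpace ℝ X] {x y : X → V}
    {G : X → ι → ι → ℝ} {q : X} (hG : ContDiffAt ℝ 1 G q)
    (hx : ContDiffAt ℝ 1 x q) (hy : ContDiffAt ℝ 1 y q) :
    ContDiffAt ℝ 1 (fun p => gramForm f (G p) (x p) (y p)) q := by
  simp only [gramForm, Matrix.toBilin_apply, Matrix.of_apply]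
  refine ContDiffAt.sum fun i _ => ContDiffAt.sum fun j _ => ?_
  refine ContDiffAt.mul (ContDiffAt.mul ?_ ?_) ?_
  · exact contDiffAt_linear (f.coord i) hx
  · exact contDiffAt_pi.mp (contDiffAt_pi.mp hG i) j
  · exact contDiffAt_linear (f.coord j) hy

/-- The velocity of the flow as a function of the matrix of the metric in a fixed basis. -/
noncomputable def gramField (br : V →ₗ[ℝ] V →ₗ[ℝ] V) (J : V →ₗ[ℝ] V) (G : ι → ι → ℝ) (i j : ι) : ℝ :=
  ∑ k, velocityIntegrand br J (gramForm f G) (f i) (f j)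
    (ContinuousLinearMap.inverse (flatMap (gramForm f G)) (f.coord k).toContinuousLinearMap) (f k)

/-- At the Gram matrix of a Hermitian metric, `gramField` is the velocity of the flow. -/
theorem IsParsevalFrame.gramField_eq {κ : Type*} [Fintype κ] {g : V →ₗ[ℝ] V →ₗ[ℝ] ℝ} {e : κ → V}
    (hu : IsParsevalFrame J g e) (i j : ι) :
    gramField f br J (fun i j => g (f i) (f j)) i j = velocityForm br J g e (f i) (f j) := by
  rw [velocityForm_eq, gramField, gramForm_self]
  exact (hu.contraction_eq_inverse f (velocityBilin br J g (f i) (f j))).symm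

theorem contDiff_flatMap_gramForm : ContDiff ℝ 1 fun G => flatMap (gramForm f G) := by
  rw [contDiff_clm_apply_iff]
  intro x
  rw [contDiff_clm_apply_iff]
  intro y
  exact contDiff_iff_contDiffAt.mpr fun G =>
    contDiffAt_gramForm f contDiffAt_id contDiffAt_const contDiffAt_const

/-- The velocity depends smoothly on the metric: the metric enters polynomially and through its
inverse. -/
theorem IsParsevalFrame.contDiffAt_gramField {κ : Type*} [Fintype κ] {g : V →ₗ[ℝ] V →ₗ[ℝ] ℝ}
    {e : κ → V} (hu : IsParsevalFrame J g e) :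
    ContDiffAt ℝ 1 (gramField f br J) (fun i j => g (f i) (f j)) := by
  rw [contDiffAt_pi]
  intro i
  rw [contDiffAt_pi]
  intro j
  refine ContDiffAt.sum fun k _ => ?_
  set q : ι → ι → ℝ := fun i j => g (f i) (f j) with hq
  have hg : ∀ {x y : (ι → ι → ℝ) → V}, ContDiffAt ℝ 1 x q → ContDiffAt ℝ 1 y q →
      ContDiffAt ℝ 1 (fun p => gramForm f p (x p) (y p)) q := fun hx hy =>
    contDiffAt_gramForm f contDiffAt_id hx hy
  have hs : ContDiffAt ℝ 1 (fun G => ContinuousLinearMap.inverse (flatMap (gramForm f G))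
      (f.coord k).toContinuousLinearMap) q := by
    obtain ⟨Φ, hΦ⟩ := hu.exists_equiv
    have h1 : ContDiffAt ℝ 1 (ContinuousLinearMap.inverse : (V →L[ℝ] V →L[ℝ] ℝ) → _)
        (flatMap (gramForm f q)) := by
      rw [hq, gramForm_self, ← hΦ]
      exact contDiffAt_map_inverse Φ
    exact (h1.comp q (contDiff_flatMap_gramForm f).contDiffAt).clm_apply contDiffAt_const
  have hJ : ∀ {x : (ι → ι → ℝ) → V}, ContDiffAt ℝ 1 x q → ContDiffAt ℝ 1 (fun p => J (x p)) q :=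
    fun hx => contDiffAt_linear J hx
  have hb : ∀ {x y : (ι → ι → ℝ) → V}, ContDiffAt ℝ 1 x q → ContDiffAt ℝ 1 y q →
      ContDiffAt ℝ 1 (fun p => br (x p) (y p)) q := fun hx hy => contDiffAt_bilinear br hx hy
  have c : ∀ v : V, ContDiffAt ℝ 1 (fun _ : ι → ι → ℝ => v) q := fun v => contDiffAt_const
  have hH : ∀ {w x y z : (ι → ι → ℝ) → V}, ContDiffAt ℝ 1 w q → ContDiffAt ℝ 1 x q →
      ContDiffAt ℝ 1 y q → ContDiffAt ℝ 1 z q → ContDiffAt ℝ 1 (fun p =>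
        bismutTorsionDeriv br J (gramForm f p) (w p) (x p) (y p) (z p)) q := by
    intro w x y z hw hx hy hz
    have H : ∀ {x y z : (ι → ι → ℝ) → V}, ContDiffAt ℝ 1 x q → ContDiffAt ℝ 1 y q →
        ContDiffAt ℝ 1 z q → ContDiffAt ℝ 1 (fun p =>
          bismutTorsion br J (gramForm f p) (x p) (y p) (z p)) q := fun hx hy hz =>
      contDiffAt_bismutTorsion hg hx hy hz
    exact (((((H (hb hw hx) hy hz).neg.add (H (hb hw hy) hx hz)).sub (H (hb hw hz) hx hy)).sub
      (H (hb hx hy) hw hz)).add (H (hb hx hz) hw hy)).sub (H (hb hy hz) hw hx)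
  refine (contDiffAt_const.mul ((contDiffAt_const.mul ?_).sub (contDiffAt_const.mul ?_))).add
    (contDiffAt_const.mul (ContDiffAt.sub ?_ ?_))
  · exact contDiffAt_bismutCoeff hg (c _) hs (hJ (c _))
  · exact contDiffAt_bismutCoeff hg (c _) hs (hJ (c _))
  · exact hH (c _) (c _) hs (hJ (c _))
  · exact hH (c _) (c _) hs (hJ (c _))

end Gram

omit [Fintype ι] in
/-- An invariant Hermitian metric moving with velocity `-S + Q` is determined by its initial
value. -/
theorem velocityForm_flow_unique {κ : Type*} [Fintype κ] {g h : ℝ → V →ₗ[ℝ] V →ₗ[ℝ] ℝ} {T : ℝ}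
    (h0 : g 0 = h 0)
    (hg : ∀ t ∈ Set.Ico 0 T, ∃ e : κ → V, IsParsevalFrame J (g t) e ∧ ∀ u v,
      HasDerivWithinAt (fun s => g s u v) (velocityForm br J (g t) e u v) (Set.Ico 0 T) t)
    (hh : ∀ t ∈ Set.Ico 0 T, ∃ e : κ → V, IsParsevalFrame J (h t) e ∧ ∀ u v,
      HasDerivWithinAt (fun s => h s u v) (velocityForm br J (h t) e u v) (Set.Ico 0 T) t) :
    ∀ t ∈ Set.Ico 0 T, g t = h t := by
  classical
  let f := Module.finBasis ℝ V
  have key : ∀ {k : ℝ → V →ₗ[ℝ] V →ₗ[ℝ] ℝ}, (∀ t ∈ Set.Ico 0 T, ∃ e : κ → V,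
      IsParsevalFrame J (k t) e ∧ ∀ u v, HasDerivWithinAt (fun s => k s u v)
        (velocityForm br J (k t) e u v) (Set.Ico 0 T) t) → ∀ t ∈ Set.Ico 0 T,
      HasDerivWithinAt (fun s i j => k s (f i) (f j))
        (gramField f br J fun i j => k t (f i) (f j)) (Set.Ico 0 T) t := by
    intro k hk t ht
    obtain ⟨e, hu, hd⟩ := hk t ht
    rw [hasDerivWithinAt_pi]
    intro i
    rw [hasDerivWithinAt_pi]
    intro j
    rw [hu.gramField_eq f]
    exact hd _ _
  have := ode_unique_of_contDiffAt (f := gramField f br J) (a := T)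
    (fun t ht => by
      obtain ⟨e, hu, -⟩ := hg t ht
      exact hu.contDiffAt_gramField f) (by simp only [h0]) (key hg) (key hh)
  intro t ht
  rw [← gramForm_self f (g t), ← gramForm_self f (h t)]
  exact congrArg _ (this ht)

end MetricUniqueness

/-! ### Framings of a manifold -/

section Framing

variable {E : Type*} [NormedAddCommGroup E] [NormedSpace ℝ E]
variable {M : Type*} [TopologicalSpace M] [ChartedSpace E M] [IsManifold 𝓘(ℝ, E) ∞ M]

variable (E M) in
/-- A parallelization of `M` by smooth vector fields `frame · v`, for `v` in the model space, whose
Lie brackets have constant coefficients. -/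
structure Framing where
  /-- The value of the parallelization at a point. -/
  frame (x : M) : E ≃L[ℝ] TangentSpace 𝓘(ℝ, E) x
  contMDiff (v : E) : CMDiff ∞ (T% fun x : M => frame x v)
  /-- The structure constants of the parallelization. -/
  bracket : E →ₗ[ℝ] E →ₗ[ℝ] E
  mlieBracket_eq (u v : E) (x : M) :
    mlieBracket 𝓘(ℝ, E) (fun y => frame y u) (fun y => frame y v) x = frame x (bracket u v)

omit [IsManifold 𝓘(ℝ, E) ∞ M] in
/-- Smoothness of a family of operators can be tested on vectors. -/
theorem contMDiffAt_clm_iff [FiniteDimensional ℝ E] {F : Type*} [NormedAddCommGroup F]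
    [NormedSpace ℝ F] {n : WithTop ℕ∞} {f : M → E →L[ℝ] F} {x : M}
    (h : ∀ v, CMDiffAt n (fun y => f y v) x) : CMDiffAt n f x := by
  let b := Module.finBasis ℝ E
  have hf : f = fun y => ∑ i, (b.coord i).toContinuousLinearMap.smulRight (f y (b i)) := by
    ext y v
    conv_lhs => rw [← b.sum_repr v, map_sum]
    simp
  rw [hf]
  refine ContMDiffAt.sum fun i _ => ?_
  exact ((ContinuousLinearMap.smulRightL ℝ E F
    (b.coord i).toContinuousLinearMap).contMDiff.contMDiffAt).comp x (h (b i))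

variable [FiniteDimensional ℝ E] (Φ : Framing E M)

namespace Framing

/-- The frame in the trivialization of the tangent bundle around `x`. -/
noncomputable def inTriv (x y : M) : E →L[ℝ] E :=
  ((trivializationAt E (TangentSpace 𝓘(ℝ, E)) x).continuousLinearMapAt ℝ y).comp
    (Φ.frame y : E →L[ℝ] TangentSpace 𝓘(ℝ, E) y)

omit [FiniteDimensional ℝ E] in
theorem eventually_mem_baseSet (x : M) :
    ∀ᶠ y in nhds x, y ∈ (trivializationAt E (TangentSpace 𝓘(ℝ, E)) x).baseSet :=
  (trivializationAt E (TangentSpace 𝓘(ℝ, E)) x).open_baseSet.mem_nhds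
    (FiberBundle.mem_baseSet_trivializationAt' x)

omit [FiniteDimensional ℝ E] in
theorem inTriv_apply {x y : M}
    (hy : y ∈ (trivializationAt E (TangentSpace 𝓘(ℝ, E)) x).baseSet) (v : E) :
    Φ.inTriv x y v = (trivializationAt E (TangentSpace 𝓘(ℝ, E)) x ⟨y, Φ.frame y v⟩).2 := by
  rw [inTriv, ContinuousLinearMap.comp_apply, Bundle.Trivialization.continuousLinearMapAt_apply,
    Bundle.Trivialization.linearMapAt_apply, if_pos hy]
  rfl

theorem contMDiffAt_inTriv (x : M) : CMDiffAt ∞ (Φ.inTriv x) x := by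
  refine contMDiffAt_clm_iff fun v => ?_
  have h := (Bundle.contMDiffAt_section x).mp (Φ.contMDiff v x)
  refine h.congr_of_eventuallyEq ?_
  filter_upwards [eventually_mem_baseSet (E := E) x] with y hy
  exact Φ.inTriv_apply hy v

/-- The frame in a trivialization, as an isomorphism. -/
noncomputable def inTrivEquiv {x y : M}
    (hy : y ∈ (trivializationAt E (TangentSpace 𝓘(ℝ, E)) x).baseSet) : E ≃L[ℝ] E :=
  (Φ.frame y).trans ((trivializationAt E (TangentSpace 𝓘(ℝ, E)) x).continuousLinearEquivAt ℝ y hy)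

omit [FiniteDimensional ℝ E] in
theorem coe_inTrivEquiv {x y : M}
    (hy : y ∈ (trivializationAt E (TangentSpace 𝓘(ℝ, E)) x).baseSet) :
    (Φ.inTrivEquiv hy : E →L[ℝ] E) = Φ.inTriv x y := by
  ext v
  rw [Φ.inTriv_apply hy]
  rfl

omit [FiniteDimensional ℝ E] in
theorem inverse_inTriv_apply {x y : M}
    (hy : y ∈ (trivializationAt E (TangentSpace 𝓘(ℝ, E)) x).baseSet)
    (w : TangentSpace 𝓘(ℝ, E) y) :
    ContinuousLinearMap.inverse (Φ.inTriv x y)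
      (trivializationAt E (TangentSpace 𝓘(ℝ, E)) x ⟨y, w⟩).2 = (Φ.frame y).symm w := by
  rw [← Φ.coe_inTrivEquiv hy, ContinuousLinearMap.inverse_equiv]
  change (Φ.inTrivEquiv hy).symm _ = _
  rw [ContinuousLinearEquiv.symm_apply_eq]
  change _ = (trivializationAt E (TangentSpace 𝓘(ℝ, E)) x ⟨y, Φ.frame y ((Φ.frame y).symm w)⟩).2
  rw [ContinuousLinearEquiv.apply_symm_apply]

theorem contMDiffAt_inverse_inTriv (x : M) :
    CMDiffAt ∞ (fun y => ContinuousLinearMap.inverse (Φ.inTriv x y)) x := by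
  have hx := FiberBundle.mem_baseSet_trivializationAt' (F := E) (E := TangentSpace 𝓘(ℝ, E)) x
  have h : ContDiffAt ℝ ∞ (ContinuousLinearMap.inverse : (E →L[ℝ] E) → (E →L[ℝ] E))
      (Φ.inTriv x x) := by
    rw [← Φ.coe_inTrivEquiv hx]
    exact contDiffAt_map_inverse _
  exact h.contMDiffAt.comp x (Φ.contMDiffAt_inTriv x)

theorem contMDiffAt_iff {n : WithTop ℕ∞} (hn : n ≤ ∞) {σ : VField E M} {x : M} :
    CMDiffAt n (T% σ) x ↔ CMDiffAt n (fun y => (Φ.frame y).symm (σ y)) x := by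
  rw [Bundle.contMDiffAt_section]
  constructor <;> intro h
  · refine (((Φ.contMDiffAt_inverse_inTriv x).of_le hn).clm_apply h).congr_of_eventuallyEq ?_
    filter_upwards [eventually_mem_baseSet (E := E) x] with y hy
    exact (Φ.inverse_inTriv_apply hy _).symm
  · refine (((Φ.contMDiffAt_inTriv x).of_le hn).clm_apply h).congr_of_eventuallyEq ?_
    filter_upwards [eventually_mem_baseSet (E := E) x] with y hy
    rw [Φ.inTriv_apply hy, ContinuousLinearEquiv.apply_symm_apply]

theorem mdifferentiableAt_iff {σ : VField E M} {x : M} :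
    MDiffAt (T% σ) x ↔ MDiffAt (fun y => (Φ.frame y).symm (σ y)) x := by
  rw [mdifferentiableAt_section]
  constructor <;> intro h
  · refine (((Φ.contMDiffAt_inverse_inTriv x).mdifferentiableAt (by simp)).clm_apply
      h).congr_of_eventuallyEq ?_
    filter_upwards [eventually_mem_baseSet (E := E) x] with y hy
    exact (Φ.inverse_inTriv_apply hy _).symm
  · refine (((Φ.contMDiffAt_inTriv x).mdifferentiableAt (by simp)).clm_apply
      h).congr_of_eventuallyEq ?_
    filter_upwards [eventually_mem_baseSet (E := E) x] with y hy
    rw [Φ.inTriv_apply hy, ContinuousLinearEquiv.apply_symm_apply]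

/-- A section of a bundle of homomorphisms on the tangent bundle is smooth if its values on the
frame are. -/
theorem contMDiffAt_hom {F : Type*} [NormedAddCommGroup F] [NormedSpace ℝ F] {W : M → Type*}
    [TopologicalSpace (TotalSpace F W)] [∀ x, AddCommGroup (W x)] [∀ x, Module ℝ (W x)]
    [∀ x, TopologicalSpace (W x)] [∀ x, IsTopologicalAddGroup (W x)] [∀ x, ContinuousSMul ℝ (W x)]
    [FiberBundle F W] [VectorBundle ℝ F W]
    {φ : (x : M) → TangentSpace 𝓘(ℝ, E) x →L[ℝ] W x} {x : M}
    (h : ∀ v, ContMDiffAt 𝓘(ℝ, E) (𝓘(ℝ, E).prod 𝓘(ℝ, F)) ∞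
      (fun y => TotalSpace.mk' F y (φ y (Φ.frame y v))) x) :
    ContMDiffAt 𝓘(ℝ, E) (𝓘(ℝ, E).prod 𝓘(ℝ, E →L[ℝ] F)) ∞
      (fun y => TotalSpace.mk' (E →L[ℝ] F) (E := fun y => TangentSpace 𝓘(ℝ, E) y →L[ℝ] W y)
        y (φ y)) x := by
  rw [contMDiffAt_hom_bundle]
  refine ⟨contMDiffAt_id, ?_⟩
  let τ := trivializationAt F W x
  have h1 : ContMDiffAt 𝓘(ℝ, E) 𝓘(ℝ, E →L[ℝ] F) ∞ (fun y =>
      (τ.continuousLinearMapAt ℝ y).comp ((φ y).comp (Φ.frame y : E →L[ℝ] _))) x := by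
    refine contMDiffAt_clm_iff fun v => ?_
    refine ((Bundle.contMDiffAt_section x).mp (h v)).congr_of_eventuallyEq ?_
    filter_upwards [τ.open_baseSet.mem_nhds (FiberBundle.mem_baseSet_trivializationAt' x)] with y hy
    simp [Bundle.Trivialization.continuousLinearMapAt_apply,
      Bundle.Trivialization.linearMapAt_apply, hy, τ]
  refine (h1.clm_comp (Φ.contMDiffAt_inverse_inTriv x)).congr_of_eventuallyEq ?_
  filter_upwards [eventually_mem_baseSet (E := E) x] with y hy
  ext v
  change (τ.continuousLinearMapAt ℝ y) (φ y _) = (τ.continuousLinearMapAt ℝ y) (φ y _)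
  congr 2
  have := Φ.inverse_inTriv_apply hy
    ((trivializationAt E (TangentSpace 𝓘(ℝ, E)) x).symmL ℝ y v)
  have h3 : (trivializationAt E (TangentSpace 𝓘(ℝ, E)) x
      ⟨y, (trivializationAt E (TangentSpace 𝓘(ℝ, E)) x).symmL ℝ y v⟩).2 = v := by
    rw [Bundle.Trivialization.symmL_apply]
    exacts [congrArg Prod.snd (Bundle.Trivialization.apply_mk_symm _ hy v), hy]
  rw [h3] at this
  exact ((Φ.frame y).apply_symm_apply _).symm.trans (congrArg (Φ.frame y) this.symm)

end Framing
end Framing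

/-! ### Derivations and Lie brackets -/

section Calculus

variable {E : Type*} [NormedAddCommGroup E] [NormedSpace ℝ E]
variable {M : Type*} [TopologicalSpace M] [ChartedSpace E M]
variable {F F' : Type*} [NormedAddCommGroup F] [NormedSpace ℝ F] [NormedAddCommGroup F'] [NormedSpace ℝ F']

theorem mvfderiv_clm_comp (L : F →L[ℝ] F') {f : M → F} {x : M} (hf : MDiffAt f x)
    (u : TangentSpace 𝓘(ℝ, E) x) :
    mvfderiv 𝓘(ℝ, E) (fun y => L (f y)) x u = L (mvfderiv 𝓘(ℝ, E) f x u) := by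
  have h := (L.hasMFDerivAt (x := f x)).comp x hf.hasMFDerivAt
  exact congrArg (fun T => T u) h.mfderiv

theorem mvfderiv_bilinear (B : F →L[ℝ] F →L[ℝ] F') {f g : M → F} {x : M} (hf : MDiffAt f x)
    (hg : MDiffAt g x) (u : TangentSpace 𝓘(ℝ, E) x) :
    mvfderiv 𝓘(ℝ, E) (fun y => B (f y) (g y)) x u
      = B (mvfderiv 𝓘(ℝ, E) f x u) (g x) + B (f x) (mvfderiv 𝓘(ℝ, E) g x u) := by
  have h1 : HasFDerivAt (fun p : F × F => B p.1 p.2) _ (f x, g x) :=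
    B.isBoundedBilinearMap.hasFDerivAt (f x, g x)
  have h2 : HasMFDerivAt 𝓘(ℝ, E) 𝓘(ℝ, F × F) (fun y => (f y, g y)) x _ :=
    ⟨hf.hasMFDerivAt.1.prodMk hg.hasMFDerivAt.1, hf.hasMFDerivAt.2.prodMk hg.hasMFDerivAt.2⟩
  have h := HasMFDerivAt.comp x (g := fun p : F × F => B p.1 p.2) h1.hasMFDerivAt h2
  refine (congrArg (fun T => T u) h.mfderiv).trans ?_
  exact add_comm _ _

theorem mvfderiv_congr {f g : M → F} {x : M} (h : f =ᶠ[nhds x] g) (u : TangentSpace 𝓘(ℝ, E) x) :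
    mvfderiv 𝓘(ℝ, E) f x u = mvfderiv 𝓘(ℝ, E) g x u :=
  congrArg (fun T : TangentSpace 𝓘(ℝ, E) x →L[ℝ] F => T u) h.mfderiv_eq

theorem minSmoothness_le_infty (k : ℕ) : minSmoothness ℝ k ≤ (∞ : WithTop ℕ∞) := by
  rw [minSmoothness_of_isRCLikeNormedField]
  exact_mod_cast le_top

variable [IsManifold 𝓘(ℝ, E) ∞ M]

theorem isManifold_minSmoothness (k : ℕ) : IsManifold 𝓘(ℝ, E) (minSmoothness ℝ k) M :=
  IsManifold.of_le (minSmoothness_le_infty k)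

/-- The derivative of a smooth function along a smooth vector field is smooth. -/
theorem contMDiffAt_mvfderiv_apply {f : M → F} {V : VField E M} {x : M} (hf : CMDiffAt ∞ f x)
    (hV : CMDiffAt ∞ (T% V) x) : CMDiffAt ∞ (fun y => mvfderiv 𝓘(ℝ, E) f y (V y)) x := by
  have h1 := ContMDiffAt.mfderiv_const (m := ∞) hf (by simp)
  have h2 := ContMDiffAt.clm_apply_of_inCoordinates (b₁ := id) (b₂ := f) (v := V) h1 hV hf
  have h3 := (contMDiffAt_totalSpace.mp h2).2
  refine h3.congr_of_eventuallyEq (Filter.Eventually.of_forall fun y => ?_)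
  simp [mvfderiv]
  rfl

variable [FiniteDimensional ℝ E]

theorem contMDiffAt_mlieBracket {U V : VField E M} {x : M} (hU : CMDiffAt ∞ (T% U) x)
    (hV : CMDiffAt ∞ (T% V) x) : CMDiffAt ∞ (T% (mlieBracket 𝓘(ℝ, E) U V)) x := by
  have := FiniteDimensional.complete ℝ E
  have : IsManifold 𝓘(ℝ, E) ((⊤ : ℕ∞) + 1) M := by
    simpa using inferInstanceAs (IsManifold 𝓘(ℝ, E) ∞ M)
  have := isManifold_minSmoothness (E := E) (M := M) 2
  have := isManifold_minSmoothness (E := E) (M := M) 3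
  exact ContMDiffAt.mlieBracket_vectorField (m := ⊤) (n := ⊤) hU hV (by simp)

theorem mlieBracket_smul_eventuallyEq {f : M → ℝ} {V X : VField E M} {x : M}
    (hf : CMDiffAt ∞ f x) (hX : CMDiffAt ∞ (T% X) x) :
    mlieBracket 𝓘(ℝ, E) V (f • X) =ᶠ[nhds x]
      (fun y => mvfderiv 𝓘(ℝ, E) f y (V y)) • X + f • mlieBracket 𝓘(ℝ, E) V X := by
  have := FiniteDimensional.complete ℝ E
  have h1 : (1 : WithTop ℕ∞) ≤ ∞ := by exact_mod_cast le_top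
  filter_upwards [(contMDiffAt_iff_contMDiffAt_nhds (by simp)).mp (hf.of_le h1),
    (contMDiffAt_iff_contMDiffAt_nhds (by simp)).mp (hX.of_le h1)] with y hfy hXy
  exact mlieBracket_smul_right (hfy.mdifferentiableAt one_ne_zero)
    (hXy.mdifferentiableAt one_ne_zero)

theorem mlieBracket_mlieBracket_smul {f : M → ℝ} {U V X : VField E M} {x : M}
    (hf : CMDiffAt ∞ f x) (hV : CMDiffAt ∞ (T% V) x) (hX : CMDiffAt ∞ (T% X) x) :
    mlieBracket 𝓘(ℝ, E) U (mlieBracket 𝓘(ℝ, E) V (f • X)) x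
      = mvfderiv 𝓘(ℝ, E) (fun y => mvfderiv 𝓘(ℝ, E) f y (V y)) x (U x) • X x
        + mvfderiv 𝓘(ℝ, E) f x (V x) • mlieBracket 𝓘(ℝ, E) U X x
        + (mvfderiv 𝓘(ℝ, E) f x (U x) • mlieBracket 𝓘(ℝ, E) V X x
        + f x • mlieBracket 𝓘(ℝ, E) U (mlieBracket 𝓘(ℝ, E) V X) x) := by
  have := FiniteDimensional.complete ℝ E
  have hVX := contMDiffAt_mlieBracket hV hX
  have hL := contMDiffAt_mvfderiv_apply hf hV
  rw [Filter.EventuallyEq.mlieBracket_vectorField_eq (Filter.EventuallyEq.refl _ U)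
    (mlieBracket_smul_eventuallyEq hf hX), mlieBracket_add_right, mlieBracket_smul_right,
    mlieBracket_smul_right]
  · exact hf.mdifferentiableAt (by simp)
  · exact hVX.mdifferentiableAt (by simp)
  · exact hL.mdifferentiableAt (by simp)
  · exact hX.mdifferentiableAt (by simp)
  · exact (hL.smul_section hX).mdifferentiableAt (by simp)
  · exact (hf.smul_section hVX).mdifferentiableAt (by simp)

/-- On smooth functions, the Lie bracket is the commutator of derivations. This is read off from
the Jacobi identity for `U`, `V` and `f • X`. -/
theorem mvfderiv_mlieBracket {f : M → ℝ} {U V X : VField E M} {x : M} (hX : X x ≠ 0)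
    (hf : CMDiffAt ∞ f x) (hU : CMDiffAt ∞ (T% U) x) (hV : CMDiffAt ∞ (T% V) x)
    (hXs : CMDiffAt ∞ (T% X) x) :
    mvfderiv 𝓘(ℝ, E) f x (mlieBracket 𝓘(ℝ, E) U V x)
      = mvfderiv 𝓘(ℝ, E) (fun y => mvfderiv 𝓘(ℝ, E) f y (V y)) x (U x)
        - mvfderiv 𝓘(ℝ, E) (fun y => mvfderiv 𝓘(ℝ, E) f y (U y)) x (V x) := by
  have := FiniteDimensional.complete ℝ E
  have := isManifold_minSmoothness (E := E) (M := M) 3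
  have h2 : minSmoothness ℝ 2 ≤ (∞ : WithTop ℕ∞) := minSmoothness_le_infty 2
  have key := leibniz_identity_mlieBracket_apply (W := f • X) (hU.of_le h2) (hV.of_le h2)
    ((hf.smul_section hXs).of_le h2)
  have key' := leibniz_identity_mlieBracket_apply (hU.of_le h2) (hV.of_le h2) (hXs.of_le h2)
  rw [mlieBracket_mlieBracket_smul hf hV hXs, mlieBracket_mlieBracket_smul hf hU hXs,
    mlieBracket_smul_right (hf.mdifferentiableAt (by simp)) (hXs.mdifferentiableAt (by simp)),
    key'] at key
  refine smul_left_injective ℝ hX ?_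
  simp only [smul_add, sub_smul] at key ⊢
  linear_combination (norm := module) (-1 : ℝ) • key

end Calculus

/-! ### Connections with constant coefficients in a framing -/

section Connection

variable {E : Type*} [NormedAddCommGroup E] [NormedSpace ℝ E] [FiniteDimensional ℝ E]
variable {M : Type*} [TopologicalSpace M] [ChartedSpace E M] [IsManifold 𝓘(ℝ, E) ∞ M]

namespace Framing

variable (Φ : Framing E M)

/-- The components of a vector field in the frame. -/
noncomputable def coord (σ : VField E M) (x : M) : E := (Φ.frame x).symm (σ x)

omit [FiniteDimensional ℝ E] in
@[simp]
theorem frame_coord (σ : VField E M) (x : M) : Φ.frame x (Φ.coord σ x) = σ x :=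
  (Φ.frame x).apply_symm_apply _

omit [FiniteDimensional ℝ E] in
@[simp]
theorem coord_frame (v : E) : Φ.coord (fun x => Φ.frame x v) = fun _ => v :=
  funext fun x => (Φ.frame x).symm_apply_apply v

theorem mdifferentiableAt_coord {σ : VField E M} {x : M} (h : MDiffAt (T% σ) x) :
    MDiffAt (Φ.coord σ) x := Φ.mdifferentiableAt_iff.mp h

theorem contMDiffAt_coord {σ : VField E M} {x : M} (h : CMDiffAt ∞ (T% σ) x) :
    CMDiffAt ∞ (Φ.coord σ) x := (Φ.contMDiffAt_iff le_rfl).mp h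

/-- The bilinear map underlying an algebraic connection form. -/
noncomputable def toCLM₂ {W : Type*} [NormedAddCommGroup W] [NormedSpace ℝ W] (A : E →ₗ[ℝ] E →ₗ[ℝ] W) :
    E →L[ℝ] E →L[ℝ] W :=
  (LinearMap.toContinuousLinearMap.toLinearMap ∘ₗ A).toContinuousLinearMap

/-- The connection whose connection form in the frame is the constant form `A`. -/
noncomputable def connection (A : E →ₗ[ℝ] E →ₗ[ℝ] E) :
    CovariantDerivative 𝓘(ℝ, E) E (fun x : M => TangentSpace 𝓘(ℝ, E) x) where
  toFun σ x := (Φ.frame x : E →L[ℝ] TangentSpace 𝓘(ℝ, E) x).comp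
    (mvfderiv 𝓘(ℝ, E) (Φ.coord σ) x
      + ((toCLM₂ A).flip (Φ.coord σ x)).comp ((Φ.frame x).symm : TangentSpace 𝓘(ℝ, E) x →L[ℝ] E))
  isCovariantDerivativeOnUniv :=
    { add := by
        intro σ σ' x hσ hσ' _
        have h : Φ.coord (σ + σ') = Φ.coord σ + Φ.coord σ' := funext fun y => map_add _ _ _
        rw [h, mvfderiv_add (Φ.mdifferentiableAt_coord hσ) (Φ.mdifferentiableAt_coord hσ')]
        ext u
        simp
        abel
      leibniz := by
        intro σ g x hσ hg _
        have h : Φ.coord (g • σ) = g • Φ.coord σ := funext fun y => map_smul (Φ.frame y).symm (g y) (σ y)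
        rw [h, mvfderiv_smul hg (Φ.mdifferentiableAt_coord hσ)]
        ext u
        simp
        module }

theorem connection_apply (A : E →ₗ[ℝ] E →ₗ[ℝ] E) (σ : VField E M) (x : M)
    (u : TangentSpace 𝓘(ℝ, E) x) :
    Φ.connection A σ x u = Φ.frame x (mvfderiv 𝓘(ℝ, E) (Φ.coord σ) x u
      + A ((Φ.frame x).symm u) (Φ.coord σ x)) := rfl

@[simp]
theorem connection_frame (A : E →ₗ[ℝ] E →ₗ[ℝ] E) (u v : E) (x : M) :
    Φ.connection A (fun y => Φ.frame y v) x (Φ.frame x u) = Φ.frame x (A u v) := by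
  rw [connection_apply, coord_frame, mvfderiv_const]
  simp

omit [FiniteDimensional ℝ E] in
theorem mdifferentiableAt_frame (v : E) (x : M) : MDiffAt (T% fun y => Φ.frame y v) x :=
  (Φ.contMDiff v x).mdifferentiableAt (by simp)

variable {nabla : CovariantDerivative 𝓘(ℝ, E) E (fun x : M => TangentSpace 𝓘(ℝ, E) x)}
  {A : E →ₗ[ℝ] E →ₗ[ℝ] E}

/-- The torsion of a connection with coefficients `A` at `x`. -/
theorem torsion_frame {x : M} (h : ∀ u v, nabla (fun y => Φ.frame y v) x (Φ.frame x u)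
    = Φ.frame x (A u v)) (u v : E) :
    nabla.torsion x (Φ.frame x u) (Φ.frame x v)
      = Φ.frame x (A u v - A v u - Φ.bracket u v) := by
  have := FiniteDimensional.complete ℝ E
  rw [nabla.torsion_apply (X := fun y => Φ.frame y u) (Y := fun y => Φ.frame y v)
    (Φ.mdifferentiableAt_frame u x) (Φ.mdifferentiableAt_frame v x), h, h, Φ.mlieBracket_eq,
    map_sub, map_sub]

/-- The Lie bracket in terms of the frame; this is the torsion of the flat connection for which the
frame is parallel. -/
theorem mlieBracket_apply {U V : VField E M} {x : M} (hU : MDiffAt (T% U) x)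
    (hV : MDiffAt (T% V) x) :
    mlieBracket 𝓘(ℝ, E) U V x = Φ.frame x (mvfderiv 𝓘(ℝ, E) (Φ.coord V) x (U x)
      - mvfderiv 𝓘(ℝ, E) (Φ.coord U) x (V x) + Φ.bracket (Φ.coord U x) (Φ.coord V x)) := by
  have := FiniteDimensional.complete ℝ E
  have h1 := (Φ.connection 0).torsion_apply hU hV
  have h2 := Φ.torsion_frame (nabla := Φ.connection 0) (A := 0) (x := x) (fun u v => by simp)
    (Φ.coord U x) (Φ.coord V x)
  rw [frame_coord, frame_coord, h1] at h2
  simp only [connection_apply, LinearMap.zero_apply, add_zero, sub_zero, zero_sub, map_neg] at h2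
  rw [map_add, map_sub, ← sub_eq_zero]
  rw [← sub_eq_zero] at h2
  linear_combination (norm := module) (-1 : ℝ) • h2

include Φ in
/-- The Lie bracket acts on vector-valued functions as the commutator of derivations. A member of
the framing serves as the nonvanishing field required by `mvfderiv_mlieBracket`. -/
theorem mvfderiv_coord_mlieBracket {f : M → E} {U V : VField E M} {x : M} (hf : CMDiffAt ∞ f x)
    (hU : CMDiffAt ∞ (T% U) x) (hV : CMDiffAt ∞ (T% V) x) :
    mvfderiv 𝓘(ℝ, E) f x (mlieBracket 𝓘(ℝ, E) U V x)
      = mvfderiv 𝓘(ℝ, E) (fun y => mvfderiv 𝓘(ℝ, E) f y (V y)) x (U x)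
        - mvfderiv 𝓘(ℝ, E) (fun y => mvfderiv 𝓘(ℝ, E) f y (U y)) x (V x) := by
  rcases subsingleton_or_nontrivial E with hE | hE
  · exact Subsingleton.elim _ _
  obtain ⟨v, hv⟩ := exists_ne (0 : E)
  have hX : Φ.frame x v ≠ 0 := by simpa using hv
  refine (Module.finBasis ℝ E).ext_elem fun i => ?_
  let ℓ : E →L[ℝ] ℝ := ((Module.finBasis ℝ E).coord i).toContinuousLinearMap
  change ℓ _ = ℓ _
  have hd : ∀ y, MDiffAt f y → ∀ w, mvfderiv 𝓘(ℝ, E) (fun y => ℓ (f y)) y w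
      = ℓ (mvfderiv 𝓘(ℝ, E) f y w) := fun y hy w => mvfderiv_clm_comp ℓ hy w
  have h1 : (1 : WithTop ℕ∞) ≤ ∞ := by exact_mod_cast le_top
  have hd' : ∀ W : VField E M, (fun y => mvfderiv 𝓘(ℝ, E) (fun y => ℓ (f y)) y (W y))
      =ᶠ[nhds x] fun y => ℓ (mvfderiv 𝓘(ℝ, E) f y (W y)) := by
    intro W
    filter_upwards [(contMDiffAt_iff_contMDiffAt_nhds (by simp)).mp (hf.of_le h1)] with y hy
    exact hd y (hy.mdifferentiableAt one_ne_zero) _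
  have key := mvfderiv_mlieBracket (f := fun y => ℓ (f y)) (X := fun y => Φ.frame y v) hX
    (ℓ.contMDiff.contMDiffAt.comp x hf) hU hV (Φ.contMDiff v x)
  rw [hd x (hf.mdifferentiableAt (by simp)), mvfderiv_congr (hd' V), mvfderiv_congr (hd' U),
    mvfderiv_clm_comp ℓ ((contMDiffAt_mvfderiv_apply hf hV).mdifferentiableAt (by simp)),
    mvfderiv_clm_comp ℓ ((contMDiffAt_mvfderiv_apply hf hU).mdifferentiableAt (by simp))] at key
  rw [key, map_sub]

/-- The curvature of a connection which has the constant coefficients `A` in the framing is the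
curvature of the left-invariant connection `A`. -/
theorem curvature_eq (h : ∀ (σ : VField E M) x, MDiffAt (T% σ) x →
    ∀ u, nabla σ x u = Φ.connection A σ x u) (x : M) (u v w : E) :
    curvature nabla x (Φ.frame x u) (Φ.frame x v) (Φ.frame x w)
      = Φ.frame x (lieCurvature Φ.bracket A u v w) := by
  set U : VField E M := FiberBundle.extend E (Φ.frame x u) with hUdef
  set V : VField E M := FiberBundle.extend E (Φ.frame x v) with hVdef
  set W : VField E M := FiberBundle.extend E (Φ.frame x w) with hWdef
  have hU : CMDiffAt ∞ (T% U) x := FiberBundle.contMDiffAt_extend ..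
  have hV : CMDiffAt ∞ (T% V) x := FiberBundle.contMDiffAt_extend ..
  have hW : CMDiffAt ∞ (T% W) x := FiberBundle.contMDiffAt_extend ..
  have hUx : U x = Φ.frame x u := by simp [hUdef]
  have hVx : V x = Φ.frame x v := by simp [hVdef]
  have hWx : W x = Φ.frame x w := by simp [hWdef]
  have cx : ∀ {Z : VField E M} {z : E}, Z x = Φ.frame x z → Φ.coord Z x = z := fun hz => by
    rw [coord, hz, ContinuousLinearEquiv.symm_apply_apply]
  have h1 : (1 : WithTop ℕ∞) ≤ ∞ := by exact_mod_cast le_top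
  -- The components of `∇_Z W` for a vector field `Z` which is smooth at `x`.
  have hF : ∀ Z : VField E M, Φ.coord (fun y => nabla W y (Z y)) =ᶠ[nhds x]
      (fun y => mvfderiv 𝓘(ℝ, E) (Φ.coord W) y (Z y))
        + fun y => toCLM₂ A (Φ.coord Z y) (Φ.coord W y) := by
    intro Z
    filter_upwards [(contMDiffAt_iff_contMDiffAt_nhds (by simp)).mp (hW.of_le h1)] with y hy
    rw [coord, h W y (hy.mdifferentiableAt one_ne_zero), connection_apply,
      ContinuousLinearEquiv.symm_apply_apply]
    rfl
  have cW := Φ.contMDiffAt_coord hW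
  have hd : ∀ Z : VField E M, CMDiffAt ∞ (T% Z) x → ∀ z, nabla (fun y => nabla W y (Z y)) x z
      = Φ.frame x (mvfderiv 𝓘(ℝ, E) (fun y => mvfderiv 𝓘(ℝ, E) (Φ.coord W) y (Z y)) x z
        + (A (mvfderiv 𝓘(ℝ, E) (Φ.coord Z) x z) (Φ.coord W x)
          + A (Φ.coord Z x) (mvfderiv 𝓘(ℝ, E) (Φ.coord W) x z))
        + A ((Φ.frame x).symm z) (mvfderiv 𝓘(ℝ, E) (Φ.coord W) x (Z x)
          + A (Φ.coord Z x) (Φ.coord W x))) := by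
    intro Z hZ z
    have cZ := (Φ.contMDiffAt_coord hZ).mdifferentiableAt (n := ∞) (by simp)
    have m1 := (contMDiffAt_mvfderiv_apply cW hZ).mdifferentiableAt (n := ∞) (by simp)
    have m2 : MDiffAt (fun y => toCLM₂ A (Φ.coord Z y) (Φ.coord W y)) x :=
      ((toCLM₂ A).mdifferentiableAt.comp x cZ).clm_apply (cW.mdifferentiableAt (by simp))
    have hs : MDiffAt (T% fun y => nabla W y (Z y)) x :=
      Φ.mdifferentiableAt_iff.mpr ((m1.add m2).congr_of_eventuallyEq (hF Z))
    rw [h _ x hs, connection_apply, mvfderiv_congr (hF Z), mvfderiv_add m1 m2, (hF Z).eq_of_nhds,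
      _root_.add_apply, mvfderiv_bilinear _ cZ (cW.mdifferentiableAt (by simp))]
    rfl
  change nabla (fun y => nabla W y (V y)) x (Φ.frame x u)
    - nabla (fun y => nabla W y (U y)) x (Φ.frame x v)
    - nabla W x (mlieBracket 𝓘(ℝ, E) U V x) = _
  rw [hd V hV, hd U hU, h W x (hW.mdifferentiableAt (by simp)), connection_apply,
    Φ.mvfderiv_coord_mlieBracket cW hU hV, Φ.mlieBracket_apply (hU.mdifferentiableAt (by simp))
      (hV.mdifferentiableAt (by simp))]
  simp only [cx hUx, cx hVx, cx hWx, hUx, hVx, ContinuousLinearEquiv.symm_apply_apply, ← map_sub]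
  congr 1
  simp only [lieCurvature, map_add, map_sub, LinearMap.add_apply, LinearMap.sub_apply]
  abel

end Framing

end Connection

/-! ### Hermitian structures with constant components in a framing -/

section Components

variable {E : Type*} [NormedAddCommGroup E] [NormedSpace ℝ E] [FiniteDimensional ℝ E]
variable {M : Type*} [TopologicalSpace M] [ChartedSpace E M] [IsManifold 𝓘(ℝ, E) ∞ M]

namespace Framing

variable {Φ : Framing E M} {J : ComplexStructure E M} {J₀ : E →ₗ[ℝ] E} {g : Metric E M}
  {g₀ : E →ₗ[ℝ] E →ₗ[ℝ] ℝ}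

omit [FiniteDimensional ℝ E] in
theorem mlieBracket_frame (Φ : Framing E M) (u v : E) :
    mlieBracket 𝓘(ℝ, E) (fun y => Φ.frame y u) (fun y => Φ.frame y v)
      = fun y => Φ.frame y (Φ.bracket u v) :=
  funext fun x => Φ.mlieBracket_eq u v x

section
variable (hJ : ∀ x v, J x (Φ.frame x v) = Φ.frame x (J₀ v))
include hJ

omit [FiniteDimensional ℝ E] in
theorem apply_frame (u : E) :
    J.apply (fun y => Φ.frame y u) = fun y => Φ.frame y (J₀ u) := funext fun x => hJ x u

/-- The structure constants inherit the Jacobi identity from the Lie bracket of vector fields, and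
the vanishing of the Nijenhuis tensor from `J`. -/
theorem isComplexLie [Nonempty M] : IsComplexLie Φ.bracket J₀ := by
  obtain ⟨x⟩ := ‹Nonempty M›
  have := FiniteDimensional.complete ℝ E
  have := isManifold_minSmoothness (E := E) (M := M) 3
  have hskew : ∀ u v, Φ.bracket u v = -Φ.bracket v u := fun u v => by
    refine (Φ.frame x).injective ?_
    rw [map_neg, ← Φ.mlieBracket_eq, ← Φ.mlieBracket_eq, mlieBracket_swap_apply]
  refine ⟨hskew, fun u v w => ?_, fun u => ?_, fun u v => ?_⟩
  · have h2 : ∀ v, CMDiffAt (minSmoothness ℝ 2) (T% fun y => Φ.frame y v) x := fun v =>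
      (Φ.contMDiff v x).of_le (minSmoothness_le_infty 2)
    have h := leibniz_identity_mlieBracket_apply (h2 u) (h2 v) (h2 w)
    simp only [mlieBracket_frame, ← map_add] at h
    have h := (Φ.frame x).injective h
    rw [hskew (Φ.bracket v w) u, hskew (Φ.bracket w u) v, hskew w u, map_neg, h]
    abel
  · refine (Φ.frame x).injective ?_
    rw [← hJ, ← hJ, J.sq, map_neg]
  · have h := J.nijenhuis x (fun y => Φ.frame y u) (fun y => Φ.frame y v) (Φ.contMDiff u x)
      (Φ.contMDiff v x)
    simp only [hJ, mlieBracket_frame, ← map_add, ← map_sub] at h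
    exact (Φ.frame x).injective (h.trans (map_zero _).symm)

variable (hg : ∀ x u v, g.inner x (Φ.frame x u) (Φ.frame x v) = g₀ u v)
include hg

omit [FiniteDimensional ℝ E] in
theorem fundamentalForm_frame (u v : E) :
    fundamentalForm J g (fun y => Φ.frame y u) (fun y => Φ.frame y v) = fun _ => g₀ (J₀ u) v :=
  funext fun x => by rw [fundamentalForm, hJ, hg]

omit [FiniteDimensional ℝ E] in
theorem dcFundamentalForm_frame (hinv : ∀ u v, g₀ (J₀ u) (J₀ v) = g₀ u v)
    (hskew : ∀ u v, Φ.bracket u v = -Φ.bracket v u) (u v w : E) :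
    dcFundamentalForm J g (fun y => Φ.frame y u) (fun y => Φ.frame y v) (fun y => Φ.frame y w)
      = fun _ => -bismutTorsion Φ.bracket J₀ g₀ u v w := by
  funext x
  simp only [dcFundamentalForm, extDerivTwo, apply_frame hJ, fundamentalForm_frame hJ hg,
    mlieBracket_frame, mvfderiv_const, hinv, _root_.zero_apply, bismutTorsion]
  rw [hskew (J₀ w) (J₀ u), map_neg, LinearMap.neg_apply]
  ring

/-- The SKT condition in terms of the components in the frame. -/
theorem bismutTorsionDeriv_eq_zero [Nonempty M] (hinv : ∀ u v, g₀ (J₀ u) (J₀ v) = g₀ u v)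
    (hS : IsPluriclosed J g) (w u v z : E) :
    bismutTorsionDeriv Φ.bracket J₀ g₀ w u v z = 0 := by
  have hc := isComplexLie hJ
  obtain ⟨x⟩ := ‹Nonempty M›
  have h := hS x _ _ _ _ (Φ.contMDiff w x) (Φ.contMDiff u x) (Φ.contMDiff v x) (Φ.contMDiff z x)
  simp only [extDerivThree, dcFundamentalForm_frame hJ hg hinv hc.skew, mlieBracket_frame,
    mvfderiv_const, _root_.zero_apply] at h
  rw [bismutTorsionDeriv]
  linarith

/-- A Chern connection is the connection with the constant form given by Koszul's formula. -/
theorem isChernConnection_apply {nabla : CovariantDerivative 𝓘(ℝ, E) E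
      (fun x : M => TangentSpace 𝓘(ℝ, E) x)} (hn : IsChernConnection J g nabla)
    {ι : Type*} [Fintype ι] {e : ι → E} (hu : IsParsevalFrame J₀ g₀ e) {A : E →ₗ[ℝ] E →ₗ[ℝ] E}
    (hA : IsChernForm Φ.bracket J₀ g₀ A) (σ : VField E M) (x : M) (hσ : MDiffAt (T% σ) x)
    (u : TangentSpace 𝓘(ℝ, E) x) : nabla σ x u = Φ.connection A σ x u := by
  have : Nonempty M := ⟨x⟩
  have hc := isComplexLie hJ
  have md := fun v => Φ.mdifferentiableAt_frame v x
  -- The connection coefficients `B` of `nabla` at `x` satisfy the conditions that characterize `A`;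
  -- as the difference of two connections is a tensor, `nabla` agrees with `Φ.connection A`.
  let B : E →ₗ[ℝ] E →ₗ[ℝ] E := LinearMap.mk₂ ℝ
    (fun u v => (Φ.frame x).symm (nabla (fun y => Φ.frame y v) x (Φ.frame x u)))
    (by simp) (by simp)
    (fun u v w => by
      have : (fun y => Φ.frame y (v + w)) = (fun y => Φ.frame y v) + fun y => Φ.frame y w :=
        funext fun y => map_add _ _ _
      rw [this, nabla.isCovariantDerivativeOnUniv.add (md v) (md w)]
      simp)
    (fun c u v => by
      have : (fun y => Φ.frame y (c • v)) = c • (fun y => Φ.frame y v) :=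
        funext fun y => map_smul (Φ.frame y) _ _
      rw [this, nabla.isCovariantDerivativeOnUniv.smul_const c (md v)]
      simp)
  have hB : ∀ u v, nabla (fun y => Φ.frame y v) x (Φ.frame x u) = Φ.frame x (B u v) :=
    fun u v => ((Φ.frame x).apply_symm_apply _).symm
  have hBc : IsChernForm Φ.bracket J₀ g₀ B := by
    refine ⟨fun u v w => ?_, fun u v => ?_, fun u v => ?_⟩
    · have h := hn.metric x (fun y => Φ.frame y v) (fun y => Φ.frame y w) (Φ.frame x u) (md v) (md w)
      simp only [hg, mvfderiv_const, _root_.zero_apply, hB] at h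
      exact h.symm
    · have h := hn.complex x (fun y => Φ.frame y v) (Φ.frame x u) (md v)
      rw [apply_frame hJ, hB, hB, hJ] at h
      exact (Φ.frame x).injective h
    · have h := hn.torsion x (Φ.frame x u) (Φ.frame x v)
      rw [hJ, hJ, Φ.torsion_frame hB, Φ.torsion_frame hB, ← map_neg] at h
      exact (Φ.frame x).injective h
  have hAB : ∀ u v, B u v = A u v := fun u v => hu.ext fun w => by
    rw [hBc.eq_chernCoeff hc hu, hA.eq_chernCoeff hc hu]
  have hd := fun {σ : VField E M} (hσ : MDiffAt (T% σ) x) =>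
    IsCovariantDerivativeOn.difference_apply nabla.isCovariantDerivativeOnUniv
    (Φ.connection A).isCovariantDerivativeOnUniv (x := x) (by trivial) hσ
  have h1 : nabla σ x u - Φ.connection A σ x u = 0 := by
    have h2 := congrArg (fun T => T u) (hd hσ)
    have h3 := congrArg (fun T => T u) (hd (md (Φ.coord σ x)))
    rw [Φ.frame_coord] at h3
    have h4 := h2.symm.trans h3
    have h5 := hB ((Φ.frame x).symm u) (Φ.coord σ x)
    have h6 := Φ.connection_frame A ((Φ.frame x).symm u) (Φ.coord σ x) x
    rw [ContinuousLinearEquiv.apply_symm_apply] at h5 h6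
    refine h4.trans ?_
    exact (congrArg₂ (· - ·) h5 h6).trans (by rw [hAB, sub_self])
  exact sub_eq_zero.mp h1

/-- The connection given by Koszul's formula is a Chern connection. -/
theorem isChernConnection_connection {A : E →ₗ[ℝ] E →ₗ[ℝ] E}
    (hA : IsChernForm Φ.bracket J₀ g₀ A) : IsChernConnection J g (Φ.connection A) := by
  have ginner : ∀ x u v, g.inner x u v = g₀ ((Φ.frame x).symm u) ((Φ.frame x).symm v) := by
    intro x u v
    rw [← hg x, ContinuousLinearEquiv.apply_symm_apply, ContinuousLinearEquiv.apply_symm_apply]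
  have Jcoord : ∀ x u, (Φ.frame x).symm (J x u) = J₀ ((Φ.frame x).symm u) := by
    intro x u
    rw [ContinuousLinearEquiv.symm_apply_eq, ← hJ, ContinuousLinearEquiv.apply_symm_apply]
  refine ⟨⟨⟨fun {σ} hσ x _ => ContMDiffAt.contMDiffWithinAt ?_⟩⟩, fun x Y Z u hY hZ => ?_,
    fun x Y u hY => ?_, fun x u v => ?_⟩
  · have hσ' : CMDiffAt ∞ (T% σ) x := (hσ.contMDiffAt Filter.univ_mem).of_le (by simp)
    refine Φ.contMDiffAt_hom fun v => (Φ.contMDiffAt_iff le_rfl).mpr ?_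
    simp only [connection_apply, ContinuousLinearEquiv.symm_apply_apply]
    exact (contMDiffAt_mvfderiv_apply (Φ.contMDiffAt_coord hσ') (Φ.contMDiff v x)).add
      ((toCLM₂ A v).contMDiff.contMDiffAt.comp x (Φ.contMDiffAt_coord hσ'))
  · have h := mvfderiv_bilinear (toCLM₂ g₀) (Φ.mdifferentiableAt_coord hY)
      (Φ.mdifferentiableAt_coord hZ) u
    simp only [ginner]
    refine h.trans ?_
    have hs := hA.skew ((Φ.frame x).symm u) (Φ.coord Y x) (Φ.coord Z x)
    simp only [connection_apply, ContinuousLinearEquiv.symm_apply_apply, map_add,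
      LinearMap.add_apply]
    change g₀ _ (Φ.coord Z x) + g₀ (Φ.coord Y x) _ = (g₀ _ (Φ.coord Z x) + g₀ _ (Φ.coord Z x))
      + (g₀ (Φ.coord Y x) _ + g₀ (Φ.coord Y x) _)
    linarith
  · have hc : Φ.coord (J.apply Y) = fun y => J₀.toContinuousLinearMap (Φ.coord Y y) :=
      funext fun y => Jcoord y (Y y)
    rw [connection_apply, connection_apply, hJ, hc,
      mvfderiv_clm_comp _ (Φ.mdifferentiableAt_coord hY), map_add J₀, ← hA.complex]
    rfl
  · have hB : ∀ u v, Φ.connection A (fun y => Φ.frame y v) x (Φ.frame x u) = Φ.frame x (A u v) :=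
      fun u v => Φ.connection_frame A u v x
    obtain ⟨u, rfl⟩ := (Φ.frame x).surjective u
    obtain ⟨v, rfl⟩ := (Φ.frame x).surjective v
    rw [hJ, hJ, Φ.torsion_frame hB, Φ.torsion_frame hB, ← map_neg, hA.torsion]

end

end Framing

end Components

/-! ### The velocity of the flow in a framing -/

section FlowInFrame

/-- An orthonormal family of full cardinality is a Parseval frame. -/
theorem isParsevalFrame_of_orthonormal {V ι : Type*} [AddCommGroup V] [Module ℝ V]
    [FiniteDimensional ℝ V] [Fintype ι] [DecidableEq ι] {J : V →ₗ[ℝ] V} {g : V →ₗ[ℝ] V →ₗ[ℝ] ℝ}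
    {e : ι → V} (hcard : Fintype.card ι = Module.finrank ℝ V) (symm : ∀ x y, g x y = g y x)
    (inv : ∀ x y, g (J x) (J y) = g x y) (he : ∀ a b, g (e a) (e b) = if a = b then 1 else 0) :
    IsParsevalFrame J g e := by
  refine ⟨symm, inv, fun x => ?_⟩
  have hli : LinearIndependent ℝ e := by
    rw [Fintype.linearIndependent_iff]
    intro c hc a
    have h := congrArg (fun y => g y (e a)) hc
    simpa [he] using h
  have hspan := (hli.span_eq_top_of_card_eq_finrank' hcard).ge (Submodule.mem_top (x := x))
  obtain ⟨c, rfl⟩ := (Submodule.mem_span_range_iff_exists_fun ℝ).mp hspan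
  refine Finset.sum_congr rfl fun a _ => ?_
  simp [he]

/-- A positive definite Hermitian form has an orthonormal basis, which is a Parseval frame. -/
theorem exists_isParsevalFrame {V : Type*} [AddCommGroup V] [Module ℝ V]
    [FiniteDimensional ℝ V] {J : V →ₗ[ℝ] V} {g : V →ₗ[ℝ] V →ₗ[ℝ] ℝ}
    (symm : ∀ x y, g x y = g y x) (inv : ∀ x y, g (J x) (J y) = g x y)
    (pos : ∀ x, x ≠ 0 → 0 < g x x) :
    ∃ e : Fin (Module.finrank ℝ V) → V, IsParsevalFrame J g e ∧
      ∀ a b, g (e a) (e b) = if a = b then 1 else 0 := by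
  let C : InnerProductSpace.Core ℝ V :=
    { inner := fun x y => g x y
      conj_inner_symm := fun x y => by simp [symm x y]
      re_inner_nonneg := fun x => by
        rcases eq_or_ne x 0 with rfl | hx
        · simp
        · exact (pos x hx).le
      add_left := fun x y z => by simp
      smul_left := fun x y r => by simp
      definite := fun x hx => by
        by_contra h
        exact (pos x h).ne' hx }
  let _ : NormedAddCommGroup V := C.toNormedAddCommGroup
  let _ : InnerProductSpace ℝ V := InnerProductSpace.ofCore C.toCore
  let b := stdOrthonormalBasis ℝ V
  refine ⟨b, ⟨symm, inv, fun x => ?_⟩, orthonormal_iff_ite.mp b.orthonormal⟩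
  refine Eq.trans (Finset.sum_congr rfl fun a _ => ?_) (b.sum_repr x)
  rw [b.repr_apply_apply, real_inner_comm]
  rfl

theorem IsParsevalFrame.pos {V ι : Type*} [AddCommGroup V] [Module ℝ V] [Fintype ι]
    {J : V →ₗ[ℝ] V} {g : V →ₗ[ℝ] V →ₗ[ℝ] ℝ} {e : ι → V} (hu : IsParsevalFrame J g e) {x : V}
    (hx : x ≠ 0) : 0 < g x x := by
  rw [← hu.parseval x x]
  refine (Finset.sum_nonneg fun a _ => mul_self_nonneg _).lt_of_ne fun h => hx ?_
  rw [eq_comm, Finset.sum_eq_zero_iff_of_nonneg fun _ _ => mul_self_nonneg _] at h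
  rw [← hu.expand x]
  exact Finset.sum_eq_zero fun a _ => by
    rw [mul_self_eq_zero.mp (h a (Finset.mem_univ a)), zero_smul]

variable {E : Type*} [NormedAddCommGroup E] [NormedSpace ℝ E] [FiniteDimensional ℝ E]

omit [FiniteDimensional ℝ E] in
theorem IsParsevalFrame.isBounded {ι : Type*} [Fintype ι] {J : E →ₗ[ℝ] E} {g : E →ₗ[ℝ] E →ₗ[ℝ] ℝ}
    {e : ι → E} (hu : IsParsevalFrame J g e) : Bornology.IsBounded {x | g x x < 1} := by
  refine isBounded_iff_forall_norm_le.mpr ⟨∑ a, ‖e a‖, fun x hx => ?_⟩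
  rw [← hu.expand x]
  refine (norm_sum_le _ _).trans (Finset.sum_le_sum fun a _ => ?_)
  rw [norm_smul]
  refine mul_le_of_le_one_left (norm_nonneg _) ?_
  have h1 : g x (e a) * g x (e a) ≤ g x x := by
    rw [← hu.parseval x x]
    exact Finset.single_le_sum (f := fun a => g x (e a) * g x (e a))
      (fun _ _ => mul_self_nonneg _) (Finset.mem_univ a)
  have h2 : g x x < 1 := hx
  rw [Real.norm_eq_abs, abs_le]
  constructor <;> nlinarith

variable {M : Type*} [TopologicalSpace M] [ChartedSpace E M] [IsManifold 𝓘(ℝ, E) ∞ M]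

namespace Framing

/-- The metric with constant components `g` in the frame. -/
noncomputable def metric (Φ : Framing E M) {ι : Type*} [Fintype ι] {J : E →ₗ[ℝ] E}
    {g : E →ₗ[ℝ] E →ₗ[ℝ] ℝ} {e : ι → E} (hu : IsParsevalFrame J g e) : Metric E M where
  inner x := (ContinuousLinearMap.precomp ℝ ((Φ.frame x).symm : TangentSpace 𝓘(ℝ, E) x →L[ℝ] E)).comp
    ((toCLM₂ g).comp ((Φ.frame x).symm : TangentSpace 𝓘(ℝ, E) x →L[ℝ] E))
  symm x u v := hu.symm _ _
  pos x v hv := hu.pos fun h => hv ((Φ.frame x).symm.map_eq_zero_iff.mp h)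
  isVonNBounded x := by
    have h := ((NormedSpace.isVonNBounded_iff ℝ).mpr hu.isBounded).image
      (Φ.frame x : E →L[ℝ] TangentSpace 𝓘(ℝ, E) x)
    refine h.subset ?_
    intro v hv
    exact ⟨(Φ.frame x).symm v, hv, (Φ.frame x).apply_symm_apply v⟩
  contMDiff x := by
    refine Φ.contMDiffAt_hom fun u => Φ.contMDiffAt_hom (W := fun _ => ℝ) fun v => ?_
    rw [Bundle.contMDiffAt_section]
    refine (contMDiffAt_const (c := g u v)).congr_of_eventuallyEq
      (Filter.Eventually.of_forall fun y => ?_)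
    change g ((Φ.frame y).symm (Φ.frame y u)) ((Φ.frame y).symm (Φ.frame y v)) = g u v
    simp

theorem metric_frame (Φ : Framing E M) {ι : Type*} [Fintype ι] {J : E →ₗ[ℝ] E}
    {g : E →ₗ[ℝ] E →ₗ[ℝ] ℝ} {e : ι → E} (hu : IsParsevalFrame J g e) (x : M) (u v : E) :
    (Φ.metric hu).inner x (Φ.frame x u) (Φ.frame x v) = g u v := by
  change g ((Φ.frame x).symm (Φ.frame x u)) ((Φ.frame x).symm (Φ.frame x v)) = g u v
  simp

variable {Φ : Framing E M} {J : ComplexStructure E M} {J₀ : E →ₗ[ℝ] E} {g : Metric E M}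
  {g₀ : E →ₗ[ℝ] E →ₗ[ℝ] ℝ}

omit [FiniteDimensional ℝ E] in
theorem metric_ext {g h : Metric E M} (H : ∀ x u v,
    g.inner x (Φ.frame x u) (Φ.frame x v) = h.inner x (Φ.frame x u) (Φ.frame x v)) : g = h := by
  have : g.inner = h.inner := by
    funext x
    ext u v
    obtain ⟨u, rfl⟩ := (Φ.frame x).surjective u
    obtain ⟨v, rfl⟩ := (Φ.frame x).surjective v
    exact H x u v
  cases g
  cases h
  congr

/-- The right-hand side of the flow in the frame. -/
theorem velocity_eq (hJ : ∀ x v, J x (Φ.frame x v) = Φ.frame x (J₀ v))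
    (hg : ∀ x u v, g.inner x (Φ.frame x u) (Φ.frame x v) = g₀ u v)
    {nabla : CovariantDerivative 𝓘(ℝ, E) E (fun x : M => TangentSpace 𝓘(ℝ, E) x)}
    (hn : IsChernConnection J g nabla) {ι : Type*} [Fintype ι] {f : ι → E}
    (hf : IsParsevalFrame J₀ g₀ f) (x : M)
    {e : Fin (Module.finrank ℝ E) → TangentSpace 𝓘(ℝ, E) x} (he : IsOrthonormalFrame g x e)
    (u v : E) :
    -secondChernRicci J g nabla x e (Φ.frame x u) (Φ.frame x v)
      + torsionSquare g nabla x e (Φ.frame x u) (Φ.frame x v)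
      = velocityForm Φ.bracket J₀ g₀ f u v := by
  have : Nonempty M := ⟨x⟩
  have hc := isComplexLie hJ
  obtain ⟨A, hA⟩ := exists_isChernForm hc hf
  have hap := isChernConnection_apply hJ hg hn hf hA
  have hB : ∀ u v, nabla (fun y => Φ.frame y v) x (Φ.frame x u) = Φ.frame x (A u v) := fun u v => by
    rw [hap _ x (Φ.mdifferentiableAt_frame v x), connection_frame]
  obtain ⟨e, rfl⟩ : ∃ e' : Fin (Module.finrank ℝ E) → E, e = fun a => Φ.frame x (e' a) :=
    ⟨fun a => (Φ.frame x).symm (e a), funext fun a => ((Φ.frame x).apply_symm_apply _).symm⟩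
  have hu : IsParsevalFrame J₀ g₀ e := isParsevalFrame_of_orthonormal (by simp) hf.symm hf.inv
    fun a b => by rw [← hg x]; exact he a b
  obtain ⟨D, D', hBp, hD'⟩ := hA.exists_isBismutPair hc hu
  have key := neg_sum_curvature_add_torsion hc hu hBp hA hD' u v
  rw [secondChernRicci, torsionSquare]
  simp only [hJ, Φ.curvature_eq hap, Φ.torsion_frame hB, hg]
  rw [key]
  change velocityForm Φ.bracket J₀ g₀ e u v = _
  rw [velocityForm_eq, velocityForm_eq]
  exact hu.contraction_eq hf (velocityBilin Φ.bracket J₀ g₀ u v)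

end Framing

end FlowInFrame

/-! ### Left-invariant vector fields -/

section LeftInvariant

variable (E : Type*) [NormedAddCommGroup E] [NormedSpace ℝ E]
  {G : Type*} [TopologicalSpace G] [ChartedSpace E G] [Group G] [LieGroup 𝓘(ℝ, E) ∞ G]

/-- The differential at `1` of the left translation by `p`. -/
noncomputable def leftDiff (p : G) : E ≃L[ℝ] TangentSpace 𝓘(ℝ, E) p :=
  Diffeomorph.mfderivToContinuousLinearEquiv (I := 𝓘(ℝ, E)) (J := 𝓘(ℝ, E)) (n := ∞)
    { toEquiv := Equiv.mulLeft p
      contMDiff_toFun := contMDiff_mul_left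
      contMDiff_invFun := contMDiff_mul_left } (by simp) (1 : G)

theorem mdifferentiableAt_mul_left (a p : G) :
    MDifferentiableAt 𝓘(ℝ, E) 𝓘(ℝ, E) (fun q : G => a * q) p :=
  (contMDiff_mul_left (I := 𝓘(ℝ, E)) (n := ∞)).contMDiffAt.mdifferentiableAt (by simp)

theorem mfderiv_mul_left_leftDiff (a p : G) (v : E) :
    mfderiv 𝓘(ℝ, E) 𝓘(ℝ, E) (fun q : G => a * q) p (leftDiff E p v) = leftDiff E (a * p) v := by
  have h : (fun q : G => a * p * q) = (fun q => a * q) ∘ fun q => p * q :=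
    funext fun q => mul_assoc a p q
  have h1 : MDifferentiableAt 𝓘(ℝ, E) 𝓘(ℝ, E) (fun q : G => a * q) (p * 1) :=
    mdifferentiableAt_mul_left E a (p * 1)
  have h2 := mfderiv_comp (I' := 𝓘(ℝ, E)) (1 : G) h1 (mdifferentiableAt_mul_left E p 1)
  rw [← h] at h2
  have h3 := congrArg (fun T : E →L[ℝ] E => T v) h2
  have h4 : ∀ b : G, b = p → mfderiv 𝓘(ℝ, E) 𝓘(ℝ, E) (fun q : G => a * q) b
      (leftDiff E p v) = leftDiff E (a * p) v →
      mfderiv 𝓘(ℝ, E) 𝓘(ℝ, E) (fun q : G => a * q) p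
      (leftDiff E p v) = leftDiff E (a * p) v := by
    rintro b rfl h
    exact h
  exact h4 _ (mul_one p) h3.symm

/-- The left-invariant vector fields are smooth, as the restriction of the differential of the
multiplication to vectors of the form `(0, v)` based at `(p, 1)`. -/
theorem contMDiff_leftDiff (v : E) : CMDiff ∞ (T% fun p : G =>
    leftDiff E p v) := by
  let F₁ : G → TangentBundle 𝓘(ℝ, E) G × TangentBundle 𝓘(ℝ, E) G :=
    fun p => (TotalSpace.mk' E p 0, TotalSpace.mk' E 1 v)
  have S₁ : CMDiff ∞ F₁ :=
    (contMDiff_zeroSection ℝ (fun p : G => TangentSpace 𝓘(ℝ, E) p)).prodMk contMDiff_const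
  have S₂ : CMDiff ∞ (equivTangentBundleProd 𝓘(ℝ, E) G 𝓘(ℝ, E) G).symm :=
    contMDiff_equivTangentBundleProd_symm
  have S₃ : CMDiff ∞ (tangentMap (𝓘(ℝ, E).prod 𝓘(ℝ, E)) 𝓘(ℝ, E) fun p : G × G => p.1 * p.2) :=
    (contMDiff_mul 𝓘(ℝ, E) ∞).contMDiff_tangentMap (by simp)
  have S := (S₃.comp S₂).comp S₁
  convert! S with g
  · simp [F₁]
  · simp only [Function.comp_apply, tangentMap, F₁]
    rw [mfderiv_prod_eq_add_apply ((contMDiff_mul 𝓘(ℝ, E) ∞).mdifferentiableAt (by simp))]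
    change _ = mfderiv 𝓘(ℝ, E) 𝓘(ℝ, E) (fun z : G => z * 1) g (0 : E)
      + mfderiv 𝓘(ℝ, E) 𝓘(ℝ, E) (fun z : G => g * z) 1 v
    refine Eq.trans ?_ (congrArg₂ (· + ·) (map_zero _).symm rfl)
    exact (zero_add _).symm

variable [FiniteDimensional ℝ E]

variable (G) in
/-- The bracket of the Lie algebra of `G`, on the model space. -/
noncomputable def lieGroupBracket : E →ₗ[ℝ] E →ₗ[ℝ] E :=
  have := FiniteDimensional.complete ℝ E
  have : LieGroup 𝓘(ℝ, E) (minSmoothness ℝ 3) G := LieGroup.of_le (minSmoothness_le_infty 3)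
  LinearMap.mk₂ ℝ (fun v w : E =>
      @Bracket.bracket (GroupLieAlgebra 𝓘(ℝ, E) G) (GroupLieAlgebra 𝓘(ℝ, E) G) _ v w)
    (fun u v w => add_lie (L := GroupLieAlgebra 𝓘(ℝ, E) G) (M := GroupLieAlgebra 𝓘(ℝ, E) G) u v w)
    (fun c u v => smul_lie (R := ℝ) (L := GroupLieAlgebra 𝓘(ℝ, E) G)
      (M := GroupLieAlgebra 𝓘(ℝ, E) G) c u v)
    (fun u v w => lie_add (L := GroupLieAlgebra 𝓘(ℝ, E) G) (M := GroupLieAlgebra 𝓘(ℝ, E) G) u v w)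
    (fun c u v => lie_smul (R := ℝ) (L := GroupLieAlgebra 𝓘(ℝ, E) G)
      (M := GroupLieAlgebra 𝓘(ℝ, E) G) c u v)

theorem mlieBracket_leftDiff (u v : E) (p : G) :
    mlieBracket 𝓘(ℝ, E) (fun q : G => leftDiff E q u)
      (fun q : G => leftDiff E q v) p
      = leftDiff E p (lieGroupBracket E G u v) := by
  have := FiniteDimensional.complete ℝ E
  have : LieGroup 𝓘(ℝ, E) (minSmoothness ℝ 3) G := LieGroup.of_le (minSmoothness_le_infty 3)
  exact (congrFun (mulInvariantVector_mlieBracket (I := 𝓘(ℝ, E)) (G := G) u v) p).symm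

end LeftInvariant

/-! ### The framing of a discrete quotient -/

section Quotient

variable {E : Type*} [NormedAddCommGroup E] [NormedSpace ℝ E]
  {G : Type*} [TopologicalSpace G] [ChartedSpace E G] [Group G]
  {M : Type*} [TopologicalSpace M] [ChartedSpace E M]
  {Γ : Subgroup G} {proj : G → M} (hproj : IsDiscreteQuotient E Γ proj)

include hproj in
theorem IsDiscreteQuotient.proj_mul {γ : G} (hγ : γ ∈ Γ) (p : G) : proj (γ * p) = proj p :=
  ((hproj.eq_iff p (γ * p)).mpr ⟨γ, hγ, rfl⟩).symm

variable [LieGroup 𝓘(ℝ, E) ∞ G]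

/-- The differential of the projection composed with a left translation, on the model space. -/
noncomputable def IsDiscreteQuotient.frameAt (p : G) : E ≃L[ℝ] E :=
  (leftDiff E p).trans (hproj.isLocalDiffeomorph.mfderivToContinuousLinearEquiv (by simp) p)

theorem IsDiscreteQuotient.frameAt_apply (p : G) (v : E) :
    hproj.frameAt p v = mfderiv 𝓘(ℝ, E) 𝓘(ℝ, E) proj p (leftDiff E p v) := rfl

/-- The frame at a point of the quotient does not depend on the preimage, since left translations
by elements of `Γ` commute with the projection and preserve left-invariant fields. -/
theorem IsDiscreteQuotient.frameAt_eq {p q : G} (h : proj p = proj q) :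
    hproj.frameAt p = hproj.frameAt q := by
  obtain ⟨γ, hγ, rfl⟩ := (hproj.eq_iff p q).mp h
  ext v
  rw [frameAt_apply, frameAt_apply, ← mfderiv_mul_left_leftDiff]
  have h1 := mfderiv_comp (I' := 𝓘(ℝ, E)) p
    (hproj.isLocalDiffeomorph.mdifferentiable (by simp) (γ * p)) (mdifferentiableAt_mul_left E γ p)
  have h2 : proj ∘ (fun q => γ * q) = proj := funext fun q => hproj.proj_mul hγ q
  rw [h2] at h1
  exact congrArg (fun T : E →L[ℝ] E => T (leftDiff E p v)) h1

/-- The frame of the quotient induced by the left-invariant vector fields. -/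
noncomputable def IsDiscreteQuotient.frame (x : M) : E ≃L[ℝ] TangentSpace 𝓘(ℝ, E) x :=
  hproj.frameAt (hproj.surjective x).choose

theorem IsDiscreteQuotient.frame_proj (p : G) (v : E) :
    hproj.frame (proj p) v = mfderiv 𝓘(ℝ, E) 𝓘(ℝ, E) proj p (leftDiff E p v) :=
  congrArg (fun T : E ≃L[ℝ] E => T v) (hproj.frameAt_eq (hproj.surjective (proj p)).choose_spec)

variable [IsManifold 𝓘(ℝ, E) ∞ M]

theorem IsDiscreteQuotient.contMDiff_frame (v : E) : CMDiff ∞ (T% fun x : M => hproj.frame x v) := by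
  intro x
  obtain ⟨p, rfl⟩ := hproj.surjective x
  have hp := hproj.isLocalDiffeomorph p
  have h1 : CMDiffAt ∞ hp.localInverse (proj p) := hp.localInverse_contMDiffAt
  have h2 : ContMDiff 𝓘(ℝ, E).tangent 𝓘(ℝ, E).tangent ∞ (tangentMap 𝓘(ℝ, E) 𝓘(ℝ, E) proj) :=
    hproj.isLocalDiffeomorph.contMDiff.contMDiff_tangentMap (by simp)
  have h3 := (h2.comp (contMDiff_leftDiff E v)).contMDiffAt.comp (proj p) h1
  refine h3.congr_of_eventuallyEq ?_
  filter_upwards [hp.localInverse_eventuallyEq_right] with y hy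
  have hy : proj (hp.localInverse y) = y := hy
  have h4 := hproj.frame_proj (hp.localInverse y) v
  change (⟨y, hproj.frame y v⟩ : TangentBundle 𝓘(ℝ, E) M) = ⟨proj (hp.localInverse y), _⟩
  refine Eq.trans ?_ (congrArg (fun w => (⟨proj (hp.localInverse y), w⟩ : TangentBundle 𝓘(ℝ, E) M)) h4)
  rw [hy]

omit [IsManifold 𝓘(ℝ, E) ∞ M] in
/-- The frame of the quotient lifts to the left-invariant vector fields. -/
theorem IsDiscreteQuotient.mpullback_frame (v : E) :
    mpullback 𝓘(ℝ, E) 𝓘(ℝ, E) proj (fun x => hproj.frame x v)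
      = fun q : G => leftDiff E q v := by
  funext q
  rw [mpullback_apply, frame_proj]
  have h := hproj.isLocalDiffeomorph.mfderivToContinuousLinearEquiv_coe (by simp) q
  rw [← h, ContinuousLinearMap.inverse_equiv]
  exact ContinuousLinearEquiv.symm_apply_apply _ _

/-- An invariant metric has constant components in the frame of left-invariant vector fields. -/
theorem IsDiscreteQuotient.inner_frame {g : Metric E M} (hg : IsInvariantMetric proj g)
    (x : M) (u v : E) :
    g.inner x (hproj.frame x u) (hproj.frame x v)
      = g.inner (proj 1) (hproj.frame (proj 1) u) (hproj.frame (proj 1) v) := by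
  obtain ⟨a, rfl⟩ := hproj.surjective x
  have h := hg a 1 (leftDiff E 1 u) (leftDiff E 1 v)
  rw [mfderiv_mul_left_leftDiff, mfderiv_mul_left_leftDiff, ← hproj.frame_proj,
    ← hproj.frame_proj, ← hproj.frame_proj, ← hproj.frame_proj] at h
  have h1 : ∀ b, b = a → g.inner (proj b) (hproj.frame (proj b) u) (hproj.frame (proj b) v)
      = g.inner (proj 1) (hproj.frame (proj 1) u) (hproj.frame (proj 1) v) →
      g.inner (proj a) (hproj.frame (proj a) u) (hproj.frame (proj a) v)
      = g.inner (proj 1) (hproj.frame (proj 1) u) (hproj.frame (proj 1) v) := by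
    rintro b rfl h
    exact h
  exact h1 _ (mul_one a) h

/-- A metric with constant components in the frame of left-invariant vector fields is invariant. -/
theorem IsDiscreteQuotient.isInvariantMetric {g : Metric E M} {g₀ : E → E → ℝ}
    (hg : ∀ x u v, g.inner x (hproj.frame x u) (hproj.frame x v) = g₀ u v) :
    IsInvariantMetric proj g := by
  intro a p u v
  obtain ⟨u, rfl⟩ := (leftDiff E p).surjective u
  obtain ⟨v, rfl⟩ := (leftDiff E p).surjective v
  rw [mfderiv_mul_left_leftDiff, mfderiv_mul_left_leftDiff, ← hproj.frame_proj,
    ← hproj.frame_proj, ← hproj.frame_proj, ← hproj.frame_proj, hg, hg]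

/-- An invariant complex structure has constant components in the frame of left-invariant vector
fields. -/
theorem IsDiscreteQuotient.exists_apply_frame {J : ComplexStructure E M}
    (hJ : IsInvariantComplexStructure proj J) :
    ∃ J₀ : E →ₗ[ℝ] E, ∀ x v, J x (hproj.frame x v) = hproj.frame x (J₀ v) := by
  obtain ⟨K, hK, hK'⟩ := hJ
  refine ⟨((leftDiff E (1 : G)).symm : TangentSpace 𝓘(ℝ, E) (1 : G) →ₗ[ℝ] E) ∘ₗ (K 1 : _ →ₗ[ℝ] _) ∘ₗ
    (leftDiff E (1 : G) : E →ₗ[ℝ] TangentSpace 𝓘(ℝ, E) (1 : G)), fun x v => ?_⟩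
  obtain ⟨a, rfl⟩ := hproj.surjective x
  set w : E := (leftDiff E (1 : G)).symm (K 1 (leftDiff E 1 v)) with hw
  have hw' : leftDiff E 1 w = K 1 (leftDiff E 1 v) := by
    rw [hw, ContinuousLinearEquiv.apply_symm_apply]
  have h := hK' a 1 (leftDiff E 1 v)
  rw [← hw', mfderiv_mul_left_leftDiff, mfderiv_mul_left_leftDiff] at h
  have h1 : ∀ b, b = a → leftDiff E b w = K b (leftDiff E b v) →
      leftDiff E a w = K a (leftDiff E a v) := by
    rintro b rfl h
    exact h
  have h2 := h1 _ (mul_one a) h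
  change _ = hproj.frame (proj a) w
  rw [hproj.frame_proj, hproj.frame_proj, h2, hK]

variable [FiniteDimensional ℝ E]

/-- The framing of the quotient by the left-invariant vector fields. -/
noncomputable def IsDiscreteQuotient.framing : Framing E M where
  frame := hproj.frame
  contMDiff := hproj.contMDiff_frame
  bracket := lieGroupBracket E G
  mlieBracket_eq u v x := by
    have := FiniteDimensional.complete ℝ E
    have : IsManifold 𝓘(ℝ, E) (minSmoothness ℝ 2) G := .of_le (minSmoothness_le_infty 2) (n := ∞)
    have := isManifold_minSmoothness (E := E) (M := M) 2
    obtain ⟨p, rfl⟩ := hproj.surjective x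
    have h := mpullback_mlieBracket (I := 𝓘(ℝ, E)) (I' := 𝓘(ℝ, E)) (x₀ := p) (f := proj)
      ((hproj.contMDiff_frame u _).mdifferentiableAt (by simp))
      ((hproj.contMDiff_frame v _).mdifferentiableAt (by simp))
      (hproj.isLocalDiffeomorph.contMDiff.contMDiffAt) (minSmoothness_le_infty 2)
    rw [hproj.mpullback_frame, hproj.mpullback_frame, mlieBracket_leftDiff, mpullback_apply] at h
    have h1 := hproj.isLocalDiffeomorph.mfderivToContinuousLinearEquiv_coe (by simp) p
    rw [← h1, ContinuousLinearMap.inverse_equiv] at h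
    rw [frame_proj, ← h, ← h1]
    exact (ContinuousLinearEquiv.apply_symm_apply _ _).symm

end Quotient

/-! ### Second-order expansion of a local multiplication -/

section CrossDeriv

open Filter Asymptotics
open scoped Topology

variable {E : Type*} [NormedAddCommGroup E] [NormedSpace ℝ E]

/-- The mixed second derivative at the origin of a map of two variables: `crossDeriv μ x y` is the
derivative in the direction `x` of the partial derivative `∂₂ μ (·, 0) y`. -/
noncomputable def crossDeriv (μ : E × E → E) : E →L[ℝ] E →L[ℝ] E :=
  (fderiv ℝ (fun p => (fderiv ℝ μ p).comp (ContinuousLinearMap.inr ℝ E E)) 0).comp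
    (ContinuousLinearMap.inl ℝ E E)

variable {μ : E × E → E} (hμ : ContDiffAt ℝ 2 μ 0)

include hμ

theorem contDiffAt_partialDeriv :
    ContDiffAt ℝ 1 (fun p => (fderiv ℝ μ p).comp (ContinuousLinearMap.inr ℝ E E)) 0 :=
  (hμ.fderiv_right (m := 1) (by norm_num)).clm_comp contDiffAt_const

theorem hasFDerivAt_partialDeriv_left :
    HasFDerivAt (fun x : E => (fderiv ℝ μ (x, 0)).comp (ContinuousLinearMap.inr ℝ E E))
      (crossDeriv μ) 0 := by
  have h := ((contDiffAt_partialDeriv hμ).differentiableAt (by simp)).hasFDerivAt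
  exact HasFDerivAt.comp (f := fun x : E => (x, (0 : E))) (0 : E) h
    (ContinuousLinearMap.inl ℝ E E).hasFDerivAt

/-- The Taylor expansion of a local multiplication with unit `0`. The error is small relative to the
product of the norms, as it vanishes on both axes. -/
theorem isLittleO_sub_crossDeriv (h₁ : ∀ᶠ x in 𝓝 (0 : E), μ (x, 0) = x)
    (h₂ : ∀ᶠ y in 𝓝 (0 : E), μ (0, y) = y) :
    (fun p : E × E => μ p - p.1 - p.2 - crossDeriv μ p.1 p.2)
      =o[𝓝 0] fun p => ‖p.1‖ * ‖p.2‖ := by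
  rw [isLittleO_iff]
  intro ε hε
  have hs := ((contDiffAt_partialDeriv hμ).hasStrictFDerivAt (by simp)).isLittleO.def hε
  have hd : ∀ᶠ p in 𝓝 (0 : E × E), DifferentiableAt ℝ μ p :=
    (hμ.eventually (by simp)).mono fun p hp => hp.differentiableAt (by simp)
  obtain ⟨r₁, hr₁, H₁⟩ := Metric.eventually_nhds_iff_ball.mp h₁
  obtain ⟨r₂, hr₂, H₂⟩ := Metric.eventually_nhds_iff_ball.mp h₂
  obtain ⟨r₃, hr₃, H₃⟩ := Metric.eventually_nhds_iff_ball.mp hd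
  obtain ⟨r₄, hr₄, H₄⟩ := Metric.eventually_nhds_iff_ball.mp hs
  set r := min (min r₁ r₂) (min r₃ r₄)
  have hr : 0 < r := by positivity
  refine Metric.eventually_nhds_iff_ball.mpr ⟨r, hr, fun p hp => ?_⟩
  obtain ⟨x, y⟩ := p
  have hxy : ‖x‖ < r ∧ ‖y‖ < r := by simpa [Prod.norm_def] using hp
  obtain ⟨hx, hy⟩ := hxy
  have hmin : r ≤ r₁ ∧ r ≤ r₂ ∧ r ≤ r₃ ∧ r ≤ r₄ := by simp [r]
  obtain ⟨m₁, m₂, m₃, m₄⟩ := hmin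
  have hid : ∀ y' : E, ‖y'‖ < r → (fderiv ℝ μ (0, y')).comp (ContinuousLinearMap.inr ℝ E E)
      = ContinuousLinearMap.id ℝ E := by
    intro y' hy'
    have h3 : DifferentiableAt ℝ μ (0, y') :=
      H₃ _ (by simp [Prod.norm_def, hy'.trans_le m₃])
    have h4 : HasFDerivAt (fun y => μ (0, y))
        ((fderiv ℝ μ (0, y')).comp (ContinuousLinearMap.inr ℝ E E)) y' :=
      HasFDerivAt.comp (f := fun y : E => ((0 : E), y)) y' h3.hasFDerivAt
        (ContinuousLinearMap.inr ℝ E E).hasFDerivAt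
    have h5 : (fun y => μ (0, y)) =ᶠ[𝓝 y'] fun y => y := by
      filter_upwards [Metric.isOpen_ball.mem_nhds
        (show y' ∈ Metric.ball (0 : E) r₂ by simpa using hy'.trans_le m₂)] with y hy using H₂ y hy
    exact h4.unique ((hasFDerivAt_id y').congr_of_eventuallyEq h5)
  have hbd : ∀ y' ∈ Metric.ball (0 : E) r,
      HasFDerivWithinAt (fun y => μ (x, y) - x - y - crossDeriv μ x y)
        ((fderiv ℝ μ (x, y')).comp (ContinuousLinearMap.inr ℝ E E) - ContinuousLinearMap.id ℝ E
          - crossDeriv μ x) (Metric.ball 0 r) y' := by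
    intro y' hy'
    have hy' : ‖y'‖ < r := by simpa using hy'
    have h3 : DifferentiableAt ℝ μ (x, y') :=
      H₃ _ (by simp [Prod.norm_def, hx.trans_le m₃, hy'.trans_le m₃])
    have h4 : HasFDerivAt (fun y => μ (x, y))
        ((fderiv ℝ μ (x, y')).comp (ContinuousLinearMap.inr ℝ E E)) y' :=
      HasFDerivAt.comp (f := fun y : E => (x, y)) y' h3.hasFDerivAt
        (hasFDerivAt_prodMk_right x y')
    exact (((h4.sub_const x).sub (hasFDerivAt_id y')).sub
      (crossDeriv μ x).hasFDerivAt).hasFDerivWithinAt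
  have hle : ∀ y' ∈ Metric.ball (0 : E) r,
      ‖(fderiv ℝ μ (x, y')).comp (ContinuousLinearMap.inr ℝ E E) - ContinuousLinearMap.id ℝ E
          - crossDeriv μ x‖ ≤ ε * ‖x‖ := by
    intro y' hy'
    have hy' : ‖y'‖ < r := by simpa using hy'
    have h4 := H₄ ((x, y'), (0, y')) (by
      rw [Metric.mem_ball, dist_eq_norm]
      simp [Prod.norm_def, hx.trans_le m₄, hy'.trans_le m₄])
    simp only [hid y' hy'] at h4
    convert! h4 using 2
    · simp [crossDeriv]
    · simp [Prod.norm_def]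
  have := (convex_ball (0 : E) r).norm_image_sub_le_of_norm_hasFDerivWithin_le hbd hle
    (Metric.mem_ball_self hr) (show y ∈ Metric.ball (0 : E) r by simpa using hy)
  have hx0 : μ (x, 0) = x := H₁ x (by simpa using hx.trans_le m₁)
  simpa [hx0, mul_assoc] using this

/-- The leading term of a commutator: if `x ~ τ α` and `y ~ τ β`, then the solution `z` of
`μ(z, μ(y, x)) = μ(x, y)` satisfies `z ~ τ² (B(α, β) - B(β, α))` for `B = crossDeriv μ`. -/
theorem isLittleO_commutator (h₁ : ∀ᶠ x in 𝓝 (0 : E), μ (x, 0) = x)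
    (h₂ : ∀ᶠ y in 𝓝 (0 : E), μ (0, y) = y) {X : Type*} {l : Filter X} {τ : X → ℝ}
    (hτ : Tendsto τ l (𝓝 0)) {x y z : X → E} {α β : E}
    (hx : (fun t => x t - τ t • α) =o[l] τ) (hy : (fun t => y t - τ t • β) =o[l] τ)
    (hz : Tendsto z l (𝓝 0)) (hxyz : ∀ᶠ t in l, μ (z t, μ (y t, x t)) = μ (x t, y t)) :
    (fun t => z t - τ t ^ 2 • (crossDeriv μ α β - crossDeriv μ β α)) =o[l] fun t => τ t ^ 2 := by
  set B := crossDeriv μ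
  have hT := isLittleO_sub_crossDeriv hμ h₁ h₂
  have hO : ∀ {x : X → E} {α : E}, (fun t => x t - τ t • α) =o[l] τ → x =O[l] τ := by
    intro x α hx
    have h : (fun t => τ t • α) =O[l] τ := by
      simpa using (isBigO_refl τ l).smul (isBigO_const_const α (one_ne_zero (α := ℝ)) l)
    simpa using hx.isBigO.add h
  have hxO := hO hx
  have hyO := hO hy
  have hx0 : Tendsto x l (𝓝 0) := hxO.trans_tendsto hτ
  have hy0 : Tendsto y l (𝓝 0) := hyO.trans_tendsto hτ
  -- the bilinear terms
  have hB : ∀ {x y : X → E} {α β : E}, (fun t => x t - τ t • α) =o[l] τ →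
      (fun t => y t - τ t • β) =o[l] τ →
      (fun t => B (x t) (y t) - τ t ^ 2 • B α β) =o[l] fun t => τ t ^ 2 := by
    intro x y α β hx hy
    have hb : ∀ {f g : X → E}, (fun t => B (f t) (g t)) =O[l] fun t => ‖f t‖ * ‖g t‖ := by
      intro f g
      refine IsBigO.of_bound ‖B‖ (Eventually.of_forall fun t => ?_)
      rw [norm_mul, norm_norm, norm_norm, ← mul_assoc]
      exact B.le_opNorm₂ _ _
    have h1 : (fun t => B (x t - τ t • α) (y t)) =o[l] fun t => τ t ^ 2 :=
      hb.trans_isLittleO (by simpa [pow_two] using hx.norm_left.mul_isBigO (hO hy).norm_left)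
    have h2 : (fun t => B (τ t • α) (y t - τ t • β)) =o[l] fun t => τ t ^ 2 := by
      have h : (fun t => τ t • α) =O[l] τ := by
        simpa using (isBigO_refl τ l).smul (isBigO_const_const α (one_ne_zero (α := ℝ)) l)
      exact hb.trans_isLittleO (by simpa [pow_two] using h.norm_left.mul_isLittleO hy.norm_left)
    refine (h1.add h2).congr_left fun t => ?_
    simp only [map_sub, map_smul, _root_.sub_apply, _root_.smul_apply, smul_smul, pow_two]
    abel
  have hprod : ∀ {x y : X → E}, x =O[l] τ → y =O[l] τ → Tendsto x l (𝓝 0) → Tendsto y l (𝓝 0) →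
      (fun t => μ (x t, y t) - x t - y t - B (x t) (y t)) =o[l] fun t => τ t ^ 2 := by
    intro x y hx hy hx0 hy0
    have h := hT.comp_tendsto (hx0.prodMk_nhds hy0)
    refine h.trans_isBigO ?_
    simpa [pow_two, Function.comp_def] using hx.norm_left.mul hy.norm_left
  have hq := hprod hxO hyO hx0 hy0
  have hp := hprod hyO hxO hy0 hx0
  -- the difference of the two products
  have hd : (fun t => μ (x t, y t) - μ (y t, x t) - τ t ^ 2 • (B α β - B β α))
      =o[l] fun t => τ t ^ 2 := by
    refine ((hq.sub hp).add ((hB hx hy).sub (hB hy hx))).congr_left fun t => ?_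
    rw [smul_sub]
    abel
  have hp0 : Tendsto (fun t => μ (y t, x t)) l (𝓝 0) := by
    have h0 : μ 0 = 0 := h₁.self_of_nhds
    have := hμ.continuousAt.tendsto.comp (hy0.prodMk_nhds hx0)
    rwa [h0] at this
  -- the correction terms are small relative to `z`
  have hr : (fun t => μ (x t, y t) - μ (y t, x t) - z t) =o[l] z := by
    have h1 : (fun t => μ (z t, μ (y t, x t)) - z t - μ (y t, x t) - B (z t) (μ (y t, x t)))
        =o[l] z := by
      have h := hT.comp_tendsto (hz.prodMk_nhds hp0)
      refine h.trans_isBigO ?_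
      have h2 : (fun t => ‖z t‖ * ‖μ (y t, x t)‖) =O[l] fun t => ‖z t‖ * (1 : ℝ) :=
        (isBigO_refl (fun t => ‖z t‖) l).mul (hp0.norm.isBigO_one ℝ)
      simpa [Function.comp_def] using h2
    have h2 : (fun t => B (z t) (μ (y t, x t))) =o[l] z := by
      have h3 : (fun t => B (z t) (μ (y t, x t))) =O[l] fun t => ‖z t‖ * ‖μ (y t, x t)‖ := by
        refine IsBigO.of_bound ‖B‖ (Eventually.of_forall fun t => ?_)
        rw [norm_mul, norm_norm, norm_norm, ← mul_assoc]
        exact B.le_opNorm₂ _ _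
      refine h3.trans_isLittleO ?_
      have h4 : (fun t => ‖μ (y t, x t)‖) =o[l] fun _ => (1 : ℝ) :=
        (isLittleO_one_iff ℝ).mpr (by simpa using hp0.norm)
      simpa using (isBigO_refl (fun t => ‖z t‖) l).mul_isLittleO h4
    refine (h1.add h2).congr' ?_ EventuallyEq.rfl
    filter_upwards [hxyz] with t ht
    rw [ht]
    abel
  have hzO : z =O[l] fun t => τ t ^ 2 := by
    have h1 : (fun t => μ (x t, y t) - μ (y t, x t)) =O[l] fun t => τ t ^ 2 := by
      have h : (fun t => τ t ^ 2 • (B α β - B β α)) =O[l] fun t => τ t ^ 2 := by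
        simpa using (isBigO_refl (fun t => τ t ^ 2) l).smul
          (isBigO_const_const (B α β - B β α) (one_ne_zero (α := ℝ)) l)
      simpa using hd.isBigO.add h
    exact (hr.right_isBigO_add.congr_right fun t => by abel).trans h1
  refine (hd.sub (hr.trans_isBigO hzO)).congr_left fun t => ?_
  abel

end CrossDeriv

/-! ### The Lie bracket in a chart -/

section LieChart

open Filter
open scoped Topology

variable (E : Type*) [NormedAddCommGroup E] [NormedSpace ℝ E]
  {G : Type*} [TopologicalSpace G] [ChartedSpace E G] [Group G]

/-- The preferred chart at `1`, translated so as to map `1` to the origin. -/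
noncomputable def lieChart (g : G) : E := extChartAt 𝓘(ℝ, E) (1 : G) g - extChartAt 𝓘(ℝ, E) (1 : G) 1

variable (G) in
/-- The inverse of `lieChart`. -/
noncomputable def lieChartSymm (x : E) : G :=
  (extChartAt 𝓘(ℝ, E) (1 : G)).symm (extChartAt 𝓘(ℝ, E) (1 : G) 1 + x)

variable (G) in
/-- The multiplication of `G` in the chart `lieChart`. -/
noncomputable def localMul (p : E × E) : E :=
  lieChart E (lieChartSymm E G p.1 * lieChartSymm E G p.2)

theorem lieChart_one : lieChart E (1 : G) = 0 := sub_self _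

theorem lieChartSymm_zero : lieChartSymm E G 0 = 1 := by simp [lieChartSymm]

theorem eventually_lieChart_lieChartSymm :
    ∀ᶠ x in 𝓝 (0 : E), lieChart E (lieChartSymm E G x) = x := by
  have h : Tendsto (fun x : E => extChartAt 𝓘(ℝ, E) (1 : G) 1 + x) (𝓝 0)
      (𝓝 (extChartAt 𝓘(ℝ, E) (1 : G) 1)) :=
    (continuous_const.add continuous_id).tendsto' _ _ (add_zero _)
  filter_upwards [h.eventually (extChartAt_target_mem_nhds (I := 𝓘(ℝ, E)) (1 : G))] with x hx
  rw [lieChart, lieChartSymm, PartialEquiv.right_inv _ hx, add_sub_cancel_left]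

theorem eventually_lieChartSymm_lieChart :
    ∀ᶠ g in 𝓝 (1 : G), lieChartSymm E G (lieChart E g) = g := by
  filter_upwards [extChartAt_source_mem_nhds (I := 𝓘(ℝ, E)) (1 : G)] with g hg
  rw [lieChart, lieChartSymm, add_sub_cancel, PartialEquiv.left_inv _ hg]

variable [LieGroup 𝓘(ℝ, E) ∞ G]

theorem eventually_contMDiffAt_lieChartSymm :
    ∀ᶠ x in 𝓝 (0 : E), ContMDiffAt 𝓘(ℝ, E) 𝓘(ℝ, E) ∞ (lieChartSymm E G) x := by
  have h : Tendsto (fun x : E => extChartAt 𝓘(ℝ, E) (1 : G) 1 + x) (𝓝 0)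
      (𝓝 (extChartAt 𝓘(ℝ, E) (1 : G) 1)) :=
    (continuous_const.add continuous_id).tendsto' _ _ (add_zero _)
  filter_upwards [h.eventually (eventually_mem_nhds_iff.mpr
    (extChartAt_target_mem_nhds (I := 𝓘(ℝ, E)) (1 : G)))] with x hx
  have h1 := (contMDiffOn_extChartAt_symm (I := 𝓘(ℝ, E)) (n := ∞) (1 : G)).contMDiffAt hx
  have h2 : ContMDiff 𝓘(ℝ, E) 𝓘(ℝ, E) ∞ fun x : E => extChartAt 𝓘(ℝ, E) (1 : G) 1 + x :=
    (contDiff_const.add contDiff_id).contMDiff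
  exact h1.comp x h2.contMDiffAt

theorem eventually_contMDiffAt_lieChart :
    ∀ᶠ g in 𝓝 (1 : G), ContMDiffAt 𝓘(ℝ, E) 𝓘(ℝ, E) ∞ (lieChart E) g := by
  filter_upwards [extChartAt_source_mem_nhds (I := 𝓘(ℝ, E)) (1 : G)] with g hg
  have h1 := contMDiffAt_extChartAt' (I := 𝓘(ℝ, E)) (n := ∞) (x := (1 : G)) (x' := g) (by simpa using hg)
  have h2 : ContMDiff 𝓘(ℝ, E) 𝓘(ℝ, E) ∞ fun x : E => x - extChartAt 𝓘(ℝ, E) (1 : G) 1 :=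
    (contDiff_id.sub contDiff_const).contMDiff
  exact h2.contMDiffAt.comp g h1

theorem tendsto_lieChartSymm : Tendsto (lieChartSymm E G) (𝓝 0) (𝓝 1) := by
  have h := (eventually_contMDiffAt_lieChartSymm E (G := G)).self_of_nhds.continuousAt.tendsto
  rwa [lieChartSymm_zero] at h

theorem tendsto_lieChart : Tendsto (lieChart E) (𝓝 (1 : G)) (𝓝 0) := by
  have h := (eventually_contMDiffAt_lieChart E (G := G)).self_of_nhds.continuousAt.tendsto
  rwa [lieChart_one] at h

theorem tendsto_lieChartSymm_mul :
    Tendsto (fun p : E × E => lieChartSymm E G p.1 * lieChartSymm E G p.2) (𝓝 0) (𝓝 1) := by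
  have := topologicalGroup_of_lieGroup 𝓘(ℝ, E) ∞ (G := G)
  have h1 := (tendsto_lieChartSymm E (G := G)).comp (continuous_fst.tendsto (0 : E × E))
  have h2 := (tendsto_lieChartSymm E (G := G)).comp (continuous_snd.tendsto (0 : E × E))
  simpa using h1.mul h2

theorem eventually_lieChartSymm_localMul :
    ∀ᶠ p in 𝓝 (0 : E × E),
      lieChartSymm E G (localMul E G p) = lieChartSymm E G p.1 * lieChartSymm E G p.2 :=
  (tendsto_lieChartSymm_mul E).eventually (eventually_lieChartSymm_lieChart E)

omit [LieGroup 𝓘(ℝ, E) ∞ G] in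
theorem eventually_localMul_lieChart :
    ∀ᶠ p in 𝓝 (1 : G) ×ˢ 𝓝 (1 : G),
      localMul E G (lieChart E p.1, lieChart E p.2) = lieChart E (p.1 * p.2) := by
  filter_upwards [tendsto_fst.eventually (eventually_lieChartSymm_lieChart E (G := G)),
    tendsto_snd.eventually (eventually_lieChartSymm_lieChart E (G := G))] with p h1 h2
  rw [localMul, h1, h2]

omit [LieGroup 𝓘(ℝ, E) ∞ G] in
theorem eventually_localMul_zero : ∀ᶠ x in 𝓝 (0 : E), localMul E G (x, 0) = x := by
  filter_upwards [eventually_lieChart_lieChartSymm E (G := G)] with x hx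
  rw [localMul, lieChartSymm_zero, mul_one, hx]

omit [LieGroup 𝓘(ℝ, E) ∞ G] in
theorem eventually_zero_localMul : ∀ᶠ x in 𝓝 (0 : E), localMul E G (0, x) = x := by
  filter_upwards [eventually_lieChart_lieChartSymm E (G := G)] with x hx
  rw [localMul, lieChartSymm_zero, one_mul, hx]

theorem contDiffAt_localMul : ContDiffAt ℝ ∞ (localMul E G) 0 := by
  rw [← contMDiffAt_iff_contDiffAt]
  have h0 := (eventually_contMDiffAt_lieChartSymm E (G := G)).self_of_nhds
  have h1 : ContMDiffAt 𝓘(ℝ, E × E) 𝓘(ℝ, E) ∞ (fun p : E × E => lieChartSymm E G p.1) 0 :=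
    ContMDiffAt.comp (f := Prod.fst) (0 : E × E) h0 contDiff_fst.contMDiff.contMDiffAt
  have h2 : ContMDiffAt 𝓘(ℝ, E × E) 𝓘(ℝ, E) ∞ (fun p : E × E => lieChartSymm E G p.2) 0 :=
    ContMDiffAt.comp (f := Prod.snd) (0 : E × E) h0 contDiff_snd.contMDiff.contMDiffAt
  refine ContMDiffAt.comp (g := lieChart E) (0 : E × E) ?_ (h1.mul h2)
  have h3 := (eventually_contMDiffAt_lieChart E (G := G)).self_of_nhds
  simpa [lieChartSymm_zero] using h3

theorem mfderiv_lieChartSymm_zero :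
    mfderiv 𝓘(ℝ, E) 𝓘(ℝ, E) (lieChartSymm E G) 0 = ContinuousLinearMap.id ℝ E := by
  have h1 := mfderivWithin_range_extChartAt_symm (I := 𝓘(ℝ, E)) (x := (1 : G))
  simp only [modelWithCornersSelf_coe, Set.range_id, mfderivWithin_univ] at h1
  have h2 : HasMFDerivAt 𝓘(ℝ, E) 𝓘(ℝ, E) (fun x : E => extChartAt 𝓘(ℝ, E) (1 : G) 1 + x) 0
      (ContinuousLinearMap.id ℝ E) :=
    ((hasFDerivAt_id (0 : E)).const_add _).hasMFDerivAt
  have hs : MDifferentiableAt 𝓘(ℝ, E) 𝓘(ℝ, E) (extChartAt 𝓘(ℝ, E) (1 : G)).symm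
      (extChartAt 𝓘(ℝ, E) (1 : G) 1 + 0) := by
    rw [add_zero]
    exact ((contMDiffOn_extChartAt_symm (I := 𝓘(ℝ, E)) (n := ∞) (1 : G)).contMDiffAt
      (extChartAt_target_mem_nhds (1 : G))).mdifferentiableAt (by simp)
  have h3 := (hs.hasMFDerivAt.comp (0 : E) h2).mfderiv
  have h4 : ∀ y, y = extChartAt 𝓘(ℝ, E) (1 : G) 1 →
      (mfderiv 𝓘(ℝ, E) 𝓘(ℝ, E) (extChartAt 𝓘(ℝ, E) (1 : G)).symm y : E →L[ℝ] E)
        = ContinuousLinearMap.id ℝ E := by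
    rintro y rfl
    exact h1
  have h5 := h4 _ (add_zero _)
  refine h3.trans ?_
  ext v
  exact congrArg (fun T : E →L[ℝ] E => T v) h5

theorem leftDiff_one (v : E) : leftDiff E (1 : G) v = v := by
  have h : (fun q : G => 1 * q) = id := funext one_mul
  change mfderiv 𝓘(ℝ, E) 𝓘(ℝ, E) (fun q : G => 1 * q) 1 v = v
  rw [h, mfderiv_id]
  rfl

/-- In the chart, the left-invariant vector field defined by `v` is `x ↦ ∂₂ μ (x, 0) v` for the
local multiplication `μ`. -/
theorem eventually_mfderiv_lieChartSymm (v : E) : ∀ᶠ x in 𝓝 (0 : E),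
    mfderiv 𝓘(ℝ, E) 𝓘(ℝ, E) (lieChartSymm E G) x (fderiv ℝ (localMul E G) (x, 0) (0, v))
      = leftDiff E (lieChartSymm E G x) v := by
  have hd : ∀ᶠ p in 𝓝 (0 : E × E), DifferentiableAt ℝ (localMul E G) p :=
    (((contDiffAt_localMul E (G := G)).of_le (m := 1) (by simp)).eventually (by simp)).mono
      fun p hp => hp.differentiableAt (by simp)
  have ht : Tendsto (fun x : E => (x, (0 : E))) (𝓝 0) (𝓝 0) :=
    (Continuous.prodMk_left (0 : E)).tendsto' _ _ rfl
  filter_upwards [eventually_contMDiffAt_lieChartSymm E (G := G), ht.eventually hd,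
    ht.eventually (eventually_lieChartSymm_localMul E (G := G)).eventually_nhds,
    eventually_localMul_zero E (G := G)] with x h1 h2 h3 h4
  have e1 : HasFDerivAt (fun y => localMul E G (x, y))
      ((fderiv ℝ (localMul E G) (x, 0)).comp (ContinuousLinearMap.inr ℝ E E)) 0 :=
    HasFDerivAt.comp (f := fun y : E => (x, y)) (0 : E) h2.hasFDerivAt
      (hasFDerivAt_prodMk_right x 0)
  have h1' : MDifferentiableAt 𝓘(ℝ, E) 𝓘(ℝ, E) (lieChartSymm E G) (localMul E G (x, 0)) := by
    rw [h4]; exact h1.mdifferentiableAt (by simp)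
  have e2 := h1'.hasMFDerivAt.comp (0 : E) e1.hasMFDerivAt
  have h0 : MDifferentiableAt 𝓘(ℝ, E) 𝓘(ℝ, E) (lieChartSymm E G) 0 :=
    (eventually_contMDiffAt_lieChartSymm E (G := G)).self_of_nhds.mdifferentiableAt (by simp)
  have e3 := (mdifferentiableAt_mul_left E (lieChartSymm E G x)
    (lieChartSymm E G 0)).hasMFDerivAt.comp (0 : E) h0.hasMFDerivAt
  have hy : Tendsto (fun y : E => (x, y)) (𝓝 0) (𝓝 (x, 0)) :=
    (Continuous.prodMk_right x).tendsto' _ _ rfl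
  have e4 : (fun q => lieChartSymm E G x * q) ∘ lieChartSymm E G
      =ᶠ[𝓝 0] lieChartSymm E G ∘ fun y => localMul E G (x, y) := by
    filter_upwards [hy.eventually h3] with y hy using hy.symm
  have e5 : ∀ (A B : E →L[ℝ] E) (F : E → G),
      HasMFDerivAt 𝓘(ℝ, E) 𝓘(ℝ, E) F 0 A → HasMFDerivAt 𝓘(ℝ, E) 𝓘(ℝ, E) F 0 B → A = B :=
    fun A B F hA hB => hasMFDerivAt_unique hA hB
  have e6 := e5 _ _ _ e3 (e2.congr_of_eventuallyEq e4)
  have e7 := congrArg (fun T : E →L[ℝ] E => T v) e6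
  have e8 : ∀ y, y = x → mfderiv 𝓘(ℝ, E) 𝓘(ℝ, E) (lieChartSymm E G) y
      (fderiv ℝ (localMul E G) (x, 0) (0, v))
      = (mfderiv 𝓘(ℝ, E) 𝓘(ℝ, E) (lieChartSymm E G) x
        (fderiv ℝ (localMul E G) (x, 0) (0, v)) : E) := by
    rintro y rfl; rfl
  have e9 : ∀ (q : G) (w : E), q = 1 → w = v →
      (mfderiv 𝓘(ℝ, E) 𝓘(ℝ, E) (fun q => lieChartSymm E G x * q) q w : E)
      = leftDiff E (lieChartSymm E G x) v := by
    rintro q w rfl rfl; rfl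
  have e10 : (mfderiv 𝓘(ℝ, E) 𝓘(ℝ, E) (lieChartSymm E G) 0 : E →L[ℝ] E) v = v := by
    rw [mfderiv_lieChartSymm_zero]; rfl
  exact ((e8 _ h4).symm.trans e7.symm).trans (e9 _ _ (lieChartSymm_zero E) e10)

variable [FiniteDimensional ℝ E]

theorem eventually_inverse_mfderiv_lieChartSymm : ∀ᶠ x in 𝓝 (0 : E), ∀ w : E,
    (mfderiv 𝓘(ℝ, E) 𝓘(ℝ, E) (lieChartSymm E G) x).inverse
      (mfderiv 𝓘(ℝ, E) 𝓘(ℝ, E) (lieChartSymm E G) x w) = w := by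
  filter_upwards [eventually_contMDiffAt_lieChartSymm E (G := G),
    (tendsto_lieChartSymm E).eventually (eventually_contMDiffAt_lieChart E (G := G)),
    (eventually_lieChart_lieChartSymm E (G := G)).eventually_nhds] with x h1 h2 h3 w
  have e1 := (h2.mdifferentiableAt (by simp)).hasMFDerivAt.comp x
    (h1.mdifferentiableAt (by simp)).hasMFDerivAt
  have e2 : HasMFDerivAt 𝓘(ℝ, E) 𝓘(ℝ, E) (fun y : E => y) x (ContinuousLinearMap.id ℝ E) :=
    hasMFDerivAt_id x
  have e3 := hasMFDerivAt_unique e2 (e1.congr_of_eventuallyEq (h3.mono fun y hy => hy.symm))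
  set T : E →L[ℝ] E := mfderiv 𝓘(ℝ, E) 𝓘(ℝ, E) (lieChartSymm E G) x
  set S : E →L[ℝ] E := mfderiv 𝓘(ℝ, E) 𝓘(ℝ, E) (lieChart E) (lieChartSymm E G x)
  have e4 : ∀ w, S (T w) = w := fun w => (congrArg (fun T : E →L[ℝ] E => T w) e3).symm
  have e5 : (T : E →ₗ[ℝ] E) * (S : E →ₗ[ℝ] E) = 1 :=
    mul_eq_one_comm.mp (LinearMap.ext e4)
  have e6 : T.inverse = S := by
    refine ContinuousLinearMap.inverse_eq ?_ ?_
    · ext w; exact congrArg (fun T : E →ₗ[ℝ] E => T w) e5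
    · ext w; exact e4 w
  change T.inverse (T w) = w
  rw [e6, e4]

/-- The bracket of the Lie algebra is the skew-symmetrization of the second order term of the
multiplication. -/
theorem lieGroupBracket_eq_crossDeriv (u v : E) :
    lieGroupBracket E G u v
      = crossDeriv (localMul E G) u v - crossDeriv (localMul E G) v u := by
  have := FiniteDimensional.complete ℝ E
  have : IsManifold 𝓘(ℝ, E) (minSmoothness ℝ 2) G := .of_le (minSmoothness_le_infty 2) (n := ∞)
  have hV : ∀ v : E, mpullback 𝓘(ℝ, E) 𝓘(ℝ, E) (lieChartSymm E G)
      (fun q : G => (leftDiff E q v : TangentSpace 𝓘(ℝ, E) q))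
      =ᶠ[𝓝 0] fun x : E => fderiv ℝ (localMul E G) (x, 0) (0, v) := by
    intro v
    filter_upwards [eventually_mfderiv_lieChartSymm E (G := G) v,
      eventually_inverse_mfderiv_lieChartSymm E (G := G)] with x h1 h2
    rw [mpullback_apply, ← h1]
    exact h2 _
  have hinv : ∀ w : E, (mfderiv 𝓘(ℝ, E) 𝓘(ℝ, E) (lieChartSymm E G) 0).inverse w = w := by
    intro w
    have h : ∀ T : E →L[ℝ] E, T = ContinuousLinearMap.id ℝ E → T.inverse w = w := by
      rintro T rfl
      simp
    exact h _ (mfderiv_lieChartSymm_zero E)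
  have h := mpullback_mlieBracket (I := 𝓘(ℝ, E)) (I' := 𝓘(ℝ, E)) (x₀ := (0 : E))
    (f := lieChartSymm E G)
    ((contMDiff_leftDiff E u _).mdifferentiableAt (by simp))
    ((contMDiff_leftDiff E v _).mdifferentiableAt (by simp))
    (eventually_contMDiffAt_lieChartSymm E (G := G)).self_of_nhds (minSmoothness_le_infty 2)
  rw [mpullback_apply, mlieBracket_leftDiff] at h
  have h1 : ∀ g : G, g = 1 → leftDiff E g (lieGroupBracket E G u v) = lieGroupBracket E G u v := by
    rintro g rfl
    exact leftDiff_one E _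
  have h2 : (mfderiv 𝓘(ℝ, E) 𝓘(ℝ, E) (lieChartSymm E G) 0).inverse
      (leftDiff E (lieChartSymm E G 0) (lieGroupBracket E G u v)) = lieGroupBracket E G u v :=
    (hinv _).trans (h1 _ (lieChartSymm_zero E))
  have h3 : ∀ V W : VField E E, mlieBracket 𝓘(ℝ, E) V W (0 : E) = lieBracket ℝ V W 0 :=
    fun V W => (congrFun (mlieBracketWithin_eq_lieBracketWithin (V := V) (W := W) (s := Set.univ))
      0).trans (congrFun (lieBracketWithin_univ (V := V) (W := W)) 0)
  refine (h2.symm.trans h).trans ((h3 _ _).trans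
    ((Filter.EventuallyEq.lieBracket_vectorField_eq (hV u) (hV v)).trans ?_))
  have hc : ContDiffAt ℝ 2 (localMul E G) 0 := (contDiffAt_localMul E).of_le
    (mod_cast (minSmoothness_le_infty 2).trans' le_minSmoothness)
  have hd : ∀ v : E, HasFDerivAt (fun x : E => fderiv ℝ (localMul E G) (x, 0) (0, v))
      ((crossDeriv (localMul E G)).flip v) 0 := fun v =>
    (hasFDerivAt_partialDeriv_left hc).clm_apply (hasFDerivAt_const v 0) |>.congr_fderiv (by
      ext w; simp)
  have h0 : ∀ v : E, fderiv ℝ (localMul E G) ((0 : E), (0 : E)) (0, v) = v := by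
    intro v
    have h3 := (mfderiv_lieChartSymm_zero E (G := G))
    have h4 := (eventually_mfderiv_lieChartSymm E (G := G) v).self_of_nhds
    rw [h3] at h4
    have h5 : ∀ g : G, g = 1 → leftDiff E g v = v := by
      rintro g rfl
      exact leftDiff_one E _
    exact h4.trans (h5 _ (lieChartSymm_zero E))
  rw [lieBracket, (hd u).fderiv, (hd v).fderiv, h0, h0]
  rfl

end LieChart

/-! ### The derived series of the Lie algebra -/

section Solvable

open Filter Asymptotics
open scoped Topology

/-- The iterated brackets spanning the derived series: the words of level `n + 1` are the brackets of
two words of level `n`. -/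
def derivedWords {V : Type*} [AddCommGroup V] [Module ℝ V] (br : V →ₗ[ℝ] V →ₗ[ℝ] V) : ℕ → Set V
  | 0 => Set.univ
  | n + 1 => Set.image2 (fun u v => br u v) (derivedWords br n) (derivedWords br n)

theorem span_derivedWords {V : Type*} [AddCommGroup V] [Module ℝ V] (br : V →ₗ[ℝ] V →ₗ[ℝ] V)
    (n : ℕ) : Submodule.span ℝ (derivedWords br n) = derivedSpace br n := by
  induction n with
  | zero => exact Submodule.span_univ
  | succ n ih => rw [derivedSpace, ← ih, Submodule.map₂_span_span, derivedWords]

variable (E : Type*) [NormedAddCommGroup E] [NormedSpace ℝ E] [FiniteDimensional ℝ E]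
  (G : Type*) [TopologicalSpace G] [ChartedSpace E G] [Group G] [LieGroup 𝓘(ℝ, E) ∞ G]

/-- Iterated commutators of curves through `1` realize iterated brackets as their leading terms. -/
theorem exists_curve_derivedSeries (n : ℕ) {α : E}
    (hα : α ∈ derivedWords (lieGroupBracket E G) n) :
    ∃ c : ℝ → G, (∀ t, c t ∈ derivedSeries G n) ∧ Tendsto c (𝓝[>] 0) (𝓝 1) ∧
      (fun t => lieChart E (c t) - t ^ 2 ^ n • α) =o[𝓝[>] 0] fun t => t ^ 2 ^ n := by
  have htg := topologicalGroup_of_lieGroup 𝓘(ℝ, E) ∞ (G := G)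
  induction n generalizing α with
  | zero =>
    have h0 : Tendsto (fun t : ℝ => t • α) (𝓝[>] 0) (𝓝 0) :=
      ((continuous_id.smul continuous_const).tendsto' _ _ (zero_smul ℝ α)).mono_left
        nhdsWithin_le_nhds
    refine ⟨fun t => lieChartSymm E G (t • α), fun t => by simp,
      (tendsto_lieChartSymm E).comp h0, ?_⟩
    refine (isLittleO_zero _ _).congr' ?_ EventuallyEq.rfl
    filter_upwards [h0.eventually (eventually_lieChart_lieChartSymm E (G := G))] with t ht
    simp [ht]
  | succ n ih =>
    obtain ⟨u, hu, v, hv, rfl⟩ := hα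
    obtain ⟨a, ha, ha1, hau⟩ := ih hu
    obtain ⟨b, hb, hb1, hbv⟩ := ih hv
    have hc1 : Tendsto (fun t => a t * b t * (a t)⁻¹ * (b t)⁻¹) (𝓝[>] 0) (𝓝 1) := by
      simpa using ((ha1.mul hb1).mul ha1.inv).mul hb1.inv
    refine ⟨fun t => a t * b t * (a t)⁻¹ * (b t)⁻¹, fun t => ?_, hc1, ?_⟩
    · rw [derivedSeries_succ]
      exact Subgroup.commutator_mem_commutator (ha t) (hb t)
    have hτ : Tendsto (fun t : ℝ => t ^ 2 ^ n) (𝓝[>] 0) (𝓝 0) :=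
      ((continuous_pow _).tendsto' _ _ (zero_pow (by positivity))).mono_left nhdsWithin_le_nhds
    have hc : ContDiffAt ℝ 2 (localMul E G) 0 := (contDiffAt_localMul E).of_le
      (mod_cast (minSmoothness_le_infty 2).trans' le_minSmoothness)
    have key := isLittleO_commutator hc (eventually_localMul_zero E) (eventually_zero_localMul E)
      hτ hau hbv ((tendsto_lieChart E).comp hc1) (by
        have hba : Tendsto (fun t => b t * a t) (𝓝[>] 0) (𝓝 1) := by simpa using hb1.mul ha1
        have hloc := eventually_localMul_lieChart E (G := G)
        filter_upwards [(hb1.prodMk ha1).eventually hloc, (ha1.prodMk hb1).eventually hloc,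
          (hc1.prodMk hba).eventually hloc] with t h1 h2 h3
        rw [h1, h2, Function.comp_apply, h3]
        congr 1
        simp [mul_assoc])
    rw [← lieGroupBracket_eq_crossDeriv] at key
    simpa only [← pow_mul, ← pow_succ, Function.comp_def] using key

variable {G} in
/-- If the derived series of the group is trivial at level `n`, so is that of its Lie algebra: a
word of level `n` is the leading term of a curve in the trivial group. -/
theorem derivedSpace_eq_bot {n : ℕ} (h : derivedSeries G n = ⊥) :
    derivedSpace (lieGroupBracket E G) n = ⊥ := by
  rw [← span_derivedWords, Submodule.span_eq_bot]
  intro α hα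
  obtain ⟨c, hc, -, ho⟩ := exists_curve_derivedSeries E G n hα
  have hc1 : ∀ t, c t = 1 := fun t => by simpa [h] using hc t
  have h1 : (fun t : ℝ => t ^ 2 ^ n • α) =o[𝓝[>] 0] fun t : ℝ => t ^ 2 ^ n • (1 : ℝ) := by
    simpa [hc1, lieChart_one] using ho.neg_left
  have h2 : (fun _ : ℝ => α) =o[𝓝[>] 0] fun _ : ℝ => (1 : ℝ) := by
    rw [isLittleO_iff] at h1 ⊢
    intro ε hε
    filter_upwards [h1 hε, self_mem_nhdsWithin] with t ht (ht0 : 0 < t)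
    rw [norm_smul, norm_smul] at ht
    have : 0 < ‖t ^ 2 ^ n‖ := norm_pos_iff.mpr (by positivity)
    nlinarith
  exact isLittleO_const_const_iff.mp h2

theorem exists_derivedSpace_eq_bot (hG : Group.IsSolvable G) :
    ∃ n, derivedSpace (lieGroupBracket E G) n = ⊥ :=
  hG.solvable.imp fun _ h => derivedSpace_eq_bot E h

end Solvable

/-! ### The flow of invariant metrics -/

section Reduction

variable {E : Type*} [NormedAddCommGroup E] [NormedSpace ℝ E] [FiniteDimensional ℝ E]
variable {M : Type*} [TopologicalSpace M] [ChartedSpace E M] [IsManifold 𝓘(ℝ, E) ∞ M]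

namespace Framing

variable {Φ : Framing E M} {J : ComplexStructure E M} {J₀ : E →ₗ[ℝ] E}

variable (Φ) in
/-- The components of a metric in the frame at the point `x`. -/
noncomputable def components (g : Metric E M) (x : M) : E →ₗ[ℝ] E →ₗ[ℝ] ℝ :=
  LinearMap.mk₂ ℝ (fun u v => g.inner x (Φ.frame x u) (Φ.frame x v))
    (fun u u' v => by simp) (fun c u v => by simp) (fun u v v' => by simp) (fun c u v => by simp)

variable (hJ : ∀ x v, J x (Φ.frame x v) = Φ.frame x (J₀ v))
include hJ

/-- The components of a Hermitian metric at a point have an orthonormal basis, which is a Parseval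
frame. -/
theorem exists_isParsevalFrame {g : Metric E M} {g₀ : E →ₗ[ℝ] E →ₗ[ℝ] ℝ} (hH : IsHermitian J g)
    (x : M) (hg : ∀ u v, g.inner x (Φ.frame x u) (Φ.frame x v) = g₀ u v) :
    ∃ e : Fin (Module.finrank ℝ E) → E, IsParsevalFrame J₀ g₀ e ∧
      ∀ a b, g₀ (e a) (e b) = if a = b then 1 else 0 := by
  refine Pluriclosed.exists_isParsevalFrame (fun u v => ?_) (fun u v => ?_) fun u hu => ?_
  · rw [← hg, ← hg, g.symm]
  · rw [← hg, ← hg, ← hJ, ← hJ, hH]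
  · rw [← hg]
    exact g.pos x _ fun h => hu ((Φ.frame x).map_eq_zero_iff.mp h)

variable {g : ℝ → Metric E M} {k : ℝ → E →ₗ[ℝ] E →ₗ[ℝ] ℝ} {s : Set ℝ}
  (hg : ∀ t ∈ s, ∀ x u v, (g t).inner x (Φ.frame x u) (Φ.frame x v) = k t u v)
include hg

/-- A family of metrics with constant components is a solution of the pluriclosed flow as soon as
the components solve the corresponding ordinary differential equation. -/
theorem isPluriclosedFlow [Nonempty M] {ι : Type*} [Fintype ι]
    (hk : ∀ t ∈ s, ∃ e : ι → E, IsParsevalFrame J₀ (k t) e ∧ ∀ u v,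
      HasDerivWithinAt (fun τ => k τ u v) (velocityForm Φ.bracket J₀ (k t) e u v) s t) :
    IsPluriclosedFlow J g s := by
  intro t ht
  obtain ⟨e, he, hd⟩ := hk t ht
  obtain ⟨A, hA⟩ := exists_isChernForm (isComplexLie hJ) he
  have hC := isChernConnection_connection hJ (hg t ht) hA
  refine ⟨fun x u v => ?_, Φ.connection A, hC, fun x f hf u v => ?_⟩
  · obtain ⟨u, rfl⟩ := (Φ.frame x).surjective u
    obtain ⟨v, rfl⟩ := (Φ.frame x).surjective v
    rw [hJ, hJ, hg t ht, hg t ht, he.inv]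
  · obtain ⟨u, rfl⟩ := (Φ.frame x).surjective u
    obtain ⟨v, rfl⟩ := (Φ.frame x).surjective v
    rw [velocity_eq hJ (hg t ht) hC he x hf u v]
    exact (hd u v).congr (fun τ hτ => hg τ hτ x u v) (hg t ht x u v)

/-- The components of a solution of the pluriclosed flow with constant components solve the
corresponding ordinary differential equation. -/
theorem hasDerivWithinAt_of_isPluriclosedFlow [Nonempty M] (hf : IsPluriclosedFlow J g s) :
    ∀ t ∈ s, ∃ e : Fin (Module.finrank ℝ E) → E, IsParsevalFrame J₀ (k t) e ∧ ∀ u v,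
      HasDerivWithinAt (fun τ => k τ u v) (velocityForm Φ.bracket J₀ (k t) e u v) s t := by
  intro t ht
  obtain ⟨x⟩ := ‹Nonempty M›
  obtain ⟨hH, nabla, hn, hd⟩ := hf t ht
  obtain ⟨e, he, heo⟩ := exists_isParsevalFrame hJ hH x (hg t ht x)
  have ho : IsOrthonormalFrame (g t) x fun a => Φ.frame x (e a) := fun a b => by
    rw [hg t ht, heo]
  refine ⟨e, he, fun u v => ?_⟩
  rw [← velocity_eq hJ (hg t ht) hn he x ho u v]
  exact (hd x _ ho _ _).congr (fun τ hτ => (hg τ hτ x u v).symm) (hg t ht x u v).symm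

end Framing

end Reduction

end Pluriclosed

/-- Invariant solutions of the pluriclosed flow on a solvmanifold exist for all positive times: the
flow starting at an invariant SKT metric `g₀` has an invariant solution on `[0, ∞)`, and every
invariant solution on an interval `[0, T)` starting at `g₀` is its restriction. -/
theorem corollaryB
    {E : Type*} [NormedAddCommGroup E] [NormedSpace ℝ E] [FiniteDimensional ℝ E]
    {G : Type*} [TopologicalSpace G] [ChartedSpace E G] [Group G] [LieGroup 𝓘(ℝ, E) ∞ G]
    (hG : Group.IsSolvable G)
    {M : Type*} [TopologicalSpace M] [ChartedSpace E M] [IsManifold 𝓘(ℝ, E) ∞ M]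
    (Γ : Subgroup G) (proj : G → M) (hproj : Pluriclosed.IsDiscreteQuotient E Γ proj)
    (J : Pluriclosed.ComplexStructure E M) (hJ : Pluriclosed.IsInvariantComplexStructure proj J)
    (g₀ : Pluriclosed.Metric E M) (hg₀ : Pluriclosed.IsInvariantMetric proj g₀)
    (hHerm : Pluriclosed.IsHermitian J g₀) (hSKT : Pluriclosed.IsPluriclosed J g₀) :
    ∃ g : ℝ → Pluriclosed.Metric E M,
      g 0 = g₀ ∧
      (∀ t, 0 ≤ t → Pluriclosed.IsInvariantMetric proj (g t)) ∧
      Pluriclosed.IsPluriclosedFlow J g (Set.Ici 0) ∧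
      ∀ (T : ℝ) (h : ℝ → Pluriclosed.Metric E M),
        h 0 = g₀ →
        (∀ t ∈ Set.Ico 0 T, Pluriclosed.IsInvariantMetric proj (h t)) →
        Pluriclosed.IsPluriclosedFlow J h (Set.Ico 0 T) →
        ∀ t ∈ Set.Ico 0 T, h t = g t := by
  have : Nonempty M := ⟨proj 1⟩
  let Φ := hproj.framing
  obtain ⟨J₀, hJ₀⟩ := hproj.exists_apply_frame hJ
  have hJ₀ : ∀ x v, J x (Φ.frame x v) = Φ.frame x (J₀ v) := hJ₀
  -- the components of an invariant metric are constant
  have hcomp : ∀ g : Pluriclosed.Metric E M, Pluriclosed.IsInvariantMetric proj g → ∀ x u v,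
      g.inner x (Φ.frame x u) (Φ.frame x v) = Φ.components g (proj 1) u v :=
    fun g hg x u v => hproj.inner_frame hg x u v
  obtain ⟨e₀, he₀, -⟩ := Pluriclosed.Framing.exists_isParsevalFrame hJ₀ hHerm (proj 1)
    (g₀ := Φ.components g₀ (proj 1)) fun u v => rfl
  have hH := Pluriclosed.Framing.bismutTorsionDeriv_eq_zero hJ₀ (hcomp g₀ hg₀) he₀.inv hSKT
  obtain ⟨n, hn⟩ := Pluriclosed.exists_derivedSpace_eq_bot E G hG
  obtain ⟨k, e, hk0, hk⟩ := Pluriclosed.exists_flow (Pluriclosed.Framing.isComplexLie hJ₀)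
    (by simp) hn he₀ hH
  have hv : ∀ t ∈ Set.Ici (0 : ℝ), ∀ u v, HasDerivWithinAt (fun s => k s u v)
      (Pluriclosed.velocityForm Φ.bracket J₀ (k t) (e t) u v) (Set.Ici 0) t := by
    intro t ht u v
    obtain ⟨-, hHt, hd⟩ := hk t ht
    simpa [Pluriclosed.velocityForm, hHt] using hd u v
  classical
  -- The statement does not concern negative times; the value there is arbitrary.
  let g : ℝ → Pluriclosed.Metric E M := fun t => if ht : 0 ≤ t then Φ.metric (hk t ht).1 else g₀
  have hg : ∀ t ∈ Set.Ici (0 : ℝ), ∀ x u v,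
      (g t).inner x (Φ.frame x u) (Φ.frame x v) = k t u v := by
    intro t ht x u v
    have h : g t = Φ.metric (hk t ht).1 := dif_pos ht
    rw [h, Pluriclosed.Framing.metric_frame]
  have hg0 : g 0 = g₀ := Pluriclosed.Framing.metric_ext (Φ := Φ) fun x u v => by
    rw [hg 0 Set.self_mem_Ici, hk0, hcomp g₀ hg₀]
  refine ⟨g, hg0, fun t ht => hproj.isInvariantMetric (hg t ht),
    Pluriclosed.Framing.isPluriclosedFlow hJ₀ hg fun t ht => ⟨e t, (hk t ht).1, hv t ht⟩, ?_⟩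
  intro T h h0 hinv hflow t ht
  have hu := Pluriclosed.velocityForm_flow_unique
    (g := fun t => Φ.components (h t) (proj 1)) (h := k) (T := T)
    (by simp only [h0, hk0])
    (Pluriclosed.Framing.hasDerivWithinAt_of_isPluriclosedFlow hJ₀
      (fun t ht => hcomp (h t) (hinv t ht)) hflow)
    (fun t ht => ⟨e t, (hk t ht.1).1, fun u v => (hv t ht.1 u v).mono fun _ hs => hs.1⟩) t ht
  refine Pluriclosed.Framing.metric_ext (Φ := Φ) fun x u v => ?_
  rw [hcomp (h t) (hinv t ht), hg t ht.1]
  exact congrArg (fun b => b u v) hu
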